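/- **Setting.** Let $k$ be a field and $\mathcal C$ a $k$-linear Krull–Schmidt triangulated category with an isomorphism of functors $\beta:[2]\simeq \mathrm{id}$ (a *cyclic category*). Fix a homomorphism $v:K_0(\mathcal C)\to\Lambda$ to a lattice of finite rank. *Real decompositions.* A real decomposition $q$ is a grading by subspaces $\mathrm{Hom}(E,F)=\bigoplus_{a\in\mathbb R}\mathrm{Hom}_a(E,F)$ for all indecomposable $E,F$, such that shifts preserve degrees, degrees add under composition, $\mathrm{id}_E$ and $\beta_E$ (and the structure isomorphisms of the shift) have degree $0$, and homogeneous isomorphisms have degree $0$. For $f\ne0$ homogeneous, $q(f)$ is its degree. A *connecting path* $l:E\dashrightarrow F$ is a finite zigzag of nonzero homogeneous morphisms between indecomposables; $q(l)$ is the sum of their degrees, with sign $-1$ for arrows traversed backwards. $\mathcal C$ is *connective* if any two indecomposables are joined by a connecting path. *Diagrams.* In a diagram each object comes with a decomposition into indecomposables (decompositions of shifts being the shifted ones); its connecting paths are the ones formed by matrix entries of its morphisms, between summands of its objects. It is *liftable* if all matrix entries are homogeneous and every connecting loop in it has degree $0$, *connective* if any two summands of its objects are joined by a connecting path in it, and *locally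 liftable* if every simply connected subdiagram is liftable. $\mathcal C$ is *pre-liftable* if every liftable morphism $f:A\to B$ is part of a distinguished triangle $A\xrightarrow{f}B\xrightarrow{g}C\xrightarrow{h}A[1]$ whose long sequence of all shifts is liftable for some decomposition of $C$. A *basic loop* is $\beta_{A_i}\circ l[1]\circ l$, where $l:A_i\dashrightarrow A_i[1]$ is a connecting path in the diagram $A\to B\to C\to A[1]$ of a distinguished triangle with decomposed objects such that no matrix entry of $f,g,h$ is an isomorphism and the hexagon $A\to B\to C\to A[1]\to B[1]\to C[1]\to A$ (last arrow $\beta_A\circ h[1]$) is locally liftable. Its *Maslov index* is $(q(l)-1)/2$. $\mathcal C$ is *liftable* if it is pre-liftable and all Maslov indices vanish. *Stability conditions.* A *charge triple* $(Z,\phi,q)$ consists of a homomorphism $Z:K_0(\mathcal C)\to\mathbb C$ that factors through $v$, a phase $\phi(E)\in(0,2]$ for each indecomposable $E$, and a real decomposition $q$, with $\phi(E[1])\equiv\phi(E)+1$, $Z(E)\in\mathbb R_{\ge0}e^{i\pi\phi(E)}$, and $q(f)\equiv\phi(F)-\phi(E)$ mod $2\mathbb Z$ for nonzero homogeneous $f:E\to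 F$. A *stability condition* $(\mathcal Q,Z,\phi,q)$ consists of a charge triple, with $\mathcal C$ pre-liftable for $q$, and strictly full additive subcategories $\mathcal Q(\psi)$, $\psi\in(0,2]$, closed under direct summands, such that: $\mathcal Q(\psi)[1]=\mathcal Q(\psi')$ if $\psi'\equiv\psi+1$ mod $2$; an indecomposable $E\in\mathcal Q(\psi)$ has $\phi(E)=\psi$ and $Z(E)\neq0$; nonzero homogeneous morphisms between indecomposable semistable objects have degree $\ge0$; and every indecomposable $E$ has a *Harder–Narasimhan filtration*: objects $0=E_0\to E_1\to\dots\to E_n=E$ and distinguished triangles $E_{i-1}\to E_i\to Q_i\to E_{i-1}[1]$ with $0\ne Q_i$ semistable, and decompositions (trivial for $E_n$) for which the diagram of the $E_i,Q_i$ is connective and liftable, its completion by all shifts of the triangles is liftable, and for each $i\ge2$ there is $c_i<0$ such that any summands of $Q_{i-1}$ and $Q_i$ are joined by a simple connecting path in the latter diagram and all such paths have degree $c_i$. Two charge triples $R_1,R_2$ are *deformation equivalent* if for all zigzags $l_1,l_2:E\dashrightarrow F$ of morphisms between indecomposables, $l_1,l_2$ are connecting paths for $R_1$ iff they are for $R_2$,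 and then $q_1(l_1)-q_1(l_2)=q_2(l_1)-q_2(l_2)$. A stability condition is *good* if Harder–Narasimhan filtrations of indecomposables are unique up to isomorphism. Good stability conditions are *equivalent*, $\sigma_1\simeq\sigma_2$, if $\mathcal Q_1=\mathcal Q_2$, $Z_1=Z_2$, they have the same homogeneous morphisms, the Harder–Narasimhan filtrations of each indecomposable with respect to both are isomorphic, and $q_1(l)=q_2(l)$ for all connecting paths between indecomposable semistable objects. *The $\mathbb Z$-lift.* For a charge triple $(Z,\phi,q)$, objects of $\widetilde{\mathcal C}$ are finite direct sums of pairs $(E,\theta)$, $E$ indecomposable, $\theta\in\phi(E)+2\mathbb Z$, with $\mathrm{Hom}((E,\theta),(F,\theta'))=\mathrm{Hom}_{\theta'-\theta}(E,F)$ and $(E,\theta)[1]=(E[1],\theta+1)$; $\pi:\widetilde{\mathcal C}\to\mathcal C$ is the forgetful functor, and a triangle of $\widetilde{\mathcal C}$ is distinguished iff its image under $\pi$ is. $\mathrm{Stab}(\widetilde{\mathcal C})$ is the set of Bridgeland stability conditions $(\mathcal P,\widetilde Z)$ on $\widetilde{\mathcal C}$ (without support property) whose central charge factors through $K_0(\widetilde{\mathcal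 C})\xrightarrow{\pi_0}K_0(\mathcal C)\xrightarrow{v}\Lambda$. **Theorem.** Let $\sigma$ be a stability condition on a connective cyclic category $\mathcal C$ that is liftable with respect to $\sigma$, let $\widetilde{\mathcal C}$ be the $\mathbb Z$-lift for the charge triple of $\sigma$, and let $\mathrm{Stab}^0_{cyc}(\mathcal C)$ be the set of stability conditions whose charge triple is deformation equivalent to that of $\sigma$. Then $\widetilde{\mathcal C}$ is pretriangulated (it satisfies the axioms of a triangulated category other than the octahedral axiom), all elements of $\mathrm{Stab}^0_{cyc}(\mathcal C)$ are good, $\simeq$ is an equivalence relation on this set, and there is a bijection $$\mathrm{Stab}(\widetilde{\mathcal C})/2\mathbb Z\;\xrightarrow{\ \sim\ }\;\mathrm{Stab}^{0,e}_{cyc}(\mathcal C)=\mathrm{Stab}^0_{cyc}(\mathcal C)/\simeq,$$ where $2m\in2\mathbb Z$ acts by $[2m]$. It sends the class of $\tau$ to the class of $\sigma_1=(\mathcal Q_1,Z_1,\phi_1,q_1)$ if and only if $\tau=H^*\pi_1^*\sigma_1$ for some equivalence $H:\widetilde{\mathcal C}\to\widetilde{\mathcal C}_1$ over $\mathcal C$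 to the $\mathbb Z$-lift $\pi_1:\widetilde{\mathcal C}_1\to\mathcal C$ for $\sigma_1$, given by $(E,\theta)\mapsto(E,h(E,\theta))$ with $h(E,\theta+2)=h(E,\theta)+2$ and by the identity on morphisms of $\mathcal C$. Here $\pi_1^*\sigma_1$ has central charge $Z_1\circ\pi_0$, and its semistable objects of phase $\psi$ are the direct sums of objects $(E,\psi)$ with $E\in\mathcal Q_1(\psi')$, $\psi'\in(0,2]$, $\psi'\equiv\psi$ mod $2$. -/

import Mathlib

open CategoryTheory CategoryTheory.Limits CategoryTheory.Pretriangulated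

noncomputable section

namespace CyclicStab

universe v u w w'

/-! ### Grothendieck groups and Bridgeland stability conditions -/

section Bridgeland

variable (D : Type u) [Category.{v} D] [Preadditive D] [HasShift D ℤ]

/-- The Grothendieck group of `D` with respect to a class `T` of distinguished triangles. -/
def K0 (T : Set (Triangle D)) : Type u :=
  FreeAbelianGroup D ⧸ AddSubgroup.closure
    {x : FreeAbelianGroup D | ∃ t ∈ T, x = FreeAbelianGroup.of t.obj₂
      - FreeAbelianGroup.of t.obj₁ - FreeAbelianGroup.of t.obj₃}

instance (T : Set (Triangle D)) : AddCommGroup (K0 D T) :=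
  inferInstanceAs (AddCommGroup (_ ⧸ _))

variable {D}

/-- The class of an object in the Grothendieck group. -/
def K0.of (T : Set (Triangle D)) (X : D) : K0 D T :=
  QuotientAddGroup.mk' _ (FreeAbelianGroup.of X)

/-- A Bridgeland stability condition on a category with shift `D` and class of distinguished
triangles `T`, whose central charge factors through `v : K0 D → Λ`. -/
structure BridgelandStability (T : Set (Triangle D)) {Λ : Type w} [AddCommGroup Λ]
    (v : K0 D T →+ Λ) where
  /-- the central charge -/
  Z : K0 D T →+ ℂ
  factors : ∃ g : Λ →+ ℂ, Z = g.comp v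
  /-- the semistable objects of each phase: strictly full additive subcategories -/
  P : ℝ → ObjectProperty D
  iso_mem : ∀ (φ : ℝ) (X Y : D), (X ≅ Y) → P φ X → P φ Y
  zero_mem : ∀ (φ : ℝ) (X : D), IsZero X → P φ X
  sum_mem : ∀ (φ : ℝ) (X Y : D) (b : BinaryBicone X Y), b.IsBilimit →
    P φ X → P φ Y → P φ b.pt
  charge : ∀ (φ : ℝ) (X : D), P φ X → ¬ IsZero X →
    ∃ m : ℝ, 0 < m ∧ Z (K0.of T X) = m * Complex.exp (Complex.I * Real.pi * φ)
  shift : ∀ (φ : ℝ) (X : D), P φ X ↔ P (φ + 1) (X⟦(1 : ℤ)⟧)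
  hom_eq_zero : ∀ (φ₁ φ₂ : ℝ), φ₂ < φ₁ → ∀ (X Y : D), P φ₁ X → P φ₂ Y →
    ∀ f : X ⟶ Y, f = 0
  harderNarasimhan : ∀ X : D, ¬ IsZero X →
    ∃ (n : ℕ) (φ : Fin n → ℝ) (E : Fin (n + 1) → D) (A : Fin n → D)
      (f : ∀ i : Fin n, E i.castSucc ⟶ E i.succ) (p : ∀ i : Fin n, E i.succ ⟶ A i)
      (t : ∀ i : Fin n, A i ⟶ (E i.castSucc)⟦(1 : ℤ)⟧),
      StrictAnti φ ∧ IsZero (E 0) ∧ Nonempty (E (Fin.last n) ≅ X) ∧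
      ∀ i, Triangle.mk (f i) (p i) (t i) ∈ T ∧ P (φ i) (A i)

/-- `τ` is the image of `σ` under the shift `[2m]`, for some `m`: the relation whose classes are
the orbits of the action of `2ℤ` by even shifts, where an exact equivalence `H` acts by
`(H^* P)(φ) = {X | H X ∈ P(φ)}` and `(H^* Z)(X) = Z (H X)`. -/
def BridgelandStability.EvenShift {T : Set (Triangle D)} {Λ : Type w} [AddCommGroup Λ]
    {v : K0 D T →+ Λ} (σ τ : BridgelandStability T v) : Prop :=
  ∃ m : ℤ, (∀ (φ : ℝ) (X : D), τ.P φ X ↔ σ.P φ (X⟦2 * m⟧)) ∧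
    ∀ X : D, τ.Z (K0.of T X) = σ.Z (K0.of T (X⟦2 * m⟧))

end Bridgeland

section Cyclic

variable {C : Type u} [Category.{v} C] [HasZeroObject C] [Preadditive C] [HasShift C ℤ]
  [∀ n : ℤ, (shiftFunctor C n).Additive] [Pretriangulated C]

/-! ### Indecomposable objects and decompositions -/

variable (C) in
/-- Indecomposable objects (in particular nonzero). -/
structure IndecObj where
  obj : C
  indecomposable : Indecomposable obj

lemma indecomposable_shift {X : C} (hX : Indecomposable X) (n : ℤ) :
    Indecomposable (X⟦n⟧) := by
  have key : ∀ (Y : C) (m : ℤ), IsZero (Y⟦m⟧) → IsZero Y := fun Y m h => by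
    rw [IsZero.iff_id_eq_zero] at h ⊢
    apply (shiftFunctor C m).map_injective
    rw [CategoryTheory.Functor.map_id, Functor.map_zero, h]
  refine ⟨fun h => hX.1 (key _ _ h), fun Y Z e => ?_⟩
  have : PreservesBinaryBiproduct Y Z (shiftFunctor C (-n)) :=
    (preservesBinaryBiproducts_of_preservesBiproducts (shiftFunctor C (-n))).preserves
  let e' : X ≅ (Y⟦-n⟧) ⊞ (Z⟦-n⟧) :=
    (shiftShiftNeg X n).symm ≪≫ (shiftFunctor C (-n)).mapIso e ≪≫
      (shiftFunctor C (-n)).mapBiprod Y Z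
  rcases hX.2 _ _ e' with h | h
  · exact Or.inl (key _ _ h)
  · exact Or.inr (key _ _ h)

/-- The shift of an indecomposable object. -/
abbrev IndecObj.shift (E : IndecObj C) (n : ℤ) : IndecObj C :=
  ⟨E.obj⟦n⟧, indecomposable_shift E.indecomposable n⟩

/-- A decomposition of an object as a finite direct sum of indecomposable objects. -/
structure Decomposition (X : C) where
  n : ℕ
  summand : Fin n → IndecObj C
  inj : ∀ i, (summand i).obj ⟶ X
  proj : ∀ i, X ⟶ (summand i).obj
  inj_proj_self : ∀ i, inj i ≫ proj i = 𝟙 _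
  inj_proj_ne : ∀ i j, i ≠ j → inj i ≫ proj j = 0
  sum_proj_inj : ∑ i, proj i ≫ inj i = 𝟙 X

/-- The shift of a decomposition. -/
def Decomposition.shift {X : C} (d : Decomposition X) (n : ℤ) : Decomposition (X⟦n⟧) where
  n := d.n
  summand i := (d.summand i).shift n
  inj i := (d.inj i)⟦n⟧'
  proj i := (d.proj i)⟦n⟧'
  inj_proj_self i := by
    rw [← Functor.map_comp, d.inj_proj_self, CategoryTheory.Functor.map_id]
  inj_proj_ne i j h := by
    rw [← Functor.map_comp, d.inj_proj_ne i j h, Functor.map_zero]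
  sum_proj_inj := by
    simp only [← Functor.map_comp]
    rw [← Functor.map_sum, d.sum_proj_inj, CategoryTheory.Functor.map_id]

variable (C) in
/-- Krull-Schmidt categories. -/
def IsKrullSchmidt : Prop :=
  (∀ X : C, Nonempty (Decomposition X)) ∧ ∀ E : IndecObj C, IsLocalRing (End E.obj)

/-! ### Real decompositions -/

variable (k : Type w) [Field k] [Linear k C]

/-- A real decomposition of the cyclic category `C`, with Bott isomorphism `β`. As the shift of `C`
is not a strict action of `ℤ`, its structure isomorphisms are required to have degree `0`. -/
structure RealDecomposition (β : shiftFunctor C (2 : ℤ) ≅ 𝟭 C) where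
  /-- the homogeneous morphisms of a given degree -/
  hom : ∀ E F : IndecObj C, ℝ → Submodule k (E.obj ⟶ F.obj)
  isInternal : ∀ E F, DirectSum.IsInternal (hom E F)
  shift_mem : ∀ {E F : IndecObj C} {a : ℝ} {f : E.obj ⟶ F.obj} (n : ℤ), f ∈ hom E F a →
    f⟦n⟧' ∈ hom (E.shift n) (F.shift n) a
  comp_mem : ∀ {E F G : IndecObj C} {a b : ℝ} {f : E.obj ⟶ F.obj} {g : F.obj ⟶ G.obj},
    f ∈ hom E F a → g ∈ hom F G b → f ≫ g ∈ hom E G (a + b)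
  id_mem : ∀ E : IndecObj C, 𝟙 E.obj ∈ hom E E 0
  bott_mem : ∀ E : IndecObj C, β.hom.app E.obj ∈ hom (E.shift 2) E 0
  shiftZero_mem : ∀ E : IndecObj C,
    (shiftFunctorZero C ℤ).hom.app E.obj ∈ hom (E.shift 0) E 0
  shiftAdd_mem : ∀ (E : IndecObj C) (m n : ℤ),
    (shiftFunctorAdd C m n).hom.app E.obj ∈ hom (E.shift (m + n)) ((E.shift m).shift n) 0
  degree_iso : ∀ {E F : IndecObj C} {a : ℝ} {f : E.obj ⟶ F.obj}, IsIso f → f ∈ hom E F a → a = 0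

variable {k} {β : shiftFunctor C (2 : ℤ) ≅ 𝟭 C}

/-- Homogeneous morphisms (of some degree). -/
def RealDecomposition.IsHomogeneous (q : RealDecomposition k β) {E F : IndecObj C}
    (f : E.obj ⟶ F.obj) : Prop :=
  ∃ a : ℝ, f ∈ q.hom E F a

/-! ### Connecting paths and diagrams -/

/-- Zigzags of morphisms between indecomposable objects. -/
inductive Zigzag : IndecObj C → IndecObj C → Type (max u v)
  | nil (E : IndecObj C) : Zigzag E E
  | fwd {E F G : IndecObj C} (f : E.obj ⟶ F.obj) (l : Zigzag F G) : Zigzag E G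
  | bwd {E F G : IndecObj C} (f : F.obj ⟶ E.obj) (l : Zigzag F G) : Zigzag E G

/-- `l` is a connecting path for `q` (all its morphisms are nonzero and homogeneous), and its
degree `q(l)`, the signed sum of the degrees of its morphisms, is the given number. -/
def Zigzag.HasDegree (q : RealDecomposition k β) :
    ∀ {E F : IndecObj C}, Zigzag E F → ℝ → Prop
  | _, _, .nil _, a => a = 0
  | _, _, .fwd (E := E) (F := F) f l, a =>
      f ≠ 0 ∧ ∃ b c : ℝ, f ∈ q.hom E F b ∧ Zigzag.HasDegree q l c ∧ a = b + c
  | _, _, .bwd (E := E) (F := F) f l, a =>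
      f ≠ 0 ∧ ∃ b c : ℝ, f ∈ q.hom F E b ∧ Zigzag.HasDegree q l c ∧ a = -b + c

/-- `l` is a connecting path, i.e. homogeneous, for `q`. -/
def Zigzag.IsConnecting (q : RealDecomposition k β) {E F : IndecObj C} (l : Zigzag E F) : Prop :=
  ∃ a : ℝ, l.HasDegree q a

/-- Any two indecomposable objects are joined by a connecting path. -/
def RealDecomposition.Connective (q : RealDecomposition k β) : Prop :=
  ∀ E F : IndecObj C, ∃ l : Zigzag E F, l.IsConnecting q

variable (C) in
/-- A diagram in `C`, each of whose objects is written as a direct sum of indecomposables. -/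
structure Diagram where
  V : Type
  obj : V → C
  dec : ∀ v, Decomposition (obj v)
  Edge : V → V → Type
  map : ∀ {v w}, Edge v w → (obj v ⟶ obj w)

namespace Diagram

/-- The indecomposable summands of the objects of a diagram. -/
abbrev Node (D : Diagram C) : Type := Σ v : D.V, Fin (D.dec v).n

/-- The indecomposable object at a node. -/
abbrev summand (D : Diagram C) (x : D.Node) : IndecObj C := (D.dec x.1).summand x.2

/-- The direct summands (matrix entries) of a morphism in a diagram. -/
def comp (D : Diagram C) {v w : D.V} (e : D.Edge v w) (i : Fin (D.dec v).n)
    (j : Fin (D.dec w).n) : (D.summand ⟨v, i⟩).obj ⟶ (D.summand ⟨w, j⟩).obj :=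
  (D.dec v).inj i ≫ D.map e ≫ (D.dec w).proj j

/-- Zigzags of direct summands of morphisms in a diagram. -/
inductive Path (D : Diagram C) : D.Node → D.Node → Type
  | nil (x : D.Node) : Path D x x
  | fwd {v w : D.V} {z : D.Node} (e : D.Edge v w) (i : Fin (D.dec v).n) (j : Fin (D.dec w).n)
      (l : Path D ⟨w, j⟩ z) : Path D ⟨v, i⟩ z
  | bwd {v w : D.V} {z : D.Node} (e : D.Edge v w) (i : Fin (D.dec v).n) (j : Fin (D.dec w).n)
      (l : Path D ⟨v, i⟩ z) : Path D ⟨w, j⟩ z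

/-- The underlying zigzag in `C`. -/
def Path.toZigzag {D : Diagram C} :
    ∀ {x y : D.Node}, D.Path x y → Zigzag (D.summand x) (D.summand y)
  | _, _, .nil x => .nil (D.summand x)
  | _, _, .fwd e i j l => .fwd (D.comp e i j) l.toZigzag
  | _, _, .bwd e i j l => .bwd (D.comp e i j) l.toZigzag

/-- The nodes visited by a path. -/
def Path.nodes {D : Diagram C} : ∀ {x y : D.Node}, D.Path x y → List D.Node
  | _, _, .nil x => [x]
  | x, _, .fwd _ _ _ l => x :: l.nodes
  | x, _, .bwd _ _ _ l => x :: l.nodes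

/-- A path which contains no loop. -/
def Path.IsSimple {D : Diagram C} {x y : D.Node} (l : D.Path x y) : Prop := l.nodes.Nodup

/-- All morphisms are quasi-homogeneous and all connecting loops have degree `0`. -/
def Liftable (D : Diagram C) (q : RealDecomposition k β) : Prop :=
  (∀ (v w : D.V) (e : D.Edge v w) (i : Fin (D.dec v).n) (j : Fin (D.dec w).n),
    q.IsHomogeneous (D.comp e i j)) ∧
  ∀ (x : D.Node) (l : D.Path x x) (a : ℝ), l.toZigzag.HasDegree q a → a = 0

/-- Any two summands of objects of the diagram are joined by a connecting path in it. -/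
def Connective (D : Diagram C) (q : RealDecomposition k β) : Prop :=
  ∀ x y : D.Node, ∃ l : D.Path x y, l.toZigzag.IsConnecting q

/-- The subdiagram on a set of vertices and a set of edges. -/
def sub (D : Diagram C) (W : Set D.V) (S : ∀ v w, D.Edge v w → Prop) : Diagram C where
  V := W
  obj v := D.obj v
  dec v := D.dec v
  Edge v w := {e : D.Edge v w // S v w e}
  map e := D.map e.1

/-- The underlying graph of a diagram. -/
def graph (D : Diagram C) : SimpleGraph D.V :=
  SimpleGraph.fromRel fun v w => Nonempty (D.Edge v w)

/-- Every simply connected subdiagram is liftable. -/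
def LocallyLiftable (D : Diagram C) (q : RealDecomposition k β) : Prop :=
  ∀ (W : Set D.V) (S : ∀ v w, D.Edge v w → Prop),
    (D.sub W S).graph.IsTree → (D.sub W S).Liftable q

end Diagram

/-! ### Diagrams unrolled along the shift -/

variable (C) in
/-- A diagram with additional morphisms `X → Y[1]`. -/
structure ShiftDiagram where
  V : Type
  obj : V → C
  dec : ∀ v, Decomposition (obj v)
  Edge : V → V → Type
  map : ∀ {v w}, Edge v w → (obj v ⟶ obj w)
  Edge₁ : V → V → Type
  map₁ : ∀ {v w}, Edge₁ v w → (obj v ⟶ (obj w)⟦(1 : ℤ)⟧)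

namespace ShiftDiagram

/-- Forget the morphisms `X → Y[1]`. -/
def base (D : ShiftDiagram C) : Diagram C where
  V := D.V
  obj := D.obj
  dec := D.dec
  Edge := D.Edge
  map := D.map

/-- The edges of the unrolled diagram. -/
inductive UnrolledEdge (D : ShiftDiagram C) : D.V × ℤ → D.V × ℤ → Type
  | zero {v w : D.V} (e : D.Edge v w) (n : ℤ) : UnrolledEdge D (v, n) (w, n)
  | one {v w : D.V} (e : D.Edge₁ v w) (n : ℤ) : UnrolledEdge D (v, n) (w, 1 + n)

/-- The morphisms `f[n] : X[n] → Y[n]` and `t[n] : X[n] → Y[1][n] ≅ Y[n+1]`. -/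
def unrolledMap (D : ShiftDiagram C) : ∀ {x y : D.V × ℤ}, UnrolledEdge D x y →
    ((D.obj x.1)⟦x.2⟧ ⟶ (D.obj y.1)⟦y.2⟧)
  | _, _, .zero e n => (D.map e)⟦n⟧'
  | _, _, .one (w := w) e n =>
      (D.map₁ e)⟦n⟧' ≫ (shiftFunctorAdd C (1 : ℤ) n).inv.app (D.obj w)

/-- The infinite diagram of all the shifts `X[n]` of the objects of a diagram. -/
def unroll (D : ShiftDiagram C) : Diagram C where
  V := D.V × ℤ
  obj x := (D.obj x.1)⟦x.2⟧
  dec x := (D.dec x.1).shift x.2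
  Edge := UnrolledEdge D
  map := D.unrolledMap

end ShiftDiagram

/-! ### Pre-liftability -/

inductive ArrowEdge : Bool → Bool → Type
  | mk : ArrowEdge false true

/-- The diagram `X → Y` consisting of a single morphism. -/
def Diagram.arrow {X Y : C} (dX : Decomposition X) (dY : Decomposition Y) (f : X ⟶ Y) :
    Diagram C where
  V := Bool
  obj v := match v with
    | false => X
    | true => Y
  dec v := match v with
    | false => dX
    | true => dY
  Edge := ArrowEdge
  map e := match e with
    | .mk => f

variable (C) in
/-- A distinguished triangle `X → Y → Z → X[1]` of decomposed objects. -/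
structure DecTriangle where
  X : C
  Y : C
  Z : C
  dX : Decomposition X
  dY : Decomposition Y
  dZ : Decomposition Z
  f : X ⟶ Y
  g : Y ⟶ Z
  h : Z ⟶ X⟦(1 : ℤ)⟧
  distinguished : Triangle.mk f g h ∈ distTriang C

inductive TriVertex
  | X | Y | Z

inductive TriEdge : TriVertex → TriVertex → Type
  | f : TriEdge .X .Y
  | g : TriEdge .Y .Z

inductive TriEdge₁ : TriVertex → TriVertex → Type
  | h : TriEdge₁ .Z .X

/-- Its unrolled diagram is `⋯ → X → Y → Z → X[1] → Y[1] → ⋯`. -/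
def DecTriangle.diagram (t : DecTriangle C) : ShiftDiagram C where
  V := TriVertex
  obj v := match v with
    | .X => t.X
    | .Y => t.Y
    | .Z => t.Z
  dec v := match v with
    | .X => t.dX
    | .Y => t.dY
    | .Z => t.dZ
  Edge := TriEdge
  map e := match e with
    | .f => t.f
    | .g => t.g
  Edge₁ := TriEdge₁
  map₁ e := match e with
    | .h => t.h

/-- Every liftable quasi-homogeneous morphism can be completed to a distinguished triangle whose
long sequence is liftable. -/
def RealDecomposition.PreLiftable (q : RealDecomposition k β) : Prop :=
  ∀ (X Y : C) (dX : Decomposition X) (dY : Decomposition Y) (f : X ⟶ Y),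
    (Diagram.arrow dX dY f).Liftable q →
    ∃ (Z : C) (dZ : Decomposition Z) (g : Y ⟶ Z) (h : Z ⟶ X⟦(1 : ℤ)⟧)
      (hT : Triangle.mk f g h ∈ distTriang C),
      (DecTriangle.mk X Y Z dX dY dZ f g h hT).diagram.unroll.Liftable q

/-! ### Basic loops and Maslov indices -/

inductive HexVertex
  | X | Y | Z | X₁ | Y₁ | Z₁

inductive HexEdge : HexVertex → HexVertex → Type
  | f : HexEdge .X .Y
  | g : HexEdge .Y .Z
  | h : HexEdge .Z .X₁
  | f₁ : HexEdge .X₁ .Y₁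
  | g₁ : HexEdge .Y₁ .Z₁
  | h₁ : HexEdge .Z₁ .X

namespace DecTriangle

/-- The hexagon `X → Y → Z → X[1] → Y[1] → Z[1] → X`, closed up by the Bott isomorphism. -/
def hexagon (t : DecTriangle C) (β : shiftFunctor C (2 : ℤ) ≅ 𝟭 C) : Diagram C where
  V := HexVertex
  obj v := match v with
    | .X => t.X
    | .Y => t.Y
    | .Z => t.Z
    | .X₁ => t.X⟦(1 : ℤ)⟧
    | .Y₁ => t.Y⟦(1 : ℤ)⟧
    | .Z₁ => t.Z⟦(1 : ℤ)⟧
  dec v := match v with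
    | .X => t.dX
    | .Y => t.dY
    | .Z => t.dZ
    | .X₁ => t.dX.shift 1
    | .Y₁ => t.dY.shift 1
    | .Z₁ => t.dZ.shift 1
  Edge := HexEdge
  map e := match e with
    | .f => t.f
    | .g => t.g
    | .h => t.h
    | .f₁ => t.f⟦(1 : ℤ)⟧'
    | .g₁ => t.g⟦(1 : ℤ)⟧'
    | .h₁ => t.h⟦(1 : ℤ)⟧' ≫ (shiftFunctorAdd' C (1 : ℤ) 1 2 (by norm_num)).inv.app t.X ≫
        β.hom.app t.X

/-- The vertices `X, Y, Z, X[1]` of the triangle itself. -/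
def triangleVertices : Set HexVertex := {v | v = .X ∨ v = .Y ∨ v = .Z ∨ v = .X₁}

/-- The diagram `X → Y → Z → X[1]` inside the hexagon. -/
def triangle (t : DecTriangle C) (β : shiftFunctor C (2 : ℤ) ≅ 𝟭 C) : Diagram C :=
  (t.hexagon β).sub triangleVertices fun _ _ _ => True

/-- The node of a summand of `X` in the diagram `X → Y → Z → X[1]`. -/
def source (t : DecTriangle C) (β : shiftFunctor C (2 : ℤ) ≅ 𝟭 C) (i : Fin t.dX.n) :
    (t.triangle β).Node :=
  ⟨⟨.X, Or.inl rfl⟩, i⟩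

/-- The node of the shift of a summand of `X` in the diagram `X → Y → Z → X[1]`. -/
def target (t : DecTriangle C) (β : shiftFunctor C (2 : ℤ) ≅ 𝟭 C) (i : Fin t.dX.n) :
    (t.triangle β).Node :=
  ⟨⟨.X₁, Or.inr (Or.inr (Or.inr rfl))⟩, i⟩

/-- No direct summand of a morphism of the triangle is an isomorphism. As endomorphism rings of
indecomposables are local, this means that the triangle has no direct summand of the form
`K = K → 0 → K[1]`, or a rotation of it. -/
def Reduced (t : DecTriangle C) : Prop :=
  (∀ i j, ¬ IsIso (t.dX.inj i ≫ t.f ≫ t.dY.proj j)) ∧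
  (∀ i j, ¬ IsIso (t.dY.inj i ≫ t.g ≫ t.dZ.proj j)) ∧
  ∀ i j, ¬ IsIso (t.dZ.inj i ≫ t.h ≫ (t.dX.shift 1).proj j)

end DecTriangle

/-- A basic loop `β ∘ l[1] ∘ l`, for a connecting path `l` from a summand of `X` to its shift
inside the distinguished triangle of a reduced locally liftable hexagon. -/
structure BasicLoop (q : RealDecomposition k β) where
  t : DecTriangle C
  reduced : t.Reduced
  locallyLiftable : (t.hexagon β).LocallyLiftable q
  i : Fin t.dX.n
  path : (t.triangle β).Path (t.source β i) (t.target β i)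
  degree : ℝ
  hasDegree : path.toZigzag.HasDegree q degree

/-- The Maslov index of a basic loop. -/
def BasicLoop.maslov {q : RealDecomposition k β} (l : BasicLoop q) : ℝ := (l.degree - 1) / 2

/-- `C` is liftable with respect to `q`. -/
def RealDecomposition.IsLiftable (q : RealDecomposition k β) : Prop :=
  q.PreLiftable ∧ ∀ l : BasicLoop q, l.maslov = 0

/-! ### Harder-Narasimhan filtrations -/

/-- A filtration `0 = E₀ → E₁ → ⋯ → Eₙ ≅ E` with cones `Qᵢ`. -/
structure Filtration (E : IndecObj C) where
  n : ℕ
  obj : Fin (n + 1) → C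
  factor : Fin n → C
  f : ∀ i : Fin n, obj i.castSucc ⟶ obj i.succ
  p : ∀ i : Fin n, obj i.succ ⟶ factor i
  t : ∀ i : Fin n, factor i ⟶ (obj i.castSucc)⟦(1 : ℤ)⟧
  distinguished : ∀ i, Triangle.mk (f i) (p i) (t i) ∈ distTriang C
  isZero : IsZero (obj 0)
  e : obj (Fin.last n) ≅ E.obj

namespace Filtration

variable {E : IndecObj C}

/-- Isomorphic filtrations of `E`. -/
def Isomorphic (F G : Filtration E) : Prop :=
  ∃ (h : F.n = G.n)
    (a : ∀ i : Fin (F.n + 1), F.obj i ≅ G.obj (Fin.cast (congrArg (· + 1) h) i))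
    (b : ∀ i : Fin F.n, F.factor i ≅ G.factor (Fin.cast h i)),
    (∀ i : Fin F.n, F.f i ≫ (a i.succ).hom = (a i.castSucc).hom ≫ G.f (Fin.cast h i)) ∧
    (∀ i : Fin F.n, F.p i ≫ (b i).hom = (a i.succ).hom ≫ G.p (Fin.cast h i)) ∧
    (∀ i : Fin F.n, F.t i ≫ ((a i.castSucc).hom)⟦(1 : ℤ)⟧' = (b i).hom ≫ G.t (Fin.cast h i)) ∧
    (a (Fin.last F.n)).hom ≫
      eqToHom (congrArg G.obj (show Fin.cast _ (Fin.last F.n) = Fin.last G.n from Fin.ext h)) ≫ G.e.hom = F.e.hom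

inductive Edge (F : Filtration E) : Fin (F.n + 1) ⊕ Fin F.n → Fin (F.n + 1) ⊕ Fin F.n → Type
  | f (i : Fin F.n) : Edge F (.inl i.castSucc) (.inl i.succ)
  | p (i : Fin F.n) : Edge F (.inl i.succ) (.inr i)

inductive Edge₁ (F : Filtration E) : Fin (F.n + 1) ⊕ Fin F.n → Fin (F.n + 1) ⊕ Fin F.n → Type
  | t (i : Fin F.n) : Edge₁ F (.inr i) (.inl i.castSucc)

/-- The base of this is the diagram of the `Eᵢ` and `Qᵢ`; unrolled along the shift it is the
Harder-Narasimhan diagram. -/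
def diagram (F : Filtration E) (dE : ∀ i, Decomposition (F.obj i))
    (dQ : ∀ i, Decomposition (F.factor i)) : ShiftDiagram C where
  V := Fin (F.n + 1) ⊕ Fin F.n
  obj v := match v with
    | .inl i => F.obj i
    | .inr i => F.factor i
  dec v := match v with
    | .inl i => dE i
    | .inr i => dQ i
  Edge := F.Edge
  map e := match e with
    | .f i => F.f i
    | .p i => F.p i
  Edge₁ := F.Edge₁
  map₁ e := match e with
    | .t i => F.t i

/-- A summand of `Qᵢ`, as a node of the Harder-Narasimhan diagram. -/
def factorNode (F : Filtration E) (dE : ∀ i, Decomposition (F.obj i))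
    (dQ : ∀ i, Decomposition (F.factor i)) (i : Fin F.n) (j : Fin (dQ i).n) :
    (F.diagram dE dQ).unroll.Node :=
  ⟨(.inr i, 0), j⟩

/-- Harder-Narasimhan filtrations, for a real decomposition `q` and circle slicing `Q`. The object
`E` is its own decomposition, so the identification `Eₙ ≅ E` has to be homogeneous. -/
def IsHarderNarasimhan (F : Filtration E) (q : RealDecomposition k β)
    (Q : Set.Ioc (0 : ℝ) 2 → ObjectProperty C) : Prop :=
  ∃ (dE : ∀ i, Decomposition (F.obj i)) (dQ : ∀ i, Decomposition (F.factor i)),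
    (∀ j, q.IsHomogeneous (E := (dE (Fin.last F.n)).summand j) (F := E)
      ((dE (Fin.last F.n)).inj j ≫ F.e.hom)) ∧
    (F.diagram dE dQ).base.Connective q ∧
    (F.diagram dE dQ).base.Liftable q ∧
    (F.diagram dE dQ).unroll.Liftable q ∧
    (∀ i, ¬ IsZero (F.factor i) ∧ ∃ ψ, Q ψ (F.factor i)) ∧
    ∀ i i' : Fin F.n, (i : ℕ) + 1 = i' → ∃ c : ℝ, c < 0 ∧ ∀ j j',
      (∃ l : (F.diagram dE dQ).unroll.Path (F.factorNode dE dQ i j) (F.factorNode dE dQ i' j'),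
        l.IsSimple ∧ l.toZigzag.IsConnecting q) ∧
      ∀ l : (F.diagram dE dQ).unroll.Path (F.factorNode dE dQ i j) (F.factorNode dE dQ i' j'),
        l.IsSimple → ∀ a : ℝ, l.toZigzag.HasDegree q a → a = c

end Filtration

/-! ### Charge triples and stability conditions -/

variable {Λ : Type w'} [AddCommGroup Λ]

/-- Charge triples `(Z, φ, q)`. -/
structure ChargeTriple (k : Type w) [Field k] [Linear k C] (β : shiftFunctor C (2 : ℤ) ≅ 𝟭 C)
    (v : K0 C (distTriang C) →+ Λ) where
  /-- the central charge -/
  Z : K0 C (distTriang C) →+ ℂ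
  factors : ∃ g : Λ →+ ℂ, Z = g.comp v
  /-- the phases of the indecomposable objects -/
  phase : IndecObj C → ℝ
  phase_mem : ∀ E, phase E ∈ Set.Ioc (0 : ℝ) 2
  /-- the real decomposition -/
  q : RealDecomposition k β
  phase_shift : ∀ E, ∃ m : ℤ, phase (E.shift 1) = phase E + 1 + 2 * m
  charge : ∀ E, ∃ m : ℝ, 0 ≤ m ∧
    Z (K0.of _ E.obj) = m * Complex.exp (Complex.I * Real.pi * phase E)
  degree : ∀ (E F : IndecObj C) (f : E.obj ⟶ F.obj) (a : ℝ), f ≠ 0 → f ∈ q.hom E F a →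
    ∃ m : ℤ, a = phase F - phase E + 2 * m

/-- Stability conditions `(Q, Z, φ, q)` on a cyclic category. -/
structure StabilityCondition (k : Type w) [Field k] [Linear k C]
    (β : shiftFunctor C (2 : ℤ) ≅ 𝟭 C) (v : K0 C (distTriang C) →+ Λ)
    extends ChargeTriple k β v where
  preLiftable : q.PreLiftable
  /-- the circle slicing: strictly full additive subcategories, closed under direct summands -/
  Q : Set.Ioc (0 : ℝ) 2 → ObjectProperty C
  iso_mem : ∀ (ψ : Set.Ioc (0 : ℝ) 2) (X Y : C), (X ≅ Y) → Q ψ X → Q ψ Y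
  zero_mem : ∀ (ψ : Set.Ioc (0 : ℝ) 2) (X : C), IsZero X → Q ψ X
  sum_mem : ∀ (ψ : Set.Ioc (0 : ℝ) 2) (X Y : C), Q ψ (X ⊞ Y) ↔ Q ψ X ∧ Q ψ Y
  slicing_shift : ∀ (ψ ψ' : Set.Ioc (0 : ℝ) 2), (∃ m : ℤ, (ψ' : ℝ) = ψ + 1 + 2 * m) →
    ∀ X : C, Q ψ X ↔ Q ψ' (X⟦(1 : ℤ)⟧)
  semistable : ∀ (ψ : Set.Ioc (0 : ℝ) 2) (E : IndecObj C), Q ψ E.obj → phase E = ψ ∧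
    ∃ m : ℝ, 0 < m ∧ Z (K0.of _ E.obj) = m * Complex.exp (Complex.I * Real.pi * phase E)
  degree_nonneg : ∀ (ψ ψ' : Set.Ioc (0 : ℝ) 2) (E F : IndecObj C), Q ψ E.obj → Q ψ' F.obj →
    ∀ (f : E.obj ⟶ F.obj) (a : ℝ), f ≠ 0 → f ∈ q.hom E F a → 0 ≤ a
  harderNarasimhan : ∀ E : IndecObj C, ∃ F : Filtration E, F.IsHarderNarasimhan q Q

variable {v : K0 C (distTriang C) →+ Λ}

/-- Deformation equivalence of charge triples. -/
def ChargeTriple.DeformationEquivalent (R₁ R₂ : ChargeTriple k β v) : Prop :=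
  ∀ (E F : IndecObj C) (l₁ l₂ : Zigzag E F),
    (l₁.IsConnecting R₁.q ∧ l₂.IsConnecting R₁.q ↔ l₁.IsConnecting R₂.q ∧ l₂.IsConnecting R₂.q) ∧
    ∀ a₁ a₂ b₁ b₂ : ℝ, l₁.HasDegree R₁.q a₁ → l₂.HasDegree R₁.q a₂ →
      l₁.HasDegree R₂.q b₁ → l₂.HasDegree R₂.q b₂ → a₁ - a₂ = b₁ - b₂

namespace StabilityCondition

/-- Harder-Narasimhan filtrations of indecomposable objects are unique up to isomorphism. -/
def Good (σ : StabilityCondition k β v) : Prop :=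
  ∀ (E : IndecObj C) (F G : Filtration E), F.IsHarderNarasimhan σ.q σ.Q →
    G.IsHarderNarasimhan σ.q σ.Q → F.Isomorphic G

/-- The equivalence relation between (good) stability conditions. -/
def Equivalent (σ₁ σ₂ : StabilityCondition k β v) : Prop :=
  (σ₁.Q = σ₂.Q ∧ σ₁.Z = σ₂.Z) ∧
  (∀ (E F : IndecObj C) (f : E.obj ⟶ F.obj),
    σ₁.q.IsHomogeneous f ↔ σ₂.q.IsHomogeneous f) ∧
  (∀ (E : IndecObj C) (F G : Filtration E), F.IsHarderNarasimhan σ₁.q σ₁.Q →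
    G.IsHarderNarasimhan σ₂.q σ₂.Q → F.Isomorphic G) ∧
  ∀ (ψ ψ' : Set.Ioc (0 : ℝ) 2) (E F : IndecObj C), σ₁.Q ψ E.obj → σ₁.Q ψ' F.obj →
    ∀ (l : Zigzag E F) (a b : ℝ), l.HasDegree σ₁.q a → l.HasDegree σ₂.q b → a = b

/-- The stability conditions whose charge triple is deformation equivalent to that of `σ`. -/
def DeformationClass (σ : StabilityCondition k β v) : Type _ :=
  {σ₁ : StabilityCondition k β v //
    σ.toChargeTriple.DeformationEquivalent σ₁.toChargeTriple}

end StabilityCondition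

/-! ### The `ℤ`-lift of a cyclic category -/

namespace RealDecomposition

/-- The inverse of a homogeneous isomorphism is homogeneous of degree `0`. -/
lemma inv_mem (q : RealDecomposition k β) {E F : IndecObj C} (f : E.obj ⟶ F.obj)
    (g : F.obj ⟶ E.obj) (hf : f ∈ q.hom E F 0) (hfg : f ≫ g = 𝟙 _) (hgf : g ≫ f = 𝟙 _) :
    g ∈ q.hom F E 0 := by
  classical
  let _ := (q.isInternal F E).chooseDecomposition
  let _ := (q.isInternal E E).chooseDecomposition
  have key : ∀ x : F.obj ⟶ E.obj,
      f ≫ (DirectSum.decompose (q.hom F E) x 0 : F.obj ⟶ E.obj) =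
        (DirectSum.decompose (q.hom E E) (f ≫ x) 0 : E.obj ⟶ E.obj) := by
    intro x
    induction x using DirectSum.Decomposition.inductionOn (q.hom F E) with
    | zero => simp
    | @homogeneous a m =>
      have h : f ≫ (m : F.obj ⟶ E.obj) ∈ q.hom E E a := by
        simpa using q.comp_mem hf m.2
      by_cases ha : a = 0
      · subst ha
        rw [DirectSum.decompose_of_mem_same _ m.2, DirectSum.decompose_of_mem_same _ h]
      · rw [DirectSum.decompose_of_mem_ne _ m.2 ha, DirectSum.decompose_of_mem_ne _ h ha,
          comp_zero]
    | add x y hx hy =>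
      simp only [DirectSum.decompose_add, DirectSum.add_apply, Submodule.coe_add,
        Preadditive.comp_add, hx, hy]
  have h := key g
  rw [hfg, DirectSum.decompose_of_mem_same _ (q.id_mem E)] at h
  have h2 : g = (DirectSum.decompose (q.hom F E) g 0 : F.obj ⟶ E.obj) := by
    calc g = g ≫ f ≫ (DirectSum.decompose (q.hom F E) g 0 : F.obj ⟶ E.obj) := by
          rw [h, Category.comp_id]
      _ = _ := by rw [← Category.assoc, hgf, Category.id_comp]
  rw [h2]
  exact (DirectSum.decompose (q.hom F E) g 0).2

end RealDecomposition

lemma IndecObj.id_ne_zero (E : IndecObj C) : 𝟙 E.obj ≠ 0 := fun h =>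
  E.indecomposable.1 ((IsZero.iff_id_eq_zero _).2 h)

namespace ChargeTriple

lemma phase_of_iso (R : ChargeTriple k β v) {E F : IndecObj C} (f : E.obj ≅ F.obj)
    (hf : f.hom ∈ R.q.hom E F 0) : ∃ m : ℤ, R.phase F = R.phase E + 2 * m := by
  obtain ⟨m, hm⟩ := R.degree E F f.hom 0 (fun h => E.id_ne_zero (by
    rw [← f.hom_inv_id, h, zero_comp])) hf
  exact ⟨-m, by push_cast; linarith⟩

lemma phase_shift_zero (R : ChargeTriple k β v) (E : IndecObj C) :
    ∃ m : ℤ, R.phase (E.shift 0) = R.phase E + 2 * m := by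
  obtain ⟨m, hm⟩ := R.phase_of_iso (E := E.shift 0) (F := E)
    ((shiftFunctorZero C ℤ).app E.obj) (R.q.shiftZero_mem E)
  exact ⟨-m, by push_cast; linarith⟩

lemma phase_shift_add (R : ChargeTriple k β v) (E : IndecObj C) (n : ℤ) :
    ∃ m : ℤ, R.phase (E.shift (n + 1)) = R.phase (E.shift n) + 1 + 2 * m := by
  obtain ⟨m, hm⟩ := R.phase_of_iso (E := E.shift (n + 1)) (F := (E.shift n).shift 1)
    ((shiftFunctorAdd C n 1).app E.obj) (R.q.shiftAdd_mem E n 1)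
  obtain ⟨m', hm'⟩ := R.phase_shift (E.shift n)
  exact ⟨m' - m, by push_cast; linarith⟩

lemma phase_shift_int (R : ChargeTriple k β v) (E : IndecObj C) (n : ℤ) :
    ∃ m : ℤ, R.phase (E.shift n) = R.phase E + n + 2 * m := by
  induction n using Int.induction_on with
  | zero =>
    obtain ⟨m, hm⟩ := R.phase_shift_zero E
    exact ⟨m, by simpa using hm⟩
  | succ i ih =>
    obtain ⟨m, hm⟩ := ih
    obtain ⟨m', hm'⟩ := R.phase_shift_add E i
    exact ⟨m + m', by push_cast at *; linarith⟩
  | pred i ih =>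
    obtain ⟨m, hm⟩ := ih
    obtain ⟨m', hm'⟩ := R.phase_shift_add E (-i - 1)
    rw [show (-(i : ℤ) - 1 + 1) = -i by ring] at hm'
    exact ⟨m - m', by push_cast at *; linarith⟩

end ChargeTriple

/-- Objects of the `ℤ`-lift of `C` with respect to a charge triple: finite direct sums of pairs
`(E, θ)` of an indecomposable object and a real number congruent to its phase mod `2`. -/
structure LiftedObj (R : ChargeTriple k β v) where
  obj : C
  dec : Decomposition obj
  phase : Fin dec.n → ℝ
  phase_spec : ∀ i, ∃ m : ℤ, phase i = R.phase (dec.summand i) + 2 * m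

namespace LiftedObj

variable {R : ChargeTriple k β v}

/-- The morphisms of the `ℤ`-lift: those whose matrix entries `(E, θ) → (F, θ')` are homogeneous
of degree `θ' - θ`. -/
def homs (X Y : LiftedObj R) : AddSubgroup (X.obj ⟶ Y.obj) where
  carrier := {f | ∀ i j, X.dec.inj i ≫ f ≫ Y.dec.proj j ∈
    R.q.hom (X.dec.summand i) (Y.dec.summand j) (Y.phase j - X.phase i)}
  add_mem' {f g} hf hg i j := by
    simp only [Preadditive.add_comp, Preadditive.comp_add]
    exact add_mem (hf i j) (hg i j)
  zero_mem' i j := by simp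
  neg_mem' {f} hf i j := by
    simp only [Preadditive.neg_comp, Preadditive.comp_neg]
    exact neg_mem (hf i j)

lemma comp_mem {X Y Z : LiftedObj R} {f : X.obj ⟶ Y.obj} {g : Y.obj ⟶ Z.obj}
    (hf : f ∈ homs X Y) (hg : g ∈ homs Y Z) : f ≫ g ∈ homs X Z := by
  intro i j
  have : X.dec.inj i ≫ (f ≫ g) ≫ Z.dec.proj j = ∑ l, (X.dec.inj i ≫ f ≫ Y.dec.proj l) ≫
      (Y.dec.inj l ≫ g ≫ Z.dec.proj j) := by
    calc _ = X.dec.inj i ≫ f ≫ (∑ l, Y.dec.proj l ≫ Y.dec.inj l) ≫ g ≫ Z.dec.proj j := by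
          rw [Y.dec.sum_proj_inj]; simp
      _ = _ := by simp [Preadditive.comp_sum, Preadditive.sum_comp]
  rw [this]
  refine sum_mem fun l _ => ?_
  have h := R.q.comp_mem (hf i l) (hg l j)
  rwa [show Y.phase l - X.phase i + (Z.phase j - Y.phase l) = Z.phase j - X.phase i by ring] at h

/-- A criterion for diagonal matrices to belong to the `ℤ`-lift. -/
lemma diag_mem {X Y : LiftedObj R} (f : X.obj ⟶ Y.obj)
    (h : ∀ i j, ∃ hn : X.dec.n = Y.dec.n, (Fin.cast hn i = j →
      X.dec.inj i ≫ f ≫ Y.dec.proj j ∈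
        R.q.hom (X.dec.summand i) (Y.dec.summand j) (Y.phase j - X.phase i)) ∧
      (Fin.cast hn i ≠ j → X.dec.inj i ≫ f ≫ Y.dec.proj j = 0)) : f ∈ homs X Y := by
  intro i j
  obtain ⟨hn, h₁, h₂⟩ := h i j
  by_cases hij : Fin.cast hn i = j
  · exact h₁ hij
  · rw [h₂ hij]; exact zero_mem _

instance : Category (LiftedObj R) where
  Hom X Y := homs X Y
  id X := ⟨𝟙 X.obj, diag_mem _ fun i j => ⟨rfl, fun h => by
    obtain rfl : i = j := h
    simpa [X.dec.inj_proj_self] using R.q.id_mem (X.dec.summand i), fun h => by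
    simpa using X.dec.inj_proj_ne i j h⟩⟩
  comp f g := ⟨f.1 ≫ g.1, comp_mem f.2 g.2⟩
  id_comp _ := Subtype.ext (Category.id_comp _)
  comp_id _ := Subtype.ext (Category.comp_id _)
  assoc _ _ _ := Subtype.ext (Category.assoc _ _ _)

@[ext]
lemma hom_ext {X Y : LiftedObj R} {f g : X ⟶ Y} (h : f.1 = g.1) : f = g := Subtype.ext h

@[simp]
lemma comp_val {X Y Z : LiftedObj R} (f : X ⟶ Y) (g : Y ⟶ Z) : (f ≫ g).1 = f.1 ≫ g.1 := rfl

@[simp]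
lemma id_val (X : LiftedObj R) : (𝟙 X : X ⟶ X).1 = 𝟙 X.obj := rfl

instance : Preadditive (LiftedObj R) where
  homGroup X Y := inferInstanceAs (AddCommGroup (homs X Y))
  add_comp _ _ _ _ _ _ := Subtype.ext (Preadditive.add_comp _ _ _ _ _ _)
  comp_add _ _ _ _ _ _ := Subtype.ext (Preadditive.comp_add _ _ _ _ _ _)

@[simp]
lemma add_val {X Y : LiftedObj R} (f g : X ⟶ Y) : (f + g).1 = f.1 + g.1 := rfl

@[simp]
lemma zero_val {X Y : LiftedObj R} : (0 : X ⟶ Y).1 = 0 := rfl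

variable (R) in
/-- The covering functor `π` to `C`. -/
@[simps]
def π : LiftedObj R ⥤ C where
  obj X := X.obj
  map f := f.1

instance : (π R).Faithful where
  map_injective h := Subtype.ext h

open ZeroObject in
instance : HasZeroObject (LiftedObj R) where
  zero := ⟨⟨(0 : C), ⟨0, Fin.elim0, fun i => i.elim0, fun i => i.elim0, fun i => i.elim0,
    fun i => i.elim0, (isZero_zero C).eq_of_src _ _⟩, Fin.elim0, fun i => i.elim0⟩, by
    rw [IsZero.iff_id_eq_zero]
    exact Subtype.ext ((isZero_zero C).eq_of_src _ _)⟩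

/-- The shift `(E, θ) ↦ (E[n], θ + n)` on objects. -/
def shiftObj (n : ℤ) (X : LiftedObj R) : LiftedObj R where
  obj := X.obj⟦n⟧
  dec := X.dec.shift n
  phase i := X.phase i + n
  phase_spec i := by
    obtain ⟨m, hm⟩ := X.phase_spec i
    obtain ⟨m', hm'⟩ := R.phase_shift_int (X.dec.summand i) n
    refine ⟨m - m', ?_⟩
    change X.phase i + n = R.phase ((X.dec.summand i).shift n) + 2 * ((m - m' : ℤ) : ℝ)
    rw [hm', hm]
    push_cast
    ring

variable (R) in
/-- The shift functors of the `ℤ`-lift. -/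
def shiftF (n : ℤ) : LiftedObj R ⥤ LiftedObj R where
  obj := shiftObj n
  map {X Y} f := ⟨f.1⟦n⟧', fun i j => by
    have h := R.q.shift_mem n (f.2 i j)
    rw [Functor.map_comp, Functor.map_comp] at h
    rwa [show Y.phase j - X.phase i = (shiftObj n Y).phase j - (shiftObj n X).phase i by
      simp [shiftObj]] at h⟩
  map_id X := Subtype.ext (CategoryTheory.Functor.map_id _ _)
  map_comp f g := Subtype.ext (Functor.map_comp _ _ _)

/-- The isomorphism `X[0] ≅ X`. -/
def shiftZeroIso (X : LiftedObj R) : shiftObj 0 X ≅ X where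
  hom := ⟨(shiftFunctorZero C ℤ).hom.app X.obj, diag_mem _ fun (i j : Fin X.dec.n) => ⟨rfl, fun h => by
    obtain rfl : i = j := h
    have e : (X.dec.inj i)⟦(0 : ℤ)⟧' ≫ (shiftFunctorZero C ℤ).hom.app X.obj ≫ X.dec.proj i =
        (shiftFunctorZero C ℤ).hom.app (X.dec.summand i).obj := by
      rw [NatTrans.naturality_assoc]
      simp [X.dec.inj_proj_self]
    have h0 : X.phase i - (shiftObj 0 X).phase i = 0 := by simp [shiftObj]
    rw [h0]
    change (X.dec.inj i)⟦(0 : ℤ)⟧' ≫ _ ≫ _ ∈ _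
    rw [e]
    exact R.q.shiftZero_mem _, fun h => by
    change (X.dec.inj i)⟦(0 : ℤ)⟧' ≫ _ ≫ _ = _
    rw [NatTrans.naturality_assoc]
    simp [X.dec.inj_proj_ne i j h]
    rfl⟩⟩
  inv := ⟨(shiftFunctorZero C ℤ).inv.app X.obj, diag_mem _ fun (i j : Fin X.dec.n) => ⟨rfl, fun h => by
    obtain rfl : i = j := h
    have e : X.dec.inj i ≫ (shiftFunctorZero C ℤ).inv.app X.obj ≫ (X.dec.proj i)⟦(0 : ℤ)⟧' =
        (shiftFunctorZero C ℤ).inv.app (X.dec.summand i).obj := by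
      rw [← NatTrans.naturality, Functor.id_map, ← Category.assoc, X.dec.inj_proj_self,
        Category.id_comp]
    have h0 : (shiftObj 0 X).phase i - X.phase i = 0 := by simp [shiftObj]
    change X.dec.inj i ≫ _ ≫ (X.dec.proj i)⟦(0 : ℤ)⟧' ∈ _
    rw [e]
    change _ ∈ R.q.hom (X.dec.summand i) ((X.dec.summand i).shift 0) _
    rw [h0]
    exact R.q.inv_mem (E := (X.dec.summand i).shift 0) _ _ (R.q.shiftZero_mem _) (by simp)
      (by simp), fun h => by
    change X.dec.inj i ≫ _ ≫ (X.dec.proj j)⟦(0 : ℤ)⟧' = _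
    rw [← NatTrans.naturality, Functor.id_map, ← Category.assoc, X.dec.inj_proj_ne i j h,
      zero_comp]
    rfl⟩⟩
  hom_inv_id := Subtype.ext (Iso.hom_inv_id_app _ _)
  inv_hom_id := Subtype.ext (Iso.inv_hom_id_app _ _)

/-- The isomorphism `X[m + n] ≅ X[m][n]`. -/
def shiftAddIso (m n : ℤ) (X : LiftedObj R) : shiftObj (m + n) X ≅ shiftObj n (shiftObj m X) where
  hom := ⟨(shiftFunctorAdd C m n).hom.app X.obj, diag_mem _ fun (i j : Fin X.dec.n) => ⟨rfl, fun h => by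
    obtain rfl : i = j := h
    have e : (X.dec.inj i)⟦m + n⟧' ≫ (shiftFunctorAdd C m n).hom.app X.obj ≫
        (X.dec.proj i)⟦m⟧'⟦n⟧' = (shiftFunctorAdd C m n).hom.app (X.dec.summand i).obj := by
      rw [NatTrans.naturality_assoc, Functor.comp_map, ← Functor.map_comp, ← Functor.map_comp,
        X.dec.inj_proj_self]
      simp
    have h0 : (shiftObj n (shiftObj m X)).phase i - (shiftObj (m + n) X).phase i = 0 := by
      simp only [shiftObj]; push_cast; ring
    rw [h0]
    change (X.dec.inj i)⟦m + n⟧' ≫ _ ≫ (X.dec.proj i)⟦m⟧'⟦n⟧' ∈ _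
    rw [e]
    exact R.q.shiftAdd_mem _ _ _, fun h => by
    change (X.dec.inj i)⟦m + n⟧' ≫ _ ≫ (X.dec.proj j)⟦m⟧'⟦n⟧' = _
    rw [NatTrans.naturality_assoc, Functor.comp_map, ← Functor.map_comp, ← Functor.map_comp,
      X.dec.inj_proj_ne i j h]
    simp
    rfl⟩⟩
  inv := ⟨(shiftFunctorAdd C m n).inv.app X.obj, diag_mem _ fun (i j : Fin X.dec.n) => ⟨rfl, fun h => by
    obtain rfl : i = j := h
    have e : (X.dec.inj i)⟦m⟧'⟦n⟧' ≫ (shiftFunctorAdd C m n).inv.app X.obj ≫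
        (X.dec.proj i)⟦m + n⟧' = (shiftFunctorAdd C m n).inv.app (X.dec.summand i).obj := by
      rw [← NatTrans.naturality, Functor.comp_map, ← Functor.map_comp_assoc, ← Functor.map_comp,
        X.dec.inj_proj_self]
      simp
    have h0 : (shiftObj (m + n) X).phase i - (shiftObj n (shiftObj m X)).phase i = 0 := by
      simp only [shiftObj]; push_cast; ring
    change (X.dec.inj i)⟦m⟧'⟦n⟧' ≫ _ ≫ (X.dec.proj i)⟦m + n⟧' ∈ _
    rw [e]
    change _ ∈ R.q.hom (((X.dec.summand i).shift m).shift n) ((X.dec.summand i).shift (m + n)) _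
    rw [h0]
    exact R.q.inv_mem (E := (X.dec.summand i).shift (m + n)) _ _ (R.q.shiftAdd_mem _ _ _)
      (by simp) (by simp), fun h => by
    change (X.dec.inj i)⟦m⟧'⟦n⟧' ≫ _ ≫ (X.dec.proj j)⟦m + n⟧' = _
    rw [← NatTrans.naturality, Functor.comp_map, ← Functor.map_comp_assoc, ← Functor.map_comp,
      X.dec.inj_proj_ne i j h]
    simp
    rfl⟩⟩
  hom_inv_id := Subtype.ext (Iso.hom_inv_id_app _ _)
  inv_hom_id := Subtype.ext (Iso.inv_hom_id_app _ _)

lemma shiftObj_add_zero_eq {m n : ℤ} (h : m = n) (X : LiftedObj R) :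
    (eqToHom (congrArg (fun l => shiftObj l X) h) : shiftObj m X ⟶ shiftObj n X).1 =
      eqToHom (congrArg (fun l => X.obj⟦l⟧) h) := by
  subst h
  rfl

instance : HasShift (LiftedObj R) ℤ := hasShiftMk (LiftedObj R) ℤ
  { F := shiftF R
    zero := NatIso.ofComponents shiftZeroIso fun f =>
      Subtype.ext ((shiftFunctorZero C ℤ).hom.naturality f.1)
    add := fun m n => NatIso.ofComponents (shiftAddIso m n) fun f =>
      Subtype.ext ((shiftFunctorAdd C m n).hom.naturality f.1)
    assoc_hom_app := fun m₁ m₂ m₃ X => Subtype.ext (by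
      have h := shiftFunctorAdd'_assoc_hom_app m₁ m₂ m₃ _ _ (m₁ + m₂ + m₃) rfl rfl rfl X.obj
      simp only [shiftFunctorAdd'_eq_shiftFunctorAdd] at h
      have h' := shiftObj_add_zero_eq (add_assoc m₁ m₂ m₃) X
      refine h.trans ?_
      refine Eq.trans ?_ (congrArg (· ≫ ((shiftFunctorAdd C m₁ (m₂ + m₃)).hom.app X.obj ≫
        (shiftFunctorAdd C m₂ m₃).hom.app (X.obj⟦m₁⟧))) h'.symm)
      simp [shiftFunctorAdd'])
    zero_add_hom_app := fun n X => Subtype.ext (by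
      have h := shiftFunctorAdd_zero_add_hom_app n X.obj
      have h' := shiftObj_add_zero_eq (zero_add n) X
      exact h.trans (congrArg (· ≫ ((shiftFunctorZero C ℤ).inv.app X.obj)⟦n⟧') h'.symm))
    add_zero_hom_app := fun n X => Subtype.ext (by
      have h := shiftFunctorAdd_add_zero_hom_app n X.obj
      have h' := shiftObj_add_zero_eq (add_zero n) X
      exact h.trans (congrArg (· ≫ (shiftFunctorZero C ℤ).inv.app (X.obj⟦n⟧)) h'.symm)) }

instance (n : ℤ) : (shiftFunctor (LiftedObj R) n).Additive where
  map_add {_ _ f g} := Subtype.ext (Functor.map_add (shiftFunctor C n) (f := f.1) (g := g.1))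

variable (R) in
/-- A triangle of the `ℤ`-lift is distinguished if and only if its image in `C` is. Note that
`π (X[1]) = (π X)[1]` holds by definition. -/
def distinguished : Set (Triangle (LiftedObj R)) :=
  {t | Triangle.mk (C := C) ((π R).map t.mor₁) ((π R).map t.mor₂) ((π R).map t.mor₃) ∈
    distTriang C}

variable (R) in
/-- The homomorphism of Grothendieck groups induced by the covering functor `π`. -/
def π₀ : K0 (LiftedObj R) (distinguished R) →+ K0 C (distTriang C) :=
  QuotientAddGroup.map _ _ (FreeAbelianGroup.map (π R).obj) <| by
    rw [AddSubgroup.closure_le]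
    rintro _ ⟨t, ht, rfl⟩
    refine AddSubgroup.subset_closure ⟨_, ht, ?_⟩
    simp only [map_sub, FreeAbelianGroup.map_of_apply]
    rfl

end LiftedObj

/-- Indecomposable objects `(E, θ)` of the `ℤ`-lift. -/
structure LiftedIndec (R : ChargeTriple k β v) where
  obj : IndecObj C
  phase : ℝ
  phase_spec : ∃ m : ℤ, phase = R.phase obj + 2 * m

/-- The summands `(Eᵢ, θᵢ)` of an object of the `ℤ`-lift. -/
def LiftedObj.summand {R : ChargeTriple k β v} (X : LiftedObj R) (i : Fin X.dec.n) :
    LiftedIndec R :=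
  ⟨X.dec.summand i, X.phase i, X.phase_spec i⟩

/-- An equivalence of `ℤ`-lifts over `C`: it sends `(E, θ)` to `(E, h (E, θ))` and is the identity
on the underlying morphisms in `C`, which requires that a morphism `(E, θ) → (F, θ')` of the first
`ℤ`-lift is a morphism `(E, h (E, θ)) → (F, h (F, θ'))` of the second one. -/
structure LiftEquivalence (R R₁ : ChargeTriple k β v) where
  h : LiftedIndec R → ℝ
  spec : ∀ X : LiftedIndec R, ∃ m : ℤ, h X = R₁.phase X.obj + 2 * m
  add_two : ∀ X Y : LiftedIndec R, X.obj = Y.obj → Y.phase = X.phase + 2 → h Y = h X + 2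
  hom_mem : ∀ (X Y : LiftedIndec R) (f : X.obj.obj ⟶ Y.obj.obj),
    f ∈ R.q.hom X.obj Y.obj (Y.phase - X.phase) → f ∈ R₁.q.hom X.obj Y.obj (h Y - h X)

/-- Bridgeland stability conditions on the `ℤ`-lift of `C` with respect to `R`. Central charges
factor through the fixed homomorphism `K₀(C̃) → K₀(C) → Λ`. -/
abbrev LiftedStability (R : ChargeTriple k β v) : Type _ :=
  BridgelandStability (LiftedObj.distinguished R) (v.comp (LiftedObj.π₀ R))

/-- `τ = H^* π₁^* σ₁`, where `π₁ : C̃₁ → C` is the `ℤ`-lift with respect to the stability condition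
`σ₁`, whose lift `π₁^* σ₁` has central charge `Z₁ ∘ π₀` and semistable objects of phase `ψ` the
direct sums of the `(E, ψ)` with `E` in `Q₁(ψ')`, `ψ' ≡ ψ` mod `2`, and `H : C̃ → C̃₁` is an
equivalence over `C`. -/
def LiftedStability.IsPullback {R : ChargeTriple k β v} (τ : LiftedStability R)
    (σ₁ : StabilityCondition k β v) (H : LiftEquivalence R σ₁.toChargeTriple) : Prop :=
  τ.Z = σ₁.Z.comp (LiftedObj.π₀ R) ∧
  ∀ (ψ : ℝ) (X : LiftedObj R), τ.P ψ X ↔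
    ∀ i, H.h (X.summand i) = ψ ∧ ∃ ψ' : Set.Ioc (0 : ℝ) 2, (∃ m : ℤ, ψ = ψ' + 2 * m) ∧
      σ₁.Q ψ' (X.dec.summand i).obj

end Cyclic

end CyclicStab

end

/-!
The whole argument takes place in the `ℤ`-lift `C̃ = LiftedObj R` of the given stability condition,
whose objects are direct sums of pairs `(E, θ)`.

*The lift is pretriangulated.* The part of a morphism of `C` which belongs to `C̃` (`degZero`) is
compatible with composition, so fillers of morphisms of triangles can be taken from `C`, and only
cones have to be constructed (`LiftedObj.hasCone`). By induction on the number of summands one may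
assume that the nonzero entries of `f : X → Y` form a connected graph and include no isomorphism.
Liftability of a diagram is the existence of a *potential* on the summands of its objects
(`Diagram.IsPotential`), and pre-liftability gives a triangle `X → Y → Z → X[1]` in `C` whose long
sequence has one. Entries of `Y → Z` or `Z → X[1]` which are isomorphisms split off from `f`. If
there are none, the hexagon of the triangle is locally liftable, the vanishing of the Maslov
indices says that the potential increases by exactly `1` from `X` to `X[1]`, and it therefore
provides phases of the summands of `Z`.

*Deformation equivalence.* A charge triple is deformation equivalent to `R` if and only if it
differs from it by a function `η` on indecomposable objects which is added to phases and whose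
differences are added to degrees (`Twist`). Equivalences of `ℤ`-lifts over `C` are then exactly the
translates `(E, θ) ↦ (E, θ + η E + 2 m)`, and the pullback of a stability condition `σ₁` is the
slicing `Twist.pull`.

*From `C` to the lift.* The potential of a Harder-Narasimhan diagram turns a filtration of `E`
into one of `(E, θ)` in `C̃` (`Twist.exists_tower`). Filtrations in `C̃` are unique by the usual
argument, which shows that all stability conditions of the deformation class are good, and they are
closed under direct sums, so that the pullback is a stability condition on `C̃`.

*From the lift to `C`.* A stability condition on `C̃` determines `η` on semistable objects; on the
other indecomposable objects it is read off from the argument of the central charge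
(`exists_offset`). Since there are no morphisms from `E_{i-1}` to `Q_i[-1]`, the diagrams of its
Harder-Narasimhan filtrations are connective, so their images in `C` are Harder-Narasimhan
filtrations (`HNTower.isHarderNarasimhan`, `LiftedStability.exists_stabilityCondition`).

Two stability conditions on `C` are equivalent if and only if they have a common pullback, and two
stability conditions on `C̃` are pullbacks of the same one if and only if they differ by an even
shift; this correspondence is the bijection.
-/

open CategoryTheory CategoryTheory.Limits CategoryTheory.Pretriangulated

noncomputable section

namespace CyclicStab

universe v u w w'

section Local

variable {C : Type u} [Category.{v} C] [Preadditive C]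

/-! ### Consequences of locality of endomorphism rings -/

lemma isIso_or_isIso_of_isIso_add {X : C} [IsLocalRing (End X)] {f g : X ⟶ X}
    (h : IsIso (f + g)) : IsIso f ∨ IsIso g := by
  have h' : IsUnit (M := End X) ((f : End X) + (g : End X)) :=
    (isUnit_iff_isIso (X := X) _).2 h
  exact (IsLocalRing.isUnit_or_isUnit_of_isUnit_add h').imp (isUnit_iff_isIso (X := X) _).1
    (isUnit_iff_isIso (X := X) _).1

lemma exists_isIso_of_isIso_sum {X : C} [IsLocalRing (End X)] {ι : Type*} {s : Finset ι}
    {f : ι → (X ⟶ X)} (h : IsIso (∑ i ∈ s, f i)) : ∃ i ∈ s, IsIso (f i) := by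
  have h' : IsUnit (M := End X) (∑ i ∈ s, (f i : End X)) :=
    (isUnit_iff_isIso (X := X) _).2 h
  obtain ⟨i, hi, hu⟩ := IsLocalRing.exists_of_isUnit_sum h'
  exact ⟨i, hi, (isUnit_iff_isIso (X := X) _).1 hu⟩

/-- If `f ≫ g` is an isomorphism and the target of `f` has a local endomorphism ring, then `f`
is an isomorphism: the idempotent it defines on its target is nonzero, hence equal to `1`. -/
lemma isIso_of_isIso_comp {X Y : C} [IsLocalRing (End Y)] (hX : ¬ IsZero X) (f : X ⟶ Y)
    (g : Y ⟶ X) [IsIso (f ≫ g)] : IsIso f := by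
  have h1 : f ≫ g ≫ inv (f ≫ g) = 𝟙 X := by
    rw [← Category.assoc, IsIso.hom_inv_id]
  set r := g ≫ inv (f ≫ g) with hr
  have hi : (r ≫ f) ≫ (r ≫ f) = r ≫ f := by
    rw [Category.assoc, reassoc_of% h1]
  have h2 : IsIso (r ≫ f + (𝟙 Y - r ≫ f)) := by
    rw [add_sub_cancel]; infer_instance
  rcases isIso_or_isIso_of_isIso_add h2 with h | h
  · have : r ≫ f = 𝟙 Y := by rw [← cancel_epi (r ≫ f), hi, Category.comp_id]
    exact ⟨r, h1, this⟩
  · exfalso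
    have h0 : f ≫ (𝟙 Y - r ≫ f) = 0 := by
      rw [Preadditive.comp_sub, Category.comp_id, reassoc_of% h1, sub_self]
    have hf : f = 0 := by
      rw [← cancel_mono (𝟙 Y - r ≫ f), h0, zero_comp]
    apply hX
    rw [IsZero.iff_id_eq_zero, ← h1, hf, zero_comp]

end Local

section Graded

variable {C : Type u} [Category.{v} C] [HasZeroObject C] [Preadditive C] [HasShift C ℤ]
  [∀ n : ℤ, (shiftFunctor C n).Additive] [Pretriangulated C]
  {k : Type w} [Field k] [Linear k C] {β : shiftFunctor C (2 : ℤ) ≅ 𝟭 C}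

/-! ### Homogeneous components of morphisms -/

namespace RealDecomposition

variable (q : RealDecomposition k β)

/-- The decomposition of `Hom(E, F)` into homogeneous subspaces. -/
def homEquiv (E F : IndecObj C) :
    (DirectSum ℝ fun a => q.hom E F a) ≃ₗ[k] (E.obj ⟶ F.obj) :=
  LinearEquiv.ofBijective (DirectSum.coeLinearMap (q.hom E F)) (q.isInternal E F)

/-- The component of degree `a` of a morphism between indecomposable objects. -/
def part (E F : IndecObj C) (a : ℝ) : (E.obj ⟶ F.obj) →ₗ[k] (E.obj ⟶ F.obj) :=
  (q.hom E F a).subtype ∘ₗ DirectSum.component k ℝ (fun a => q.hom E F a) a ∘ₗ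
    (q.homEquiv E F).symm.toLinearMap

variable {q} {E F G : IndecObj C}

lemma part_mem (a : ℝ) (f : E.obj ⟶ F.obj) : q.part E F a f ∈ q.hom E F a :=
  Subtype.property _

open Classical in
lemma part_eq_ite {a b : ℝ} {f : E.obj ⟶ F.obj} (hf : f ∈ q.hom E F a) :
    q.part E F b f = if b = a then f else 0 := by
  have h : (q.homEquiv E F).symm f = DirectSum.lof k ℝ (fun a => q.hom E F a) a ⟨f, hf⟩ := by
    rw [LinearEquiv.symm_apply_eq]
    exact (DirectSum.coeLinearMap_lof (q.hom E F) a ⟨f, hf⟩).symm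
  simp only [part, LinearMap.comp_apply, LinearEquiv.coe_coe, h]
  by_cases hb : b = a
  · subst hb; simp [DirectSum.component.lof_self]
  · rw [if_neg hb, DirectSum.component.of, dif_neg (Ne.symm hb)]
    rfl

lemma part_of_mem {a : ℝ} {f : E.obj ⟶ F.obj} (hf : f ∈ q.hom E F a) :
    q.part E F a f = f := by rw [part_eq_ite hf, if_pos rfl]

lemma part_of_mem_ne {a b : ℝ} {f : E.obj ⟶ F.obj} (hf : f ∈ q.hom E F a) (h : b ≠ a) :
    q.part E F b f = 0 := by rw [part_eq_ite hf, if_neg h]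

lemma hom_induction {p : (E.obj ⟶ F.obj) → Prop} (f : E.obj ⟶ F.obj)
    (hom : ∀ a f, f ∈ q.hom E F a → p f) (zero : p 0) (add : ∀ f g, p f → p g → p (f + g)) :
    p f := by
  have h : f ∈ ⨆ a, q.hom E F a := by
    rw [(q.isInternal E F).submodule_iSup_eq_top]; trivial
  exact Submodule.iSup_induction _ (motive := p) h hom zero add

lemma part_comp_of_mem {a b : ℝ} {g : E.obj ⟶ F.obj} (hg : g ∈ q.hom E F b)
    (f : F.obj ⟶ G.obj) : q.part E G (b + a) (g ≫ f) = g ≫ q.part F G a f := by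
  classical
  induction f using hom_induction (q := q) with
  | hom c f hf =>
    rw [part_eq_ite hf, part_eq_ite (q.comp_mem hg hf)]
    by_cases h : a = c
    · subst h; simp
    · rw [if_neg (by simpa using h), if_neg h, comp_zero]
  | zero => simp
  | add f g hf hg => simp [hf, hg]

lemma part_comp_of_mem' {a b : ℝ} (g : E.obj ⟶ F.obj) {f : F.obj ⟶ G.obj}
    (hf : f ∈ q.hom F G b) : q.part E G (a + b) (g ≫ f) = q.part E F a g ≫ f := by
  classical
  induction g using hom_induction (q := q) with
  | hom c g hg =>
    rw [part_eq_ite hg, part_eq_ite (q.comp_mem hg hf)]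
    by_cases h : a = c
    · subst h; simp
    · rw [if_neg (by simpa using h), if_neg h, zero_comp]
  | zero => simp
  | add f g hf hg => simp [hf, hg]

lemma eq_zero_of_part {f : E.obj ⟶ F.obj} (h : ∀ a, q.part E F a f = 0) : f = 0 := by
  have : (q.homEquiv E F).symm f = 0 := by
    ext a
    exact h a
  simpa using this

lemma mem_of_part {a : ℝ} {f : E.obj ⟶ F.obj} (h : ∀ b, b ≠ a → q.part E F b f = 0) :
    f ∈ q.hom E F a := by
  classical
  have : f - q.part E F a f = 0 := by
    apply eq_zero_of_part (q := q)
    intro b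
    rw [map_sub, part_eq_ite (part_mem a f)]
    split_ifs with hb
    · subst hb; simp
    · rw [h b hb, sub_zero]
  rw [sub_eq_zero.1 this]
  exact part_mem a f

lemma degree_unique {a b : ℝ} {f : E.obj ⟶ F.obj} (hf : f ≠ 0) (ha : f ∈ q.hom E F a)
    (hb : f ∈ q.hom E F b) : a = b := by
  by_contra h
  exact hf (by rw [← part_of_mem ha, part_of_mem_ne hb h])

lemma part_shift (n : ℤ) (a : ℝ) (f : E.obj ⟶ F.obj) :
    q.part (E.shift n) (F.shift n) a (f⟦n⟧') = (q.part E F a f)⟦n⟧' := by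
  classical
  induction f using hom_induction (q := q) with
  | hom c f hf =>
    rw [part_eq_ite hf, part_eq_ite (q.shift_mem n hf)]
    split_ifs
    · rfl
    · rw [Functor.map_zero]
  | zero => simp
  | add f g hf hg => simp only [Functor.map_add, map_add, hf, hg]

lemma shift_mem_iff (n : ℤ) {a : ℝ} {f : E.obj ⟶ F.obj} :
    f⟦n⟧' ∈ q.hom (E.shift n) (F.shift n) a ↔ f ∈ q.hom E F a := by
  refine ⟨fun h => mem_of_part fun b hb => ?_, q.shift_mem n⟩
  apply (shiftFunctor C n).map_injective
  rw [← part_shift, part_of_mem_ne h hb, Functor.map_zero]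

lemma comp_iso_mem_iff {a : ℝ} {f : E.obj ⟶ F.obj} (e : F.obj ≅ G.obj)
    (he : e.hom ∈ q.hom F G 0) : f ≫ e.hom ∈ q.hom E G a ↔ f ∈ q.hom E F a := by
  refine ⟨fun h => ?_, fun h => by simpa using q.comp_mem h he⟩
  simpa using q.comp_mem h (q.inv_mem e.hom e.inv he (by simp) (by simp))

end RealDecomposition

namespace RealDecomposition

variable {q : RealDecomposition k β} {E F : IndecObj C}

/-- The degree `0` part of an isomorphism and of its inverse are summed over all degrees; by
locality, one of the summands `f_a ≫ g_{-a}` of the identity is invertible. -/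
lemma exists_homogeneous_iso (hloc : ∀ E : IndecObj C, IsLocalRing (End E.obj))
    (e : E.obj ≅ F.obj) : ∃ e' : E.obj ≅ F.obj, e'.hom ∈ q.hom E F 0 := by
  have := hloc E
  have := hloc F
  suffices h : ∀ f : E.obj ⟶ F.obj, (∀ a f, f ∈ q.hom E F a → ¬ IsIso f) →
      ¬ IsIso (f ≫ e.inv) by
    by_contra! H
    refine h e.hom (fun a f hf hi => H (asIso f) ?_) (by rw [e.hom_inv_id]; infer_instance)
    obtain rfl := q.degree_iso hi hf
    exact hf
  intro f H
  induction f using hom_induction (q := q) with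
  | hom a f hf =>
    intro h
    exact H a f hf (isIso_of_isIso_comp E.indecomposable.1 f e.inv)
  | zero =>
    intro h
    exact E.indecomposable.1 ((IsZero.iff_id_eq_zero _).2 (by
      rw [← cancel_mono ((0 : E.obj ⟶ F.obj) ≫ e.inv)]; simp))
  | add f g hf hg =>
    intro h
    rw [Preadditive.add_comp] at h
    exact (isIso_or_isIso_of_isIso_add h).elim hf hg

end RealDecomposition

end Graded

end CyclicStab

end

open CategoryTheory CategoryTheory.Limits CategoryTheory.Pretriangulated

noncomputable section

namespace CyclicStab

universe v u w w'

section Sums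

variable {D : Type u} [Category.{v} D] [Preadditive D]

/-! ### Direct sums in additive categories -/

/-- The structure maps of `X` as a direct sum of a finite family of objects. -/
structure SumData {ι : Type*} [Fintype ι] (X : D) (L : ι → D) where
  inj : ∀ i, L i ⟶ X
  proj : ∀ i, X ⟶ L i
  inj_proj_self : ∀ i, inj i ≫ proj i = 𝟙 _
  inj_proj_ne : ∀ i j, i ≠ j → inj i ≫ proj j = 0
  total : ∑ i, proj i ≫ inj i = 𝟙 X

/-- The structure maps of `X` as a direct sum of two objects. -/
structure BinSplit (X X₁ X₂ : D) where
  i₁ : X₁ ⟶ X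
  i₂ : X₂ ⟶ X
  p₁ : X ⟶ X₁
  p₂ : X ⟶ X₂
  i₁_p₁ : i₁ ≫ p₁ = 𝟙 _
  i₁_p₂ : i₁ ≫ p₂ = 0
  i₂_p₁ : i₂ ≫ p₁ = 0
  i₂_p₂ : i₂ ≫ p₂ = 𝟙 _
  total : p₁ ≫ i₁ + p₂ ≫ i₂ = 𝟙 X

attribute [simp] SumData.inj_proj_self BinSplit.i₁_p₁ BinSplit.i₁_p₂ BinSplit.i₂_p₁
  BinSplit.i₂_p₂

section Assoc

variable {X X₁ X₂ Y : D}

@[simp]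
lemma SumData.inj_proj_self_assoc {ι : Type*} [Fintype ι] {L : ι → D} (s : SumData X L) (i : ι)
    (f : L i ⟶ Y) : s.inj i ≫ s.proj i ≫ f = f := by
  rw [← Category.assoc, s.inj_proj_self, Category.id_comp]

@[simp]
lemma BinSplit.i₁_p₁_assoc (s : BinSplit X X₁ X₂) (f : X₁ ⟶ Y) : s.i₁ ≫ s.p₁ ≫ f = f := by
  rw [← Category.assoc, s.i₁_p₁, Category.id_comp]

@[simp]
lemma BinSplit.i₁_p₂_assoc (s : BinSplit X X₁ X₂) (f : X₂ ⟶ Y) :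
    s.i₁ ≫ s.p₂ ≫ f = 0 := by
  rw [← Category.assoc, s.i₁_p₂, zero_comp]

@[simp]
lemma BinSplit.i₂_p₁_assoc (s : BinSplit X X₁ X₂) (f : X₁ ⟶ Y) :
    s.i₂ ≫ s.p₁ ≫ f = 0 := by
  rw [← Category.assoc, s.i₂_p₁, zero_comp]

@[simp]
lemma BinSplit.i₂_p₂_assoc (s : BinSplit X X₁ X₂) (f : X₂ ⟶ Y) : s.i₂ ≫ s.p₂ ≫ f = f := by
  rw [← Category.assoc, s.i₂_p₂, Category.id_comp]

end Assoc

namespace BinSplit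

variable {X X₁ X₂ Y Y₁ Y₂ : D}

/-- The two summands exchanged. -/
def symm (s : BinSplit X X₁ X₂) : BinSplit X X₂ X₁ :=
  ⟨s.i₂, s.i₁, s.p₂, s.p₁, s.i₂_p₂, s.i₂_p₁, s.i₁_p₂, s.i₁_p₁, by rw [add_comm, s.total]⟩

/-- The decomposition `X = 0 ⊕ X`. -/
def zeroLeft (X : D) {Z : D} (hZ : IsZero Z) : BinSplit X Z X :=
  ⟨0, 𝟙 X, 0, 𝟙 X, hZ.eq_of_src _ _, by simp, by simp, by simp, by simp⟩

lemma hom_ext (s : BinSplit X X₁ X₂) {f g : X ⟶ Y} (h₁ : s.i₁ ≫ f = s.i₁ ≫ g)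
    (h₂ : s.i₂ ≫ f = s.i₂ ≫ g) : f = g := by
  rw [← Category.id_comp f, ← Category.id_comp g, ← s.total]
  simp [h₁, h₂]

/-- Direct sums of two objects given by a splitting. -/
def toBicone (s : BinSplit X X₁ X₂) : BinaryBicone X₁ X₂ where
  pt := X
  fst := s.p₁
  snd := s.p₂
  inl := s.i₁
  inr := s.i₂
  inl_fst := s.i₁_p₁
  inl_snd := s.i₁_p₂
  inr_fst := s.i₂_p₁
  inr_snd := s.i₂_p₂

lemma isBilimit_toBicone (s : BinSplit X X₁ X₂) : Nonempty s.toBicone.IsBilimit :=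
  ⟨isBinaryBilimitOfTotal _ s.total⟩

end BinSplit

namespace SumData

variable {ι : Type*} [Fintype ι] {X Y : D} {L : ι → D}

@[simp]
lemma inj_proj [DecidableEq ι] (s : SumData X L) (i j : ι) :
    s.inj i ≫ s.proj j = if h : i = j then eqToHom (by rw [h]) else 0 := by
  split_ifs with h
  · subst h; simp
  · exact s.inj_proj_ne i j h

lemma hom_ext (s : SumData X L) {f g : X ⟶ Y} (h : ∀ i, s.inj i ≫ f = s.inj i ≫ g) : f = g := by
  rw [← Category.id_comp f, ← Category.id_comp g, ← s.total]
  simp [Preadditive.sum_comp, h]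

lemma hom_ext' (s : SumData X L) {f g : Y ⟶ X} (h : ∀ i, f ≫ s.proj i = g ≫ s.proj i) :
    f = g := by
  rw [← Category.comp_id f, ← Category.comp_id g, ← s.total]
  simp only [Preadditive.comp_sum, reassoc_of% h]

/-- The morphism out of a direct sum with given components. -/
def desc (s : SumData X L) (f : ∀ i, L i ⟶ Y) : X ⟶ Y := ∑ i, s.proj i ≫ f i

/-- The morphism into a direct sum with given components. -/
def lift (s : SumData X L) (f : ∀ i, Y ⟶ L i) : Y ⟶ X := ∑ i, f i ≫ s.inj i

@[simp]
lemma inj_desc (s : SumData X L) (f : ∀ i, L i ⟶ Y) (i : ι) : s.inj i ≫ s.desc f = f i := by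
  classical
  rw [desc, Preadditive.comp_sum, Finset.sum_eq_single i]
  · simp
  · intro j _ h
    rw [← Category.assoc, s.inj_proj_ne i j h.symm, zero_comp]
  · simp

@[simp]
lemma lift_proj (s : SumData X L) (f : ∀ i, Y ⟶ L i) (i : ι) : s.lift f ≫ s.proj i = f i := by
  classical
  rw [lift, Preadditive.sum_comp, Finset.sum_eq_single i]
  · simp
  · intro j _ h
    rw [Category.assoc, s.inj_proj_ne j i h, comp_zero]
  · simp

@[simp]
lemma inj_desc_assoc {Z : D} (s : SumData X L) (f : ∀ i, L i ⟶ Y) (i : ι) (g : Y ⟶ Z) :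
    s.inj i ≫ s.desc f ≫ g = f i ≫ g := by
  rw [← Category.assoc, s.inj_desc]

lemma exists_isIso_proj (s : SumData X L) {N : D} [IsLocalRing (End N)] (hN : ¬ IsZero N)
    [∀ i, IsLocalRing (End (L i))] (a : N ⟶ X) (b : X ⟶ N) [IsIso (a ≫ b)] :
    ∃ i, IsIso (a ≫ s.proj i) := by
  have h : a ≫ b = ∑ i, (a ≫ s.proj i) ≫ s.inj i ≫ b := by
    conv_lhs => rw [← Category.id_comp b, ← s.total]
    simp [Preadditive.sum_comp, Preadditive.comp_sum]
  obtain ⟨i, -, hi⟩ := exists_isIso_of_isIso_sum (f := fun i => (a ≫ s.proj i) ≫ s.inj i ≫ b)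
    (s := Finset.univ) (by rw [← h]; infer_instance)
  exact ⟨i, isIso_of_isIso_comp hN _ (s.inj i ≫ b)⟩

/-- A direct sum is the direct sum of two complementary partial sums. -/
def split (s : SumData X L) (P : ι → Prop) [DecidablePred P] {X₁ X₂ : D}
    (s₁ : SumData X₁ fun i : {i // P i} => L i) (s₂ : SumData X₂ fun i : {i // ¬ P i} => L i) :
    BinSplit X X₁ X₂ where
  i₁ := s₁.desc fun i => s.inj i
  i₂ := s₂.desc fun i => s.inj i
  p₁ := s₁.lift fun i => s.proj i
  p₂ := s₂.lift fun i => s.proj i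
  i₁_p₁ := s₁.hom_ext fun i => s₁.hom_ext' fun j => by
    classical
    simp [Subtype.ext_iff]
  i₁_p₂ := s₁.hom_ext fun i => s₂.hom_ext' fun j => by
    have : (i : ι) ≠ j := fun h => j.2 (h ▸ i.2)
    simp [s.inj_proj_ne _ _ this]
  i₂_p₁ := s₂.hom_ext fun i => s₁.hom_ext' fun j => by
    have : (i : ι) ≠ j := fun h => i.2 (h ▸ j.2)
    simp [s.inj_proj_ne _ _ this]
  i₂_p₂ := s₂.hom_ext fun i => s₂.hom_ext' fun j => by
    classical
    simp [Subtype.ext_iff]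
  total := s.hom_ext fun i => by
    by_cases h : P i
    · have h1 : s.inj i ≫ s₁.lift (fun i => s.proj i) = s₁.inj ⟨i, h⟩ :=
        s₁.hom_ext' fun j => by classical simp [Subtype.ext_iff]
      have h2 : s.inj i ≫ s₂.lift (fun i => s.proj i) = 0 :=
        s₂.hom_ext' fun j => by
          have : i ≠ j := fun h' => j.2 (h' ▸ h)
          simp [s.inj_proj_ne _ _ this]
      simp [reassoc_of% h1, reassoc_of% h2]
    · have h1 : s.inj i ≫ s₂.lift (fun i => s.proj i) = s₂.inj ⟨i, h⟩ :=
        s₂.hom_ext' fun j => by classical simp [Subtype.ext_iff]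
      have h2 : s.inj i ≫ s₁.lift (fun i => s.proj i) = 0 :=
        s₁.hom_ext' fun j => by
          have : i ≠ j := fun h' => h (h' ▸ j.2)
          simp [s.inj_proj_ne _ _ this]
      simp [reassoc_of% h1, reassoc_of% h2]

/-- A direct sum over a disjoint union is the direct sum of the two partial sums. -/
def splitSum {ι κ : Type*} [Fintype ι] [Fintype κ] {L : ι ⊕ κ → D} (s : SumData X L)
    {X₁ X₂ : D} (s₁ : SumData X₁ fun i => L (.inl i)) (s₂ : SumData X₂ fun i => L (.inr i)) :
    BinSplit X X₁ X₂ :=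
  have hne : ∀ i j, s.inj (.inl i) ≫ s.proj (.inr j) = 0 :=
    fun i j => s.inj_proj_ne _ _ (by simp)
  have hne' : ∀ i j, s.inj (.inr i) ≫ s.proj (.inl j) = 0 :=
    fun i j => s.inj_proj_ne _ _ (by simp)
  have h1 : ∀ i, s.inj (.inl i) ≫ s₁.lift (fun j => s.proj (.inl j)) = s₁.inj i :=
    fun i => s₁.hom_ext' fun j => by classical simp
  have h2 : ∀ i, s.inj (.inr i) ≫ s₂.lift (fun j => s.proj (.inr j)) = s₂.inj i :=
    fun i => s₂.hom_ext' fun j => by classical simp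
  have h3 : ∀ i, s.inj (.inl i) ≫ s₂.lift (fun j => s.proj (.inr j)) = 0 :=
    fun i => s₂.hom_ext' fun j => by simp [hne]
  have h4 : ∀ i, s.inj (.inr i) ≫ s₁.lift (fun j => s.proj (.inl j)) = 0 :=
    fun i => s₁.hom_ext' fun j => by simp [hne']
  { i₁ := s₁.desc fun i => s.inj (.inl i)
    i₂ := s₂.desc fun i => s.inj (.inr i)
    p₁ := s₁.lift fun i => s.proj (.inl i)
    p₂ := s₂.lift fun i => s.proj (.inr i)
    i₁_p₁ := s₁.hom_ext fun i => by simp [h1]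
    i₁_p₂ := s₁.hom_ext fun i => by simp [h3]
    i₂_p₁ := s₂.hom_ext fun i => by simp [h4]
    i₂_p₂ := s₂.hom_ext fun i => by simp [h2]
    total := s.hom_ext fun i => by
      rcases i with i | i
      · simp [reassoc_of% h1 i, reassoc_of% h3 i]
      · simp [reassoc_of% h2 i, reassoc_of% h4 i] }

/-- If `p : X → K` is invertible on the summand `L i₀`, then `X` is the direct sum of `K` and of
the other summands, with `p` as a projection. -/
lemma exists_split_of_proj [DecidableEq ι] (s : SumData X L) (i₀ : ι) {X' : D}
    (s' : SumData X' fun i : {i // i ≠ i₀} => L i) {K : D} (p : X ⟶ K) [IsIso (s.inj i₀ ≫ p)] :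
    ∃ b : BinSplit X K X', b.p₁ = p := by
  let a := inv (s.inj i₀ ≫ p) ≫ s.inj i₀
  have ha : a ≫ p = 𝟙 K := by simp [a]
  let c : X' ⟶ X := s'.desc fun i => s.inj i
  let r : X ⟶ X' := s'.lift fun i => s.proj i
  have hi₀ : s.inj i₀ ≫ r = 0 := s'.hom_ext' fun j => by simp [r, s.inj_proj_ne _ _ j.2.symm]
  have har : a ≫ r = 0 := by simp [a, hi₀]
  have hcr : c ≫ r = 𝟙 X' := s'.hom_ext fun i => s'.hom_ext' fun j => by
    simp [c, r, Subtype.ext_iff]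
  have hrc : s.proj i₀ ≫ s.inj i₀ + r ≫ c = 𝟙 X := s.hom_ext fun i => by
    by_cases h : i = i₀
    · subst h; simp [reassoc_of% hi₀]
    · have h1 : s.inj i ≫ r = s'.inj ⟨i, h⟩ := s'.hom_ext' fun j => by
        simp [r, Subtype.ext_iff]
      rw [Preadditive.comp_add, reassoc_of% h1, ← Category.assoc, s.inj_proj_ne _ _ h]
      simp [c]
  refine ⟨⟨a, c - c ≫ p ≫ a, p, r, ha, har, ?_, ?_, ?_⟩, rfl⟩
  · simp [ha]
  · simp [hcr, har]
  · have h2 : s.inj i₀ ≫ p ≫ a = s.inj i₀ := by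
      simp only [a]
      rw [← Category.assoc, IsIso.hom_inv_id_assoc]
    have h3 : r ≫ c = 𝟙 X - s.proj i₀ ≫ s.inj i₀ := by rw [← hrc]; abel
    rw [Preadditive.comp_sub, reassoc_of% h3, h3]
    simp only [Preadditive.sub_comp, Category.id_comp, Category.assoc, h2]
    abel

/-- If `a : K → X` is invertible onto the summand `L i₀`, then `X` is the direct sum of `K` and of
the other summands, with `a` as an inclusion. -/
lemma exists_split_of_inj [DecidableEq ι] (s : SumData X L) (i₀ : ι) {X' : D}
    (s' : SumData X' fun i : {i // i ≠ i₀} => L i) {K : D} (a : K ⟶ X) [IsIso (a ≫ s.proj i₀)] :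
    ∃ b : BinSplit X K X', b.i₁ = a ∧ b.p₁ = s.proj i₀ ≫ inv (a ≫ s.proj i₀) := by
  let p := s.proj i₀ ≫ inv (a ≫ s.proj i₀)
  have ha : a ≫ p = 𝟙 K := by
    simp only [p]
    rw [← Category.assoc, IsIso.hom_inv_id]
  let c : X' ⟶ X := s'.desc fun i => s.inj i
  let r : X ⟶ X' := s'.lift fun i => s.proj i
  have hi₀ : s.inj i₀ ≫ r = 0 := s'.hom_ext' fun j => by simp [r, s.inj_proj_ne _ _ j.2.symm]
  have hc₀ : c ≫ s.proj i₀ = 0 := s'.hom_ext fun j => by simp [c, s.inj_proj_ne _ _ j.2]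
  have hcr : c ≫ r = 𝟙 X' := s'.hom_ext fun i => s'.hom_ext' fun j => by
    simp [c, r, Subtype.ext_iff]
  have hrc : s.proj i₀ ≫ s.inj i₀ + r ≫ c = 𝟙 X := s.hom_ext fun i => by
    by_cases h : i = i₀
    · subst h; simp [reassoc_of% hi₀]
    · have h1 : s.inj i ≫ r = s'.inj ⟨i, h⟩ := s'.hom_ext' fun j => by
        simp [r, Subtype.ext_iff]
      rw [Preadditive.comp_add, reassoc_of% h1, ← Category.assoc, s.inj_proj_ne _ _ h]
      simp [c]
  have hcp : c ≫ p = 0 := by simp [p, reassoc_of% hc₀]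
  refine ⟨⟨a, c, p, r - p ≫ a ≫ r, ha, ?_, hcp, ?_, ?_⟩, rfl, rfl⟩
  · simp [reassoc_of% ha]
  · simp [hcr, reassoc_of% hcp]
  · have h2 : p ≫ a ≫ s.proj i₀ = s.proj i₀ := by simp [p]
    have h3 : r ≫ c = 𝟙 X - s.proj i₀ ≫ s.inj i₀ := by rw [← hrc]; abel
    simp only [Preadditive.sub_comp, Category.assoc, h3, Preadditive.comp_sub, Category.comp_id,
      reassoc_of% h2]
    abel

end SumData

end Sums

end CyclicStab

end

open CategoryTheory CategoryTheory.Limits CategoryTheory.Pretriangulated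

noncomputable section

namespace CyclicStab

universe v u w w'

section LiftBasics

variable {C : Type u} [Category.{v} C] [HasZeroObject C] [Preadditive C] [HasShift C ℤ]
  [∀ n : ℤ, (shiftFunctor C n).Additive] [Pretriangulated C]
  {k : Type w} [Field k] [Linear k C] {β : shiftFunctor C (2 : ℤ) ≅ 𝟭 C}
  {Λ : Type w'} [AddCommGroup Λ] {v : K0 C (distTriang C) →+ Λ} {R : ChargeTriple k β v}

/-! ### Objects and morphisms of the `ℤ`-lift -/

namespace Decomposition

/-- The trivial decomposition of an indecomposable object. -/
def single (E : IndecObj C) : Decomposition E.obj where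
  n := 1
  summand _ := E
  inj _ := 𝟙 _
  proj _ := 𝟙 _
  inj_proj_self _ := Category.comp_id _
  inj_proj_ne i j h := absurd (Subsingleton.elim i j) h
  sum_proj_inj := by simp

variable {X Y Z : C} (dX : Decomposition X) (dY : Decomposition Y) (dZ : Decomposition Z)

/-- A decomposition presents an object as a direct sum. -/
def sumData : SumData X fun i => (dX.summand i).obj :=
  ⟨dX.inj, dX.proj, dX.inj_proj_self, dX.inj_proj_ne, dX.sum_proj_inj⟩

lemma hom_ext {f g : X ⟶ Y} (h : ∀ i j, dX.inj i ≫ f ≫ dY.proj j = dX.inj i ≫ g ≫ dY.proj j) :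
    f = g :=
  dX.sumData.hom_ext fun i => dY.sumData.hom_ext' fun j => by
    simpa [sumData] using h i j

lemma entry_comp (f : X ⟶ Y) (g : Y ⟶ Z) (i : Fin dX.n) (j : Fin dZ.n) :
    dX.inj i ≫ (f ≫ g) ≫ dZ.proj j = ∑ l, (dX.inj i ≫ f ≫ dY.proj l) ≫
      (dY.inj l ≫ g ≫ dZ.proj j) := by
  calc _ = dX.inj i ≫ f ≫ (∑ l, dY.proj l ≫ dY.inj l) ≫ g ≫ dZ.proj j := by
        rw [dY.sum_proj_inj]; simp
    _ = _ := by simp [Preadditive.comp_sum, Preadditive.sum_comp]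

lemma isZero_iff : IsZero X ↔ dX.n = 0 := by
  constructor
  · intro h
    by_contra hn
    let i : Fin dX.n := ⟨0, by omega⟩
    refine (dX.summand i).id_ne_zero ?_
    rw [← dX.inj_proj_self, h.eq_of_tgt (dX.inj i) 0, zero_comp]
  · intro h
    have : IsEmpty (Fin dX.n) := by rw [h]; infer_instance
    rw [IsZero.iff_id_eq_zero, ← dX.sum_proj_inj, Finset.univ_eq_empty, Finset.sum_empty]

end Decomposition

namespace LiftedIndec

/-- An indecomposable object `(E, θ)` as an object of the `ℤ`-lift. -/
abbrev lift (L : LiftedIndec R) : LiftedObj R where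
  obj := L.obj.obj
  dec := .single L.obj
  phase _ := L.phase
  phase_spec _ := L.phase_spec

/-- Morphisms `(E, θ) → (F, θ')`. -/
def homMk {L M : LiftedIndec R} (f : L.obj.obj ⟶ M.obj.obj)
    (hf : f ∈ R.q.hom L.obj M.obj (M.phase - L.phase)) : L.lift ⟶ M.lift :=
  ⟨f, fun i j => by
    change (𝟙 _ ≫ f ≫ 𝟙 _ : L.obj.obj ⟶ M.obj.obj) ∈ R.q.hom L.obj M.obj (M.phase - L.phase)
    rwa [Category.id_comp, Category.comp_id]⟩

lemma hom_mem {L M : LiftedIndec R} (f : L.lift ⟶ M.lift) :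
    f.1 ∈ R.q.hom L.obj M.obj (M.phase - L.phase) := by
  have h : 𝟙 L.obj.obj ≫ f.1 ≫ 𝟙 M.obj.obj ∈ R.q.hom L.obj M.obj (M.phase - L.phase) :=
    f.2 (0 : Fin 1) (0 : Fin 1)
  rwa [Category.id_comp, Category.comp_id] at h

lemma not_isZero (L : LiftedIndec R) : ¬ IsZero L.lift := fun h =>
  L.obj.id_ne_zero (congrArg Subtype.val ((IsZero.iff_id_eq_zero _).1 h))

end LiftedIndec

namespace LiftedObj

variable {X Y Z : LiftedObj R}

/-- The inclusion of a summand. -/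
def incl (X : LiftedObj R) (i : Fin X.dec.n) : (X.summand i).lift ⟶ X :=
  ⟨X.dec.inj i, fun a j => by
    change 𝟙 _ ≫ X.dec.inj i ≫ X.dec.proj j ∈
      R.q.hom (X.dec.summand i) (X.dec.summand j) (X.phase j - X.phase i)
    rw [Category.id_comp]
    by_cases h : i = j
    · subst h
      rw [X.dec.inj_proj_self, sub_self]
      exact R.q.id_mem _
    · rw [X.dec.inj_proj_ne i j h]
      exact zero_mem _⟩

/-- The projection to a summand. -/
def pr (X : LiftedObj R) (i : Fin X.dec.n) : X ⟶ (X.summand i).lift :=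
  ⟨X.dec.proj i, fun j a => by
    change X.dec.inj j ≫ X.dec.proj i ≫ 𝟙 _ ∈
      R.q.hom (X.dec.summand j) (X.dec.summand i) (X.phase i - X.phase j)
    rw [Category.comp_id]
    by_cases h : j = i
    · subst h
      rw [X.dec.inj_proj_self, sub_self]
      exact R.q.id_mem _
    · rw [X.dec.inj_proj_ne j i h]
      exact zero_mem _⟩

@[simp]
lemma sum_val {ι : Type*} (s : Finset ι) (f : ι → (X ⟶ Y)) :
    (∑ i ∈ s, f i).1 = ∑ i ∈ s, (f i).1 :=
  map_sum (homs X Y).subtype f s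

variable (X) in
/-- Every object is the direct sum of its summands `(Eᵢ, θᵢ)`. -/
def sumData : SumData X fun i => (X.summand i).lift where
  inj := X.incl
  proj := X.pr
  inj_proj_self i := Subtype.ext (X.dec.inj_proj_self i)
  inj_proj_ne i j h := Subtype.ext (X.dec.inj_proj_ne i j h)
  total := Subtype.ext <| by
    rw [sum_val]
    exact X.dec.sum_proj_inj

open Classical in
/-- Finite direct sums of objects `(E, θ)` exist. -/
lemma exists_sumData {ι : Type} [Fintype ι] (L : ι → LiftedIndec R) :
    ∃ X : LiftedObj R, X.dec.n = Fintype.card ι ∧ Nonempty (SumData X fun i => (L i).lift) := by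
  let e : Fin (Fintype.card ι) ≃ ι := (Fintype.equivFin ι).symm
  let F : ι → C := fun i => (L i).obj.obj
  have hne : ∀ i j, i ≠ j → biproduct.ι F i ≫ biproduct.π F j = 0 :=
    fun i j h => biproduct.ι_π_ne _ h
  have hs : ∀ i, biproduct.ι F i ≫ biproduct.π F i = 𝟙 (F i) :=
    fun i => biproduct.ι_π_self F i
  have key : ∀ i j, biproduct.ι F i ≫ biproduct.π F j ∈
      R.q.hom (L i).obj (L j).obj ((L j).phase - (L i).phase) := by
    intro i j
    by_cases h : i = j
    · subst h
      rw [hs, sub_self]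
      exact R.q.id_mem _
    · rw [hne i j h]
      exact zero_mem _
  let X : LiftedObj R :=
    { obj := ⨁ F
      dec :=
        { n := Fintype.card ι
          summand := fun j => (L (e j)).obj
          inj := fun j => biproduct.ι F (e j)
          proj := fun j => biproduct.π F (e j)
          inj_proj_self := fun j => hs (e j)
          inj_proj_ne := fun i j h => hne _ _ (e.injective.ne h)
          sum_proj_inj := by
            rw [e.sum_comp fun i => biproduct.π F i ≫ biproduct.ι F i]
            exact biproduct.total }
      phase := fun j => (L (e j)).phase
      phase_spec := fun j => (L (e j)).phase_spec }
  refine ⟨X, rfl, ⟨⟨fun i => ⟨biproduct.ι F i, fun a j => ?_⟩, fun i => ⟨biproduct.π F i,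
    fun j a => ?_⟩, fun i => Subtype.ext (hs i),
    fun i j h => Subtype.ext (hne i j h), Subtype.ext ?_⟩⟩⟩
  · change 𝟙 _ ≫ biproduct.ι F i ≫ biproduct.π F (e j) ∈ _
    rw [Category.id_comp]
    exact key i (e j)
  · change biproduct.ι F (e j) ≫ biproduct.π F i ≫ 𝟙 _ ∈ _
    rw [Category.comp_id]
    exact key (e j) i
  · rw [sum_val]
    exact biproduct.total (f := F)

/-- Binary direct sums exist in the `ℤ`-lift. -/
lemma exists_binSplit (X Y : LiftedObj R) : ∃ Z : LiftedObj R, Nonempty (BinSplit Z X Y) := by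
  obtain ⟨Z, -, ⟨s⟩⟩ := exists_sumData (Sum.elim X.summand Y.summand)
  exact ⟨Z, ⟨s.splitSum (X₁ := X) (X₂ := Y) X.sumData Y.sumData⟩⟩

/-! ### The degree `0` part of a morphism of `C` -/

lemma exists_degZero (f : X.obj ⟶ Y.obj) : ∃ g : X ⟶ Y, ∀ i j,
    X.dec.inj i ≫ g.1 ≫ Y.dec.proj j =
      R.q.part (X.dec.summand i) (Y.dec.summand j) (Y.phase j - X.phase i)
        (X.dec.inj i ≫ f ≫ Y.dec.proj j) := by
  let g : X.obj ⟶ Y.obj := X.dec.sumData.desc fun i => Y.dec.sumData.lift fun j =>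
    R.q.part (X.dec.summand i) (Y.dec.summand j) (Y.phase j - X.phase i)
      (X.dec.inj i ≫ f ≫ Y.dec.proj j)
  have h : ∀ i j, X.dec.inj i ≫ g ≫ Y.dec.proj j =
      R.q.part (X.dec.summand i) (Y.dec.summand j) (Y.phase j - X.phase i)
        (X.dec.inj i ≫ f ≫ Y.dec.proj j) := fun i j => by
    have h1 := X.dec.sumData.inj_desc_assoc (fun i => Y.dec.sumData.lift fun j =>
      R.q.part (X.dec.summand i) (Y.dec.summand j) (Y.phase j - X.phase i)
        (X.dec.inj i ≫ f ≫ Y.dec.proj j)) i (Y.dec.sumData.proj j)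
    exact h1.trans (Y.dec.sumData.lift_proj _ j)
  refine ⟨⟨g, fun i j => ?_⟩, h⟩
  rw [h]
  exact RealDecomposition.part_mem _ _

/-- The part of a morphism of `C` which belongs to the `ℤ`-lift. -/
def degZero (f : X.obj ⟶ Y.obj) : X ⟶ Y := (exists_degZero f).choose

lemma entry_degZero (f : X.obj ⟶ Y.obj) (i : Fin X.dec.n) (j : Fin Y.dec.n) :
    X.dec.inj i ≫ (degZero f).1 ≫ Y.dec.proj j =
      R.q.part (X.dec.summand i) (Y.dec.summand j) (Y.phase j - X.phase i)
        (X.dec.inj i ≫ f ≫ Y.dec.proj j) :=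
  (exists_degZero f).choose_spec i j

lemma degZero_val (f : X ⟶ Y) : degZero f.1 = f :=
  Subtype.ext <| X.dec.hom_ext Y.dec fun i j => by
    rw [entry_degZero, RealDecomposition.part_of_mem (f.2 i j)]

lemma degZero_comp (f : X ⟶ Y) (g : Y.obj ⟶ Z.obj) : degZero (f.1 ≫ g) = f ≫ degZero g :=
  Subtype.ext <| X.dec.hom_ext Z.dec fun i j => by
    rw [entry_degZero, comp_val, X.dec.entry_comp Y.dec Z.dec, X.dec.entry_comp Y.dec Z.dec,
      map_sum]
    refine Finset.sum_congr rfl fun l _ => ?_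
    rw [entry_degZero, ← RealDecomposition.part_comp_of_mem (f.2 i l)]
    congr 1
    ring_nf

lemma comp_degZero (f : X.obj ⟶ Y.obj) (g : Y ⟶ Z) : degZero (f ≫ g.1) = degZero f ≫ g :=
  Subtype.ext <| X.dec.hom_ext Z.dec fun i j => by
    rw [entry_degZero, comp_val, X.dec.entry_comp Y.dec Z.dec, X.dec.entry_comp Y.dec Z.dec,
      map_sum]
    refine Finset.sum_congr rfl fun l _ => ?_
    rw [entry_degZero, ← RealDecomposition.part_comp_of_mem' _ (g.2 l j)]
    congr 1
    ring_nf

/-- A morphism all of whose matrix entries have a degree different from that of the morphisms of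
the `ℤ`-lift has no part in the `ℤ`-lift. -/
lemma degZero_eq_zero {f : X.obj ⟶ Y.obj} (h : ∀ i j, ∃ a, a ≠ Y.phase j - X.phase i ∧
    X.dec.inj i ≫ f ≫ Y.dec.proj j ∈ R.q.hom (X.dec.summand i) (Y.dec.summand j) a) :
    degZero f = 0 :=
  Subtype.ext <| X.dec.hom_ext Y.dec fun i j => by
    obtain ⟨a, ha, hf⟩ := h i j
    rw [entry_degZero, RealDecomposition.part_of_mem_ne hf ha.symm]
    simp

/-- The covering functor reflects isomorphisms. -/
lemma isIso_of_isIso_val (f : X ⟶ Y) [IsIso f.1] : IsIso f :=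
  ⟨degZero (inv f.1), by rw [← degZero_comp, IsIso.hom_inv_id]; exact degZero_val (𝟙 X),
    by rw [← comp_degZero, IsIso.inv_hom_id]; exact degZero_val (𝟙 Y)⟩

lemma isIso_val (f : X ⟶ Y) [IsIso f] : IsIso f.1 := inferInstanceAs (IsIso ((π R).map f))

lemma isZero_iff : IsZero X ↔ X.dec.n = 0 := by
  rw [← X.dec.isZero_iff, IsZero.iff_id_eq_zero, IsZero.iff_id_eq_zero]
  exact ⟨fun h => congrArg Subtype.val h, fun h => Subtype.ext h⟩

/-- Endomorphism rings of the objects `(E, θ)` are local. -/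
lemma isLocalRing_end_lift (hloc : ∀ E : IndecObj C, IsLocalRing (End E.obj))
    (L : LiftedIndec R) : IsLocalRing (End L.lift) := by
  have := hloc L.obj
  have : Nontrivial (End L.lift) :=
    ⟨𝟙 L.lift, 0, fun h => L.not_isZero ((IsZero.iff_id_eq_zero _).2 h)⟩
  refine IsLocalRing.of_isUnit_or_isUnit_of_isUnit_add fun f g h => ?_
  have h1 : IsIso ((f : L.lift ⟶ L.lift) + g) := (isUnit_iff_isIso (X := L.lift) _).1 h
  have h2 : IsIso ((f : L.lift ⟶ L.lift).1 + (g : L.lift ⟶ L.lift).1 :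
      L.obj.obj ⟶ L.obj.obj) := isIso_val ((f : L.lift ⟶ L.lift) + g)
  rcases isIso_or_isIso_of_isIso_add h2 with h | h
  · exact Or.inl ((isUnit_iff_isIso (X := L.lift) _).2 (isIso_of_isIso_val f))
  · exact Or.inr ((isUnit_iff_isIso (X := L.lift) _).2 (isIso_of_isIso_val g))

end LiftedObj

end LiftBasics

end CyclicStab

end

open CategoryTheory CategoryTheory.Limits CategoryTheory.Pretriangulated

noncomputable section

namespace CyclicStab

universe v u w w'

section Potentials

variable {C : Type u} [Category.{v} C] [HasZeroObject C] [Preadditive C] [HasShift C ℤ]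
  [∀ n : ℤ, (shiftFunctor C n).Additive] [Pretriangulated C]
  {k : Type w} [Field k] [Linear k C] {β : shiftFunctor C (2 : ℤ) ≅ 𝟭 C}
  {q : RealDecomposition k β}

/-! ### Degrees of connecting paths and potentials of diagrams -/

lemma Zigzag.HasDegree.unique {E F : IndecObj C} {l : Zigzag E F} {a b : ℝ}
    (ha : l.HasDegree q a) (hb : l.HasDegree q b) : a = b := by
  induction l generalizing a b with
  | nil E => exact Eq.trans ha (Eq.symm hb)
  | fwd f l ih =>
    obtain ⟨hf, a₁, a₂, h₁, h₂, rfl⟩ := ha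
    obtain ⟨-, b₁, b₂, h₁', h₂', rfl⟩ := hb
    rw [RealDecomposition.degree_unique hf h₁ h₁', ih h₂ h₂']
  | bwd f l ih =>
    obtain ⟨hf, a₁, a₂, h₁, h₂, rfl⟩ := ha
    obtain ⟨-, b₁, b₂, h₁', h₂', rfl⟩ := hb
    rw [RealDecomposition.degree_unique hf h₁ h₁', ih h₂ h₂']

namespace Diagram

variable {D : Diagram C}

variable (D q) in
/-- The nodes `x` and `y` are joined by a connecting path of degree `a` in the diagram. -/
def Joined (x y : D.Node) (a : ℝ) : Prop := ∃ l : D.Path x y, l.toZigzag.HasDegree q a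

lemma Joined.refl (x : D.Node) : D.Joined q x x 0 := ⟨.nil x, rfl⟩

lemma Joined.cons {v w : D.V} {z : D.Node} (e : D.Edge v w) {i : Fin (D.dec v).n}
    {j : Fin (D.dec w).n} {a b : ℝ} (h : D.comp e i j ≠ 0)
    (ha : D.comp e i j ∈ q.hom (D.summand ⟨v, i⟩) (D.summand ⟨w, j⟩) a)
    (hl : D.Joined q ⟨w, j⟩ z b) : D.Joined q ⟨v, i⟩ z (a + b) := by
  obtain ⟨l, hl⟩ := hl
  exact ⟨.fwd e i j l, h, a, b, ha, hl, rfl⟩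

lemma Joined.cons' {v w : D.V} {z : D.Node} (e : D.Edge v w) {i : Fin (D.dec v).n}
    {j : Fin (D.dec w).n} {a b : ℝ} (h : D.comp e i j ≠ 0)
    (ha : D.comp e i j ∈ q.hom (D.summand ⟨v, i⟩) (D.summand ⟨w, j⟩) a)
    (hl : D.Joined q ⟨v, i⟩ z b) : D.Joined q ⟨w, j⟩ z (-a + b) := by
  obtain ⟨l, hl⟩ := hl
  exact ⟨.bwd e i j l, h, a, b, ha, hl, rfl⟩

lemma Joined.trans {x y z : D.Node} {a b : ℝ} (h₁ : D.Joined q x y a) (h₂ : D.Joined q y z b) :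
    D.Joined q x z (a + b) := by
  obtain ⟨l, hl⟩ := h₁
  induction l generalizing a with
  | nil x =>
    obtain rfl : a = 0 := hl
    simpa using h₂
  | fwd e i j l ih =>
    obtain ⟨hf, c, d, hc, hd, rfl⟩ := hl
    rw [add_assoc]
    exact (ih h₂ hd).cons e hf hc
  | bwd e i j l ih =>
    obtain ⟨hf, c, d, hc, hd, rfl⟩ := hl
    rw [add_assoc]
    exact (ih h₂ hd).cons' e hf hc

lemma Joined.symm {x y : D.Node} {a : ℝ} (h : D.Joined q x y a) : D.Joined q y x (-a) := by
  obtain ⟨l, hl⟩ := h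
  induction l generalizing a with
  | nil x =>
    obtain rfl : a = 0 := hl
    simpa using Joined.refl (q := q) x
  | fwd e i j l ih =>
    obtain ⟨hf, c, d, hc, hd, rfl⟩ := hl
    have := (ih hd).trans ((Joined.refl (q := q) _).cons' e hf hc)
    rwa [show -(c + d) = -d + (-c + 0) by ring]
  | bwd e i j l ih =>
    obtain ⟨hf, c, d, hc, hd, rfl⟩ := hl
    have := (ih hd).trans ((Joined.refl (q := q) _).cons e hf hc)
    rwa [show -(-c + d) = -d + (c + 0) by ring]

lemma connective_iff : D.Connective q ↔ ∀ x y, ∃ a, D.Joined q x y a :=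
  ⟨fun h x y => let ⟨l, a, ha⟩ := h x y; ⟨a, l, ha⟩,
    fun h x y => let ⟨a, l, ha⟩ := h x y; ⟨l, a, ha⟩⟩

variable (D q) in
/-- A potential assigns to each node of a diagram a real number such that every matrix entry of a
morphism of the diagram is homogeneous of degree the difference of the values at its ends. -/
def IsPotential (p : D.Node → ℝ) : Prop :=
  ∀ (v w : D.V) (e : D.Edge v w) (i : Fin (D.dec v).n) (j : Fin (D.dec w).n),
    D.comp e i j ∈ q.hom (D.summand ⟨v, i⟩) (D.summand ⟨w, j⟩) (p ⟨w, j⟩ - p ⟨v, i⟩)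

lemma IsPotential.degree_eq {p : D.Node → ℝ} (hp : D.IsPotential q p) {x y : D.Node}
    (l : D.Path x y) {a : ℝ} (h : l.toZigzag.HasDegree q a) : a = p y - p x := by
  induction l generalizing a with
  | nil x => exact Eq.trans h (by ring)
  | fwd e i j l ih =>
    obtain ⟨hf, c, d, hc, hd, rfl⟩ := h
    rw [ih hd, RealDecomposition.degree_unique hf hc (hp _ _ e i j)]
    ring
  | bwd e i j l ih =>
    obtain ⟨hf, c, d, hc, hd, rfl⟩ := h
    rw [ih hd, RealDecomposition.degree_unique hf hc (hp _ _ e i j)]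
    ring

lemma Joined.degree_eq {x y : D.Node} {a : ℝ} (h : D.Joined q x y a) {p : D.Node → ℝ}
    (hp : D.IsPotential q p) : a = p y - p x := by
  obtain ⟨l, hl⟩ := h
  exact hp.degree_eq l hl

/-- A diagram is liftable if and only if it has a potential. -/
lemma liftable_iff_exists_isPotential : D.Liftable q ↔ ∃ p, D.IsPotential q p := by
  classical
  constructor
  · rintro ⟨hh, hl⟩
    let S : Setoid D.Node :=
      ⟨fun x y => ∃ a, D.Joined q x y a, fun x => ⟨0, Joined.refl x⟩,
        fun ⟨a, h⟩ => ⟨-a, h.symm⟩, fun ⟨a, h⟩ ⟨b, h'⟩ => ⟨a + b, h.trans h'⟩⟩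
    have hr : ∀ x : D.Node, ∃ a, D.Joined q (Quotient.mk S x).out x a :=
      fun x => Quotient.exact (s := S) (Quotient.out_eq _)
    choose p hp using hr
    refine ⟨p, fun v w e i j => ?_⟩
    obtain ⟨b, hb⟩ := hh v w e i j
    by_cases h0 : D.comp e i j = 0
    · rw [h0]; exact zero_mem _
    · have h1 : D.Joined q ⟨v, i⟩ ⟨w, j⟩ (b + 0) := (Joined.refl _).cons e h0 hb
      have h2 : Quotient.mk S ⟨v, i⟩ = Quotient.mk S ⟨w, j⟩ := Quotient.sound (s := S) ⟨_, h1⟩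
      have h3 := hp ⟨v, i⟩
      rw [h2] at h3
      obtain ⟨l, h4⟩ := (h3.trans h1).trans (hp ⟨w, j⟩).symm
      have h5 := hl _ l _ h4
      rwa [show p ⟨w, j⟩ - p ⟨v, i⟩ = b by linarith]
  · rintro ⟨p, hp⟩
    refine ⟨fun v w e i j => ⟨_, hp v w e i j⟩, fun x l a h => ?_⟩
    rw [hp.degree_eq l h, sub_self]

/-- A property of nodes which is invariant under nonzero matrix entries is invariant under
connecting paths. -/
lemma Joined.invariant {P : D.Node → Prop}
    (hP : ∀ (v w : D.V) (e : D.Edge v w) (i : Fin (D.dec v).n) (j : Fin (D.dec w).n),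
      D.comp e i j ≠ 0 → (P ⟨v, i⟩ ↔ P ⟨w, j⟩))
    {x y : D.Node} {a : ℝ} (h : D.Joined q x y a) : P x ↔ P y := by
  obtain ⟨l, hl⟩ := h
  induction l generalizing a with
  | nil x => rfl
  | fwd e i j l ih =>
    obtain ⟨hf, c, d, hc, hd, rfl⟩ := hl
    exact (hP _ _ e i j hf).trans (ih hd)
  | bwd e i j l ih =>
    obtain ⟨hf, c, d, hc, hd, rfl⟩ := hl
    exact (hP _ _ e i j hf).symm.trans (ih hd)

end Diagram

namespace ShiftDiagram

variable (D : ShiftDiagram C)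

/-- The matrix entries of the morphisms `X → Y[1]`. -/
def comp₁ {v w : D.V} (e : D.Edge₁ v w) (i : Fin (D.dec v).n) (j : Fin (D.dec w).n) :
    ((D.dec v).summand i).obj ⟶ (((D.dec w).summand j).shift 1).obj :=
  (D.dec v).inj i ≫ D.map₁ e ≫ ((D.dec w).proj j)⟦(1 : ℤ)⟧'

/-- The matrix entries of the morphisms `X → Y`. -/
def comp₀ {v w : D.V} (e : D.Edge v w) (i : Fin (D.dec v).n) (j : Fin (D.dec w).n) :
    ((D.dec v).summand i).obj ⟶ ((D.dec w).summand j).obj :=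
  (D.dec v).inj i ≫ D.map e ≫ (D.dec w).proj j

lemma unroll_comp_zero {v w : D.V} (e : D.Edge v w) (n : ℤ) (i : Fin (D.dec v).n)
    (j : Fin (D.dec w).n) :
    D.unroll.comp (v := (v, n)) (w := (w, n)) (.zero e n) i j = (D.comp₀ e i j)⟦n⟧' := by
  rw [comp₀, Functor.map_comp, Functor.map_comp]
  rfl

lemma unroll_comp_one {v w : D.V} (e : D.Edge₁ v w) (n : ℤ) (i : Fin (D.dec v).n)
    (j : Fin (D.dec w).n) :
    D.unroll.comp (v := (v, n)) (w := (w, 1 + n)) (.one e n) i j = (D.comp₁ e i j)⟦n⟧' ≫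
      (shiftFunctorAdd C 1 n).inv.app ((D.dec w).summand j).obj := by
  have h : D.unroll.comp (v := (v, n)) (w := (w, 1 + n)) (.one e n) i j =
    ((D.dec v).inj i)⟦n⟧' ≫ ((D.map₁ e)⟦n⟧' ≫ (shiftFunctorAdd C 1 n).inv.app (D.obj w)) ≫
      ((D.dec w).proj j)⟦1 + n⟧' := rfl
  rw [h, comp₁, Functor.map_comp, Functor.map_comp, Category.assoc, Category.assoc,
    Category.assoc]
  congr 2
  exact ((shiftFunctorAdd C 1 n).inv.naturality ((D.dec w).proj j)).symm

/-- Potentials of the unrolled diagram, in terms of the entries of the morphisms of a diagram. -/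
lemma isPotential_unroll_iff (p : D.unroll.Node → ℝ) : D.unroll.IsPotential q p ↔
    (∀ (v w : D.V) (e : D.Edge v w) (i : Fin (D.dec v).n) (j : Fin (D.dec w).n) (n : ℤ),
      D.comp₀ e i j ∈ q.hom ((D.dec v).summand i) ((D.dec w).summand j)
        (p ⟨(w, n), j⟩ - p ⟨(v, n), i⟩)) ∧
    ∀ (v w : D.V) (e : D.Edge₁ v w) (i : Fin (D.dec v).n) (j : Fin (D.dec w).n) (n : ℤ),
      D.comp₁ e i j ∈ q.hom ((D.dec v).summand i) (((D.dec w).summand j).shift 1)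
        (p ⟨(w, 1 + n), j⟩ - p ⟨(v, n), i⟩) := by
  have key : ∀ (v w : D.V) (e : D.Edge₁ v w) (i : Fin (D.dec v).n) (j : Fin (D.dec w).n) (n : ℤ)
      (a : ℝ), D.unroll.comp (v := (v, n)) (w := (w, 1 + n)) (.one e n) i j ∈
        q.hom (((D.dec v).summand i).shift n) (((D.dec w).summand j).shift (1 + n)) a ↔
      D.comp₁ e i j ∈ q.hom ((D.dec v).summand i) (((D.dec w).summand j).shift 1) a := by
    intro v w e i j n a
    rw [unroll_comp_one]
    refine (RealDecomposition.comp_iso_mem_iff (q := q)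
      (F := (((D.dec w).summand j).shift 1).shift n) (G := ((D.dec w).summand j).shift (1 + n))
      ((shiftFunctorAdd C 1 n).symm.app ((D.dec w).summand j).obj) ?_).trans
      (RealDecomposition.shift_mem_iff n)
    exact q.inv_mem (E := ((D.dec w).summand j).shift (1 + n)) _ _ (q.shiftAdd_mem _ 1 n)
      (by simp) (by simp)
  have key₀ : ∀ (v w : D.V) (e : D.Edge v w) (i : Fin (D.dec v).n) (j : Fin (D.dec w).n) (n : ℤ)
      (a : ℝ), D.unroll.comp (v := (v, n)) (w := (w, n)) (.zero e n) i j ∈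
        q.hom (((D.dec v).summand i).shift n) (((D.dec w).summand j).shift n) a ↔
      D.comp₀ e i j ∈ q.hom ((D.dec v).summand i) ((D.dec w).summand j) a := by
    intro v w e i j n a
    rw [unroll_comp_zero]
    exact RealDecomposition.shift_mem_iff n
  constructor
  · intro h
    refine ⟨fun v w e i j n => ?_, fun v w e i j n => ?_⟩
    · exact (key₀ v w e i j n _).1 (h (v, n) (w, n) (.zero e n) i j)
    · exact (key v w e i j n _).1 (h (v, n) (w, 1 + n) (.one e n) i j)
  · rintro ⟨h₀, h₁⟩ _ _ e i j
    cases e with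
    | zero e n => exact (key₀ _ _ e i j n _).2 (h₀ _ _ e i j n)
    | one e n => exact (key _ _ e i j n _).2 (h₁ _ _ e i j n)

end ShiftDiagram

end Potentials

end CyclicStab

end

open CategoryTheory CategoryTheory.Limits CategoryTheory.Pretriangulated

noncomputable section

namespace CyclicStab

universe v u w w'

section SumTriangles

variable {C : Type u} [Category.{v} C] [HasZeroObject C] [Preadditive C] [HasShift C ℤ]
  [∀ n : ℤ, (shiftFunctor C n).Additive] [Pretriangulated C]

/-! ### Direct sums of distinguished triangles -/

lemma BinSplit.isIso_pi_lift {X : C} {F : Bool → C} (s : BinSplit X (F true) (F false))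
    (φ : ∀ j, X ⟶ F j) (h₁ : φ true = s.p₁) (h₂ : φ false = s.p₂) : IsIso (Pi.lift φ) := by
  refine ⟨Pi.π F true ≫ s.i₁ + Pi.π F false ≫ s.i₂, ?_, ?_⟩
  · rw [Preadditive.comp_add, Pi.lift_π_assoc, Pi.lift_π_assoc, h₁, h₂, s.total]
  · refine Pi.hom_ext _ _ fun j => ?_
    rw [Category.assoc, Pi.lift_π, Category.id_comp]
    cases j
    · rw [h₂]; simp
    · rw [h₁]; simp

/-- A triangle which is the direct sum of two distinguished triangles is distinguished. -/
lemma distinguished_of_binSplit {T T₁ T₂ : Triangle C} (h₁ : T₁ ∈ distTriang C)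
    (h₂ : T₂ ∈ distTriang C) (φ₁ : T ⟶ T₁) (φ₂ : T ⟶ T₂)
    (s : BinSplit T.obj₁ T₁.obj₁ T₂.obj₁) (hs₁ : φ₁.hom₁ = s.p₁) (hs₂ : φ₂.hom₁ = s.p₂)
    (s' : BinSplit T.obj₂ T₁.obj₂ T₂.obj₂) (hs₁' : φ₁.hom₂ = s'.p₁) (hs₂' : φ₂.hom₂ = s'.p₂)
    (s'' : BinSplit T.obj₃ T₁.obj₃ T₂.obj₃) (hs₁'' : φ₁.hom₃ = s''.p₁)
    (hs₂'' : φ₂.hom₃ = s''.p₂) : T ∈ distTriang C := by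
  let F : Bool → Triangle C := fun b => Bool.rec T₂ T₁ b
  let φ : ∀ j, T ⟶ F j := fun b => Bool.rec φ₂ φ₁ b
  have hF : ∀ j, F j ∈ distTriang C := by
    rintro (_ | _)
    · exact h₂
    · exact h₁
  let ψ : T ⟶ productTriangle F := productTriangle.lift F φ
  have i₁ : IsIso ψ.hom₁ := BinSplit.isIso_pi_lift (F := fun j => (F j).obj₁) s
    (fun j => (φ j).hom₁) hs₁ hs₂
  have i₂ : IsIso ψ.hom₂ := BinSplit.isIso_pi_lift (F := fun j => (F j).obj₂) s'
    (fun j => (φ j).hom₂) hs₁' hs₂'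
  have i₃ : IsIso ψ.hom₃ := BinSplit.isIso_pi_lift (F := fun j => (F j).obj₃) s''
    (fun j => (φ j).hom₃) hs₁'' hs₂''
  have : IsIso ψ := Triangle.isIso_of_isIsos _ i₁ i₂ i₃
  exact isomorphic_distinguished _ (productTriangle_distinguished F hF) _ (asIso ψ)

end SumTriangles

section LiftTriangles

variable {C : Type u} [Category.{v} C] [HasZeroObject C] [Preadditive C] [HasShift C ℤ]
  [∀ n : ℤ, (shiftFunctor C n).Additive] [Pretriangulated C]
  {k : Type w} [Field k] [Linear k C] {β : shiftFunctor C (2 : ℤ) ≅ 𝟭 C}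
  {Λ : Type w'} [AddCommGroup Λ] {v : K0 C (distTriang C) →+ Λ} {R : ChargeTriple k β v}

namespace LiftedObj

variable {X X₁ X₂ Y Y₁ Y₂ : LiftedObj R}

/-- The morphism `f` of the `ℤ`-lift is part of a triangle whose image in `C` is distinguished. -/
def HasCone (f : X ⟶ Y) : Prop :=
  ∃ (Z : LiftedObj R) (g : Y ⟶ Z) (h : Z ⟶ X⟦(1 : ℤ)⟧), Triangle.mk f g h ∈ distinguished R

lemma mem_distinguished_iff {X Y Z : LiftedObj R} (f : X ⟶ Y) (g : Y ⟶ Z)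
    (h : Z ⟶ X⟦(1 : ℤ)⟧) : Triangle.mk f g h ∈ distinguished R ↔
      Triangle.mk (C := C) (X := X.obj) (Y := Y.obj) (Z := Z.obj) f.1 g.1 h.1 ∈
        distTriang C := Iff.rfl

/-- The image of a splitting in `C`. -/
def mapBinSplit (s : BinSplit X X₁ X₂) : BinSplit X.obj X₁.obj X₂.obj where
  i₁ := s.i₁.1
  i₂ := s.i₂.1
  p₁ := s.p₁.1
  p₂ := s.p₂.1
  i₁_p₁ := congrArg Subtype.val s.i₁_p₁
  i₁_p₂ := congrArg Subtype.val s.i₁_p₂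
  i₂_p₁ := congrArg Subtype.val s.i₂_p₁
  i₂_p₂ := congrArg Subtype.val s.i₂_p₂
  total := congrArg Subtype.val s.total

/-- Cones of direct sums of morphisms. -/
lemma HasCone.binSplit (s : BinSplit X X₁ X₂) (t : BinSplit Y Y₁ Y₂) {f : X ⟶ Y}
    (h₁₂ : s.i₁ ≫ f ≫ t.p₂ = 0) (h₂₁ : s.i₂ ≫ f ≫ t.p₁ = 0)
    (h₁ : HasCone (s.i₁ ≫ f ≫ t.p₁)) (h₂ : HasCone (s.i₂ ≫ f ≫ t.p₂)) : HasCone f := by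
  obtain ⟨Z₁, g₁, k₁, hT₁⟩ := h₁
  obtain ⟨Z₂, g₂, k₂, hT₂⟩ := h₂
  obtain ⟨Z, ⟨r⟩⟩ := exists_binSplit Z₁ Z₂
  have e₁ : f ≫ t.p₁ = s.p₁ ≫ s.i₁ ≫ f ≫ t.p₁ :=
    s.hom_ext (by simp) (by simp [h₂₁])
  have e₂ : f ≫ t.p₂ = s.p₂ ≫ s.i₂ ≫ f ≫ t.p₂ :=
    s.hom_ext (by simp [h₁₂]) (by simp)
  let g : Y ⟶ Z := t.p₁ ≫ g₁ ≫ r.i₁ + t.p₂ ≫ g₂ ≫ r.i₂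
  let k : Z ⟶ X⟦(1 : ℤ)⟧ := r.p₁ ≫ k₁ ≫ s.i₁⟦(1 : ℤ)⟧' + r.p₂ ≫ k₂ ≫ s.i₂⟦(1 : ℤ)⟧'
  have eg₁ : g ≫ r.p₁ = t.p₁ ≫ g₁ := by simp [g]
  have eg₂ : g ≫ r.p₂ = t.p₂ ≫ g₂ := by simp [g]
  have ek₁ : k ≫ s.p₁⟦(1 : ℤ)⟧' = r.p₁ ≫ k₁ := by
    simp only [k, Preadditive.add_comp, Category.assoc, ← Functor.map_comp, s.i₁_p₁, s.i₂_p₁,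
      Functor.map_zero, comp_zero, add_zero, CategoryTheory.Functor.map_id, Category.comp_id]
  have ek₂ : k ≫ s.p₂⟦(1 : ℤ)⟧' = r.p₂ ≫ k₂ := by
    simp only [k, Preadditive.add_comp, Category.assoc, ← Functor.map_comp, s.i₁_p₂, s.i₂_p₂,
      Functor.map_zero, comp_zero, zero_add, CategoryTheory.Functor.map_id, Category.comp_id]
  refine ⟨Z, g, k, ?_⟩
  rw [mem_distinguished_iff] at hT₁ hT₂ ⊢
  refine distinguished_of_binSplit hT₁ hT₂
    { hom₁ := s.p₁.1, hom₂ := t.p₁.1, hom₃ := r.p₁.1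
      comm₁ := congrArg Subtype.val e₁
      comm₂ := congrArg Subtype.val eg₁.symm |>.symm
      comm₃ := congrArg Subtype.val ek₁ }
    { hom₁ := s.p₂.1, hom₂ := t.p₂.1, hom₃ := r.p₂.1
      comm₁ := congrArg Subtype.val e₂
      comm₂ := congrArg Subtype.val eg₂.symm |>.symm
      comm₃ := congrArg Subtype.val ek₂ }
    (mapBinSplit s) rfl rfl (mapBinSplit t) rfl rfl (mapBinSplit r) rfl rfl

lemma isZero_obj (h : IsZero X) : IsZero X.obj :=
  X.dec.isZero_iff.2 (isZero_iff.1 h)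

lemma HasCone.of_isZero_source {f : X ⟶ Y} (h : IsZero X) : HasCone f := by
  refine ⟨Y, 𝟙 Y, 0, ?_⟩
  rw [mem_distinguished_iff, Pretriangulated.Triangle.distinguished_iff_of_isZero₁ _ (isZero_obj h)]
  exact inferInstanceAs (IsIso (𝟙 Y.obj))

lemma HasCone.of_isZero_target {f : X ⟶ Y} (h : IsZero Y) : HasCone f := by
  refine ⟨X⟦(1 : ℤ)⟧, 0, 𝟙 _, ?_⟩
  rw [mem_distinguished_iff, Pretriangulated.Triangle.distinguished_iff_of_isZero₂ _ (isZero_obj h)]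
  exact inferInstanceAs (IsIso (𝟙 (X.obj⟦(1 : ℤ)⟧)))

open ZeroObject in
lemma HasCone.of_isIso (f : X ⟶ Y) [IsIso f] : HasCone f := by
  refine ⟨0, 0, 0, ?_⟩
  rw [mem_distinguished_iff, Pretriangulated.Triangle.distinguished_iff_of_isZero₃ _ (isZero_obj (isZero_zero _))]
  exact isIso_val f

end LiftedObj

end LiftTriangles

end CyclicStab

end

open CategoryTheory CategoryTheory.Limits CategoryTheory.Pretriangulated

noncomputable section

namespace CyclicStab

universe v u w w'

section Hexagon

variable {C : Type u} [Category.{v} C] [HasZeroObject C] [Preadditive C] [HasShift C ℤ]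
  [∀ n : ℤ, (shiftFunctor C n).Additive] [Pretriangulated C]
  {k : Type w} [Field k] [Linear k C] {β : shiftFunctor C (2 : ℤ) ≅ 𝟭 C}
  {q : RealDecomposition k β}

/-! ### Local liftability of hexagons -/

namespace DecTriangle

variable (t : DecTriangle C)

/-- Entries of the first morphism of a triangle. -/
def entryF (i : Fin t.dX.n) (j : Fin t.dY.n) : (t.dX.summand i).obj ⟶ (t.dY.summand j).obj :=
  t.dX.inj i ≫ t.f ≫ t.dY.proj j

/-- Entries of the second morphism of a triangle. -/
def entryG (i : Fin t.dY.n) (j : Fin t.dZ.n) : (t.dY.summand i).obj ⟶ (t.dZ.summand j).obj :=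
  t.dY.inj i ≫ t.g ≫ t.dZ.proj j

/-- Entries of the third morphism of a triangle. -/
def entryH (i : Fin t.dZ.n) (j : Fin t.dX.n) :
    (t.dZ.summand i).obj ⟶ ((t.dX.summand j).shift 1).obj :=
  t.dZ.inj i ≫ t.h ≫ (t.dX.proj j)⟦(1 : ℤ)⟧'

variable (q) in
/-- A potential of the long sequence of all shifts of a triangle: its values on the summands of
`X[n]`, `Y[n]` and `Z[n]`. -/
structure LongPotential where
  F : ℤ → Fin t.dX.n → ℝ
  G : ℤ → Fin t.dY.n → ℝ
  H : ℤ → Fin t.dZ.n → ℝ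
  f_mem : ∀ n i j, t.entryF i j ∈ q.hom (t.dX.summand i) (t.dY.summand j) (G n j - F n i)
  g_mem : ∀ n i j, t.entryG i j ∈ q.hom (t.dY.summand i) (t.dZ.summand j) (H n j - G n i)
  h_mem : ∀ n i j, t.entryH i j ∈
    q.hom (t.dZ.summand i) ((t.dX.summand j).shift 1) (F (1 + n) j - H n i)

lemma exists_longPotential (h : t.diagram.unroll.Liftable q) : Nonempty (t.LongPotential q) := by
  obtain ⟨p, hp⟩ := Diagram.liftable_iff_exists_isPotential.1 h
  obtain ⟨h₀, h₁⟩ := (ShiftDiagram.isPotential_unroll_iff _ p).1 hp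
  exact ⟨⟨fun n i => p ⟨(.X, n), i⟩, fun n i => p ⟨(.Y, n), i⟩, fun n i => p ⟨(.Z, n), i⟩,
    fun n i j => h₀ _ _ .f i j n, fun n i j => h₀ _ _ .g i j n, fun n i j => h₁ _ _ .h i j n⟩⟩

variable {t}

/-- The values of a potential of the long sequence on the hexagon, where each vertex of the
hexagon is lifted to the vertex with the given shift in the long sequence. -/
def LongPotential.hex (p : t.LongPotential q) (m : HexVertex → ℤ) : (t.hexagon β).Node → ℝ
  | ⟨.X, i⟩ => p.F (m .X) i
  | ⟨.Y, i⟩ => p.G (m .Y) i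
  | ⟨.Z, i⟩ => p.H (m .Z) i
  | ⟨.X₁, i⟩ => p.F (m .X₁) i
  | ⟨.Y₁, i⟩ => p.G (m .Y₁) i
  | ⟨.Z₁, i⟩ => p.H (m .Z₁) i

/-- The increase of the shift along an edge of the hexagon. -/
def hexStep : ∀ {a b : HexVertex}, HexEdge a b → ℤ
  | _, _, .f => 0
  | _, _, .g => 0
  | _, _, .h => 1
  | _, _, .f₁ => 0
  | _, _, .g₁ => 0
  | _, _, .h₁ => 1

lemma shiftFunctorAdd'_inv_mem (E : IndecObj C) (m : ℤ) (h : (1 : ℤ) + 1 = m) :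
    (shiftFunctorAdd' C (1 : ℤ) 1 m h).inv.app E.obj ∈
      q.hom ((E.shift 1).shift 1) (E.shift m) 0 := by
  subst h
  rw [shiftFunctorAdd'_eq_shiftFunctorAdd]
  exact q.inv_mem (E := E.shift (1 + 1)) _ _ (q.shiftAdd_mem E 1 1) (by simp) (by simp)

lemma hexagon_comp_h₁ (i : Fin t.dZ.n) (j : Fin t.dX.n) :
    (t.hexagon β).comp (v := .Z₁) (w := .X) .h₁ i j = (t.entryH i j)⟦(1 : ℤ)⟧' ≫
      (shiftFunctorAdd' C (1 : ℤ) 1 2 (by norm_num)).inv.app (t.dX.summand j).obj ≫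
      β.hom.app (t.dX.summand j).obj := by
  have h : (t.hexagon β).comp (v := .Z₁) (w := .X) .h₁ i j =
    (t.dZ.inj i)⟦(1 : ℤ)⟧' ≫ (t.h⟦(1 : ℤ)⟧' ≫
      (shiftFunctorAdd' C (1 : ℤ) 1 2 (by norm_num)).inv.app t.X ≫
      β.hom.app t.X) ≫ t.dX.proj j := rfl
  have h1 : β.hom.app t.X ≫ t.dX.proj j =
      (t.dX.proj j)⟦(2 : ℤ)⟧' ≫ β.hom.app (t.dX.summand j).obj :=
    (β.hom.naturality (t.dX.proj j)).symm
  have h2 : (shiftFunctorAdd' C (1 : ℤ) 1 2 (by norm_num)).inv.app t.X ≫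
      (t.dX.proj j)⟦(2 : ℤ)⟧' = (t.dX.proj j)⟦(1 : ℤ)⟧'⟦(1 : ℤ)⟧' ≫
        (shiftFunctorAdd' C (1 : ℤ) 1 2 (by norm_num)).inv.app (t.dX.summand j).obj :=
    ((shiftFunctorAdd' C (1 : ℤ) 1 2 (by norm_num)).inv.naturality (t.dX.proj j)).symm
  rw [h, entryH, Functor.map_comp, Functor.map_comp, Category.assoc, Category.assoc, h1,
    reassoc_of% h2, Category.assoc, Category.assoc]

lemma mem_of_eq {E F : IndecObj C} {f g : E.obj ⟶ F.obj} {a b : ℝ} (hf : f ∈ q.hom E F a)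
    (h : a = b) (e : g = f) : g ∈ q.hom E F b := by
  rwa [e, ← h]

lemma hexagon_comp_f₁ (i : Fin t.dX.n) (j : Fin t.dY.n) :
    (t.hexagon β).comp (v := .X₁) (w := .Y₁) .f₁ i j = (t.entryF i j)⟦(1 : ℤ)⟧' := by
  rw [entryF, Functor.map_comp, Functor.map_comp]
  rfl

lemma hexagon_comp_g₁ (i : Fin t.dY.n) (j : Fin t.dZ.n) :
    (t.hexagon β).comp (v := .Y₁) (w := .Z₁) .g₁ i j = (t.entryG i j)⟦(1 : ℤ)⟧' := by
  rw [entryG, Functor.map_comp, Functor.map_comp]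
  rfl

/-- The lift of a morphism of the hexagon to the long sequence. -/
lemma LongPotential.hex_mem (p : t.LongPotential q) (m : HexVertex → ℤ) {a b : HexVertex}
    (e : HexEdge a b) (h : m b = hexStep e + m a) (i : Fin ((t.hexagon β).dec a).n)
    (j : Fin ((t.hexagon β).dec b).n) : (t.hexagon β).comp e i j ∈
      q.hom ((t.hexagon β).summand ⟨a, i⟩) ((t.hexagon β).summand ⟨b, j⟩)
        (p.hex m ⟨b, j⟩ - p.hex m ⟨a, i⟩) := by
  cases e with
  | f =>
    have hm : p.G (m .X) = p.G (m .Y) := by rw [h, hexStep, zero_add]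
    exact mem_of_eq (p.f_mem (m .X) i j) (congrArg (· - p.F (m .X) i) (congrFun hm j)) rfl
  | g =>
    have hm : p.H (m .Y) = p.H (m .Z) := by rw [h, hexStep, zero_add]
    exact mem_of_eq (p.g_mem (m .Y) i j) (congrArg (· - p.G (m .Y) i) (congrFun hm j)) rfl
  | h =>
    have hm : p.F (1 + m .Z) = p.F (m .X₁) := by rw [h, hexStep]
    exact mem_of_eq (p.h_mem (m .Z) i j) (congrArg (· - p.H (m .Z) i) (congrFun hm j)) rfl
  | f₁ =>
    have hm : p.G (m .X₁) = p.G (m .Y₁) := by rw [h, hexStep, zero_add]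
    exact mem_of_eq (q.shift_mem 1 (p.f_mem (m .X₁) i j))
      (congrArg (· - p.F (m .X₁) i) (congrFun hm j)) (hexagon_comp_f₁ i j)
  | g₁ =>
    have hm : p.H (m .Y₁) = p.H (m .Z₁) := by rw [h, hexStep, zero_add]
    exact mem_of_eq (q.shift_mem 1 (p.g_mem (m .Y₁) i j))
      (congrArg (· - p.G (m .Y₁) i) (congrFun hm j)) (hexagon_comp_g₁ i j)
  | h₁ =>
    have hm : p.F (1 + m .Z₁) = p.F (m .X) := by rw [h, hexStep]
    have h1 := q.comp_mem (q.shift_mem 1 (p.h_mem (m .Z₁) i j))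
      (q.comp_mem (shiftFunctorAdd'_inv_mem (q := q) (t.dX.summand j) 2 (by norm_num))
        (q.bott_mem (t.dX.summand j)))
    rw [add_zero, add_zero] at h1
    exact mem_of_eq h1 (congrArg (· - p.H (m .Z₁) i) (congrFun hm j)) (hexagon_comp_h₁ i j)

/-- A hexagon whose long sequence is liftable is locally liftable: a simply connected part of the
hexagon misses one of its edges, and the hexagon cut open there lifts to the long sequence. -/
lemma LongPotential.locallyLiftable (p : t.LongPotential q) :
    (t.hexagon β).LocallyLiftable q := by
  intro (W : Set HexVertex) (S : ∀ v w : HexVertex, HexEdge v w → Prop) hT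
  have key : (∃ m : HexVertex → ℤ, ∀ (a b : HexVertex) (_ : a ∈ W) (_ : b ∈ W) (e : HexEdge a b),
      S a b e → m b = hexStep e + m a) → ((t.hexagon β).sub W S).Liftable q := by
    rintro ⟨m, hm⟩
    refine Diagram.liftable_iff_exists_isPotential.2 ⟨fun x => p.hex m ⟨x.1.1, x.2⟩, ?_⟩
    intro a b e i j
    exact p.hex_mem m e.1 (hm a.1 b.1 a.2 b.2 e.1 e.2) i j
  by_contra hnot
  have hall : ∀ (a b : HexVertex) (e : HexEdge a b), a ∈ W ∧ b ∈ W ∧ S a b e := by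
    by_contra! hcon
    obtain ⟨a, b, e, he⟩ := hcon
    refine hnot (key ?_)
    cases e with
    | f =>
      refine ⟨fun | .X => 2 | .Y => 0 | .Z => 0 | .X₁ => 1 | .Y₁ => 1 | .Z₁ => 1, ?_⟩
      intro a b ha hb e hS
      cases e <;> first | exact absurd hS (he ha hb) | rfl
    | g =>
      refine ⟨fun | .X => 2 | .Y => 2 | .Z => 0 | .X₁ => 1 | .Y₁ => 1 | .Z₁ => 1, ?_⟩
      intro a b ha hb e hS
      cases e <;> first | exact absurd hS (he ha hb) | rfl
    | h =>
      refine ⟨fun | .X => 1 | .Y => 1 | .Z => 1 | .X₁ => 0 | .Y₁ => 0 | .Z₁ => 0, ?_⟩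
      intro a b ha hb e hS
      cases e <;> first | exact absurd hS (he ha hb) | rfl
    | f₁ =>
      refine ⟨fun | .X => 1 | .Y => 1 | .Z => 1 | .X₁ => 2 | .Y₁ => 0 | .Z₁ => 0, ?_⟩
      intro a b ha hb e hS
      cases e <;> first | exact absurd hS (he ha hb) | rfl
    | g₁ =>
      refine ⟨fun | .X => 1 | .Y => 1 | .Z => 1 | .X₁ => 2 | .Y₁ => 2 | .Z₁ => 0, ?_⟩
      intro a b ha hb e hS
      cases e <;> first | exact absurd hS (he ha hb) | rfl
    | h₁ =>
      refine ⟨fun | .X => 0 | .Y => 0 | .Z => 0 | .X₁ => 1 | .Y₁ => 1 | .Z₁ => 1, ?_⟩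
      intro a b ha hb e hS
      cases e <;> first | exact absurd hS (he ha hb) | rfl
  -- Otherwise the subdiagram contains the whole hexagon, which is a cycle.
  let Γ : SimpleGraph W := ((t.hexagon β).sub W S).graph
  have adj : ∀ (a b : HexVertex) (e : HexEdge a b) (ha : a ∈ W) (hb : b ∈ W), a ≠ b →
      Γ.Adj ⟨a, ha⟩ ⟨b, hb⟩ := fun a b e ha hb hne =>
    (SimpleGraph.fromRel_adj _ _ _).2 ⟨fun h => hne (congrArg Subtype.val h),
      Or.inl ⟨⟨e, (hall a b e).2.2⟩⟩⟩
  have hX : HexVertex.X ∈ W := (hall _ _ .f).1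
  have hY : HexVertex.Y ∈ W := (hall _ _ .g).1
  have hZ : HexVertex.Z ∈ W := (hall _ _ .h).1
  have hX₁ : HexVertex.X₁ ∈ W := (hall _ _ .f₁).1
  have hY₁ : HexVertex.Y₁ ∈ W := (hall _ _ .g₁).1
  have hZ₁ : HexVertex.Z₁ ∈ W := (hall _ _ .h₁).1
  let p₁ : Γ.Walk ⟨.X, hX⟩ ⟨.Y, hY⟩ := .cons (adj _ _ .f hX hY (by simp)) .nil
  let p₂ : Γ.Walk ⟨.X, hX⟩ ⟨.Y, hY⟩ :=
    .cons (adj _ _ .h₁ hZ₁ hX (by simp)).symm <| .cons (adj _ _ .g₁ hY₁ hZ₁ (by simp)).symm <|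
    .cons (adj _ _ .f₁ hX₁ hY₁ (by simp)).symm <| .cons (adj _ _ .h hZ hX₁ (by simp)).symm <|
    .cons (adj _ _ .g hY hZ (by simp)).symm .nil
  have h₁ : p₁.IsPath := by simp [p₁]
  have h₂ : p₂.IsPath := by simp [p₂]
  have := congrArg (fun p : Γ.Path ⟨.X, hX⟩ ⟨.Y, hY⟩ => p.1.length)
    ((hT.isAcyclic.subsingleton_path _ _).elim ⟨p₁, h₁⟩ ⟨p₂, h₂⟩)
  simp [p₁, p₂] at this

end DecTriangle

end Hexagon

end CyclicStab

end

open CategoryTheory CategoryTheory.Limits CategoryTheory.Pretriangulated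

noncomputable section

namespace CyclicStab

universe v u w w'

section Cones

variable {C : Type u} [Category.{v} C] [HasZeroObject C] [Preadditive C] [HasShift C ℤ]
  [∀ n : ℤ, (shiftFunctor C n).Additive] [Pretriangulated C]
  {k : Type w} [Field k] [Linear k C] {β : shiftFunctor C (2 : ℤ) ≅ 𝟭 C}
  {Λ : Type w'} [AddCommGroup Λ] {v : K0 C (distTriang C) →+ Λ} {R : ChargeTriple k β v}

/-! ### Cones in the `ℤ`-lift -/

namespace LiftedObj

variable {X Y : LiftedObj R}

/-- The matrix entries of a morphism of the `ℤ`-lift. -/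
def entry (f : X ⟶ Y) (i : Fin X.dec.n) (j : Fin Y.dec.n) :
    (X.dec.summand i).obj ⟶ (Y.dec.summand j).obj :=
  X.dec.inj i ≫ f.1 ≫ Y.dec.proj j

lemma entry_mem (f : X ⟶ Y) (i : Fin X.dec.n) (j : Fin Y.dec.n) :
    entry f i j ∈ R.q.hom (X.dec.summand i) (Y.dec.summand j) (Y.phase j - X.phase i) := f.2 i j

lemma incl_comp_pr_eq_zero {f : X ⟶ Y} {i : Fin X.dec.n} {j : Fin Y.dec.n}
    (h : entry f i j = 0) : X.incl i ≫ f ≫ Y.pr j = 0 := Subtype.ext h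

/-- The bipartite graph of the nonzero matrix entries of `f` is connected (or empty). -/
def EntryConnected (f : X ⟶ Y) : Prop :=
  ∀ (P : Fin X.dec.n → Prop) (Q : Fin Y.dec.n → Prop),
    (∀ i j, entry f i j ≠ 0 → (P i ↔ Q j)) →
      ((∀ i, P i) ∧ ∀ j, Q j) ∨ ((∀ i, ¬ P i) ∧ ∀ j, ¬ Q j)

/-- The statement that morphisms with fewer summands than `f` have cones. -/
def SmallerHaveCones (X Y : LiftedObj R) : Prop :=
  ∀ (X' Y' : LiftedObj R) (f : X' ⟶ Y'), X'.dec.n + Y'.dec.n < X.dec.n + Y.dec.n → HasCone f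

lemma HasCone.of_not_entryConnected {f : X ⟶ Y} (IH : SmallerHaveCones X Y)
    (h : ¬ EntryConnected f) : HasCone f := by
  classical
  simp only [EntryConnected, not_forall] at h
  obtain ⟨P, Q, hPQ, h⟩ := h
  obtain ⟨X₁, hX₁, ⟨s₁⟩⟩ := exists_sumData fun i : {i // P i} => X.summand i
  obtain ⟨X₂, hX₂, ⟨s₂⟩⟩ := exists_sumData fun i : {i // ¬ P i} => X.summand i
  obtain ⟨Y₁, hY₁, ⟨t₁⟩⟩ := exists_sumData fun i : {i // Q i} => Y.summand i
  obtain ⟨Y₂, hY₂, ⟨t₂⟩⟩ := exists_sumData fun i : {i // ¬ Q i} => Y.summand i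
  have cX : X₁.dec.n + X₂.dec.n = X.dec.n := by
    rw [hX₁, hX₂, ← Fintype.card_sum, Fintype.card_congr (Equiv.sumCompl P), Fintype.card_fin]
  have cY : Y₁.dec.n + Y₂.dec.n = Y.dec.n := by
    rw [hY₁, hY₂, ← Fintype.card_sum, Fintype.card_congr (Equiv.sumCompl Q), Fintype.card_fin]
  have h₁ : 0 < X₁.dec.n + Y₁.dec.n := by
    by_contra h0
    refine h (Or.inr ⟨fun i hi => ?_, fun j hj => ?_⟩)
    · have := Fintype.card_pos_iff.2 ⟨(⟨i, hi⟩ : {i // P i})⟩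
      omega
    · have := Fintype.card_pos_iff.2 ⟨(⟨j, hj⟩ : {i // Q i})⟩
      omega
  have h₂ : 0 < X₂.dec.n + Y₂.dec.n := by
    by_contra h0
    refine h (Or.inl ⟨fun i => ?_, fun j => ?_⟩)
    · by_contra hi
      have := Fintype.card_pos_iff.2 ⟨(⟨i, hi⟩ : {i // ¬ P i})⟩
      omega
    · by_contra hj
      have := Fintype.card_pos_iff.2 ⟨(⟨j, hj⟩ : {i // ¬ Q i})⟩
      omega
  let s : BinSplit X X₁ X₂ := X.sumData.split P s₁ s₂
  let t : BinSplit Y Y₁ Y₂ := Y.sumData.split Q t₁ t₂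
  have hz : ∀ i j, ¬ (P i ↔ Q j) → X.sumData.inj i ≫ f ≫ Y.sumData.proj j = 0 :=
    fun i j hij => incl_comp_pr_eq_zero (by by_contra h0; exact hij (hPQ i j h0))
  refine HasCone.binSplit s t ?_ ?_ (IH _ _ _ (by omega)) (IH _ _ _ (by omega))
  · exact s₁.hom_ext fun i => t₂.hom_ext' fun j => by
      simpa [s, t, SumData.split] using hz i j fun h => j.2 (h.1 i.2)
  · exact s₂.hom_ext fun i => t₁.hom_ext' fun j => by
      simpa [s, t, SumData.split] using hz i j fun h => i.2 (h.2 j.2)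

open Classical in
lemma exists_sumData_compl (X : LiftedObj R) (i₀ : Fin X.dec.n) :
    ∃ X' : LiftedObj R, X'.dec.n + 1 = X.dec.n ∧
      Nonempty (SumData X' fun i : {i // i ≠ i₀} => (X.summand i).lift) := by
  obtain ⟨X', hX', ⟨s⟩⟩ := exists_sumData fun i : {i // i ≠ i₀} => X.summand i
  refine ⟨X', ?_, ⟨by convert s⟩⟩
  have h : Fintype.card {i // i ≠ i₀} = X.dec.n - 1 := by
    rw [Fintype.card_subtype_compl, Fintype.card_fin, Fintype.card_subtype_eq]
  have := i₀.2
  omega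

/-- Gaussian elimination of an invertible matrix entry. -/
lemma HasCone.of_isIso_entry {f : X ⟶ Y} (IH : SmallerHaveCones X Y) (i₀ : Fin X.dec.n)
    (j₀ : Fin Y.dec.n) (h : IsIso (X.incl i₀ ≫ f ≫ Y.pr j₀)) : HasCone f := by
  obtain ⟨X', hX', ⟨s'⟩⟩ := exists_sumData_compl X i₀
  obtain ⟨Y', hY', ⟨t'⟩⟩ := exists_sumData_compl Y j₀
  have : IsIso (X.sumData.inj i₀ ≫ f ≫ Y.pr j₀) := h
  obtain ⟨s, hs⟩ := X.sumData.exists_split_of_proj i₀ s' (f ≫ Y.pr j₀)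
  have h1 : (s.i₁ ≫ f) ≫ Y.sumData.proj j₀ = 𝟙 _ := by
    rw [Category.assoc, ← s.i₁_p₁, hs]
    rfl
  have : IsIso ((s.i₁ ≫ f) ≫ Y.sumData.proj j₀) := by rw [h1]; infer_instance
  obtain ⟨t, ht, ht'⟩ := Y.sumData.exists_split_of_inj j₀ t' (s.i₁ ≫ f)
  refine HasCone.binSplit s t ?_ ?_ ?_ (IH _ _ _ (by omega))
  · rw [← Category.assoc, ← ht, t.i₁_p₂]
  · have : f ≫ Y.sumData.proj j₀ = s.p₁ := hs.symm
    rw [ht', reassoc_of% this, s.i₂_p₁_assoc]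
  · have : IsIso (s.i₁ ≫ f ≫ t.p₁) := by
      rw [← Category.assoc, ← ht, t.i₁_p₁]
      infer_instance
    exact HasCone.of_isIso _

open ZeroObject in
/-- A summand of the target which `f` does not meet splits off. -/
lemma HasCone.of_comp_eq_zero {f : X ⟶ Y} (IH : SmallerHaveCones X Y) (j₀ : Fin Y.dec.n)
    {K : LiftedObj R} (p : Y ⟶ K) (hp : IsIso (Y.incl j₀ ≫ p)) (h : f ≫ p = 0) : HasCone f := by
  obtain ⟨Y', hY', ⟨t'⟩⟩ := exists_sumData_compl Y j₀
  have : IsIso (Y.sumData.inj j₀ ≫ p) := hp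
  obtain ⟨t, ht⟩ := Y.sumData.exists_split_of_proj j₀ t' p
  refine HasCone.binSplit (BinSplit.zeroLeft X (isZero_zero _)) t ?_ ?_
    (HasCone.of_isZero_source (isZero_zero _)) (IH _ _ _ (by omega))
  · simp [BinSplit.zeroLeft]
  · simp [ht, h]

open ZeroObject in
/-- A summand of the source on which `f` vanishes splits off. -/
lemma HasCone.of_comp_eq_zero' {f : X ⟶ Y} (IH : SmallerHaveCones X Y) (i₀ : Fin X.dec.n)
    {K : LiftedObj R} (a : K ⟶ X) (ha : IsIso (a ≫ X.pr i₀)) (h : a ≫ f = 0) : HasCone f := by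
  obtain ⟨X', hX', ⟨s'⟩⟩ := exists_sumData_compl X i₀
  have : IsIso (a ≫ X.sumData.proj i₀) := ha
  obtain ⟨s, hs, -⟩ := X.sumData.exists_split_of_inj i₀ s' a
  refine HasCone.binSplit s (BinSplit.zeroLeft Y (isZero_zero _)) ?_ ?_
    (HasCone.of_isZero_target (isZero_zero _)) (IH _ _ _ (by omega))
  · rw [reassoc_of% hs, reassoc_of% h, zero_comp]
  · simp [BinSplit.zeroLeft]

end LiftedObj

end Cones

end CyclicStab

end

open CategoryTheory CategoryTheory.Limits CategoryTheory.Pretriangulated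

noncomputable section

namespace CyclicStab

universe v u w w'

section ReducedCones

variable {C : Type u} [Category.{v} C] [HasZeroObject C] [Preadditive C] [HasShift C ℤ]
  [∀ n : ℤ, (shiftFunctor C n).Additive] [Pretriangulated C]
  {k : Type w} [Field k] [Linear k C] {β : shiftFunctor C (2 : ℤ) ≅ 𝟭 C}
  {Λ : Type w'} [AddCommGroup Λ] {v : K0 C (distTriang C) →+ Λ} {R : ChargeTriple k β v}

namespace LiftedObj

variable {X Y : LiftedObj R}

/-- A morphism of the `ℤ`-lift is a liftable morphism of `C`. -/
lemma liftable_arrow (f : X ⟶ Y) : (Diagram.arrow X.dec Y.dec f.1).Liftable R.q := by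
  refine Diagram.liftable_iff_exists_isPotential.2
    ⟨fun x => match x with
      | ⟨false, i⟩ => X.phase i
      | ⟨true, j⟩ => Y.phase j, ?_⟩
  rintro _ _ ⟨⟩ i j
  exact entry_mem f i j

/-- The triangle of decomposed objects on a morphism of the `ℤ`-lift. -/
abbrev decTriangle (f : X ⟶ Y) {Z : C} (dZ : Decomposition Z) {g : Y.obj ⟶ Z}
    {h : Z ⟶ X.obj⟦(1 : ℤ)⟧} (hT : Triangle.mk f.1 g h ∈ distTriang C) : DecTriangle C :=
  ⟨X.obj, Y.obj, Z, X.dec, Y.dec, dZ, f.1, g, h, hT⟩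

section

variable {f : X ⟶ Y} {Z : C} {dZ : Decomposition Z} {g : Y.obj ⟶ Z}
  {h : Z ⟶ X.obj⟦(1 : ℤ)⟧} {hT : Triangle.mk f.1 g h ∈ distTriang C}

/-- On the summands of `X[n]` and `Y[n]`, the phases of a connected morphism and a potential of its
triangle differ by a constant. -/
lemma EntryConnected.potential_eq (hf : EntryConnected f)
    (p : (decTriangle f dZ hT).LongPotential R.q) (hX : 0 < X.dec.n) (n : ℤ) :
    ∃ c : ℝ, (∀ i, p.F n i = X.phase i + c) ∧ ∀ j, p.G n j = Y.phase j + c := by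
  let i₀ : Fin X.dec.n := ⟨0, hX⟩
  refine ⟨p.F n i₀ - X.phase i₀, ?_⟩
  have hstep : ∀ i j, entry f i j ≠ 0 → (p.F n i = X.phase i + (p.F n i₀ - X.phase i₀) ↔
      p.G n j = Y.phase j + (p.F n i₀ - X.phase i₀)) := by
    intro i j hij
    have := RealDecomposition.degree_unique hij (entry_mem f i j) (p.f_mem n i j)
    constructor <;> intro h' <;> linarith
  rcases hf _ _ hstep with h | h
  · exact h
  · exact absurd (by ring) (h.1 i₀)

/-- The entries of the morphism `g` of the triangle which are isomorphisms split off. -/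
lemma HasCone.of_isIso_entryG (IH : SmallerHaveCones X Y) (hf : EntryConnected f)
    (hX : 0 < X.dec.n) (p : (decTriangle f dZ hT).LongPotential R.q) (j₀ : Fin Y.dec.n)
    (l : Fin dZ.n) (hi : IsIso ((decTriangle f dZ hT).entryG j₀ l)) : HasCone f := by
  obtain ⟨c, -, hG⟩ := hf.potential_eq p hX 0
  have hd : p.H 0 l - p.G 0 j₀ = 0 := R.q.degree_iso hi (p.g_mem 0 j₀ l)
  have hne : (decTriangle f dZ hT).entryG j₀ l ≠ 0 := fun h0 => (dZ.summand l).id_ne_zero (by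
    rw [← IsIso.inv_hom_id ((decTriangle f dZ hT).entryG j₀ l)]
    exact (congrArg (_ ≫ ·) h0).trans comp_zero)
  let K : LiftedIndec R := ⟨dZ.summand l, Y.phase j₀, by
    obtain ⟨m, hm⟩ := R.degree _ _ _ _ hne (p.g_mem 0 j₀ l)
    obtain ⟨m', hm'⟩ := Y.phase_spec j₀
    have hm2 : p.H 0 l - p.G 0 j₀ = R.phase (dZ.summand l) - R.phase (Y.dec.summand j₀) + 2 * m :=
      hm
    refine ⟨m + m', ?_⟩
    push_cast
    linarith⟩
  let a : Y ⟶ K.lift := ⟨g ≫ dZ.proj l, fun j i => by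
    have h1 : Y.dec.inj j ≫ (g ≫ dZ.proj l) ≫ K.lift.dec.proj i =
        (decTriangle f dZ hT).entryG j l := by
      change Y.dec.inj j ≫ (g ≫ dZ.proj l) ≫ 𝟙 _ = _
      rw [Category.comp_id]
      rfl
    exact DecTriangle.mem_of_eq (p.g_mem 0 j l)
      (by change _ = Y.phase j₀ - Y.phase j; linarith [hG j, hG j₀]) h1⟩
  have hv : IsIso (Y.incl j₀ ≫ a).1 := hi
  refine HasCone.of_comp_eq_zero IH j₀ a (isIso_of_isIso_val _) (Subtype.ext ?_)
  change f.1 ≫ g ≫ dZ.proj l = 0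
  have h0 : f.1 ≫ g = 0 := comp_distTriang_mor_zero₁₂ _ hT
  rw [reassoc_of% h0, zero_comp]

/-- The entries of the morphism `h` of the triangle which are isomorphisms split off. -/
lemma HasCone.of_isIso_entryH (IH : SmallerHaveCones X Y) (hf : EntryConnected f)
    (hX : 0 < X.dec.n) (p : (decTriangle f dZ hT).LongPotential R.q) (l : Fin dZ.n)
    (i₀ : Fin X.dec.n) (hi : IsIso ((decTriangle f dZ hT).entryH l i₀)) : HasCone f := by
  obtain ⟨c, hF, -⟩ := hf.potential_eq p hX (1 + 0)
  have hd : p.F (1 + 0) i₀ - p.H 0 l = 0 :=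
    R.q.degree_iso (F := (X.dec.summand i₀).shift 1) hi (p.h_mem 0 l i₀)
  have hmem : (decTriangle f dZ hT).entryH l i₀ ∈
      R.q.hom (dZ.summand l) ((X.dec.summand i₀).shift 1) 0 :=
    DecTriangle.mem_of_eq (p.h_mem 0 l i₀) hd rfl
  let η : ((X.dec.summand i₀).shift 1).obj ⟶ (dZ.summand l).obj :=
    inv ((decTriangle f dZ hT).entryH l i₀)
  have hη : η ∈ R.q.hom ((X.dec.summand i₀).shift 1) (dZ.summand l) 0 :=
    R.q.inv_mem _ _ hmem (IsIso.hom_inv_id _) (IsIso.inv_hom_id _)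
  obtain ⟨b, hb⟩ := (shiftFunctor C (1 : ℤ)).map_surjective (η ≫ dZ.inj l ≫ h)
  have hent : ∀ i, (b ≫ X.dec.proj i)⟦(1 : ℤ)⟧' = η ≫ (decTriangle f dZ hT).entryH l i := by
    intro i
    rw [Functor.map_comp, hb, Category.assoc, Category.assoc]
    rfl
  let a : (X.summand i₀).lift ⟶ X := ⟨b, fun i' i => by
    have h1 : (X.summand i₀).lift.dec.inj i' ≫ b ≫ X.dec.proj i = b ≫ X.dec.proj i :=
      Category.id_comp _
    have h2 := R.q.comp_mem hη (p.h_mem 0 l i)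
    rw [← hent i] at h2
    exact DecTriangle.mem_of_eq ((RealDecomposition.shift_mem_iff 1).1 h2)
      (by change _ = X.phase i - X.phase i₀; linarith [hF i, hF i₀]) h1⟩
  have hv : b ≫ X.dec.proj i₀ = 𝟙 _ := by
    apply (shiftFunctor C (1 : ℤ)).map_injective
    rw [hent, CategoryTheory.Functor.map_id]
    exact IsIso.inv_hom_id _
  have ha : a ≫ X.pr i₀ = 𝟙 _ := Subtype.ext hv
  refine HasCone.of_comp_eq_zero' IH i₀ a (by rw [ha]; infer_instance) (Subtype.ext ?_)
  change b ≫ f.1 = 0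
  have h0 : h ≫ f.1⟦(1 : ℤ)⟧' = 0 := comp_distTriang_mor_zero₃₁ _ hT
  apply (shiftFunctor C (1 : ℤ)).map_injective
  rw [Functor.map_comp, hb, Category.assoc, Category.assoc, h0, comp_zero, comp_zero,
    Functor.map_zero]

/-- In the reduced case, the vanishing of the Maslov indices determines the degree of the
connecting paths from `X` to `X[1]` in the triangle on a connected morphism. -/
lemma EntryConnected.shift_degree (hmas : ∀ l : BasicLoop R.q, l.maslov = 0)
    (hf : EntryConnected f) (hred : (decTriangle f dZ hT).Reduced)
    (p : (decTriangle f dZ hT).LongPotential R.q) (i : Fin X.dec.n) (j : Fin Y.dec.n)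
    (l : Fin dZ.n) (hg : (decTriangle f dZ hT).entryG j l ≠ 0)
    (hh : (decTriangle f dZ hT).entryH l i ≠ 0) : p.F (1 + 0) i - p.F 0 i = 1 := by
  let t := decTriangle f dZ hT
  let nX : Fin X.dec.n → (t.triangle β).Node := t.source β
  let nX₁ : Fin X.dec.n → (t.triangle β).Node := t.target β
  let nY : Fin Y.dec.n → (t.triangle β).Node := fun j => ⟨⟨.Y, Or.inr (Or.inl rfl)⟩, j⟩
  let nZ : Fin dZ.n → (t.triangle β).Node := fun j => ⟨⟨.Z, Or.inr (Or.inr (Or.inl rfl))⟩, j⟩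
  have stepF : ∀ i' j', entry f i' j' ≠ 0 →
      (t.triangle β).Joined R.q (nX i') (nY j') (p.G 0 j' - p.F 0 i' + 0) := fun i' j' h0 =>
    (Diagram.Joined.refl (D := t.triangle β) (nY j')).cons (D := t.triangle β)
      (v := ⟨.X, Or.inl rfl⟩) (w := ⟨.Y, Or.inr (Or.inl rfl)⟩) (⟨.f, trivial⟩) h0 (p.f_mem 0 i' j')
  have stepG : (t.triangle β).Joined R.q (nY j) (nZ l) (p.H 0 l - p.G 0 j + 0) :=
    (Diagram.Joined.refl (D := t.triangle β) (nZ l)).cons (D := t.triangle β)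
      (v := ⟨.Y, Or.inr (Or.inl rfl)⟩) (w := ⟨.Z, Or.inr (Or.inr (Or.inl rfl))⟩) (⟨.g, trivial⟩) hg
      (p.g_mem 0 j l)
  have stepH : (t.triangle β).Joined R.q (nZ l) (nX₁ i) (p.F (1 + 0) i - p.H 0 l + 0) :=
    (Diagram.Joined.refl (D := t.triangle β) (nX₁ i)).cons (D := t.triangle β)
      (v := ⟨.Z, Or.inr (Or.inr (Or.inl rfl))⟩) (w := ⟨.X₁, Or.inr (Or.inr (Or.inr rfl))⟩)
      (⟨.h, trivial⟩) hh (p.h_mem 0 l i)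
  have hY : (t.triangle β).Joined R.q (nX i) (nY j) (p.G 0 j - p.F 0 i) := by
    have hstep : ∀ i' j', entry f i' j' ≠ 0 →
        ((t.triangle β).Joined R.q (nX i) (nX i') (p.F 0 i' - p.F 0 i) ↔
          (t.triangle β).Joined R.q (nX i) (nY j') (p.G 0 j' - p.F 0 i)) := by
      refine fun i' j' h0 => ⟨fun h1 => ?_, fun h1 => ?_⟩
      · have := h1.trans (stepF i' j' h0)
        rwa [show p.F 0 i' - p.F 0 i + (p.G 0 j' - p.F 0 i' + 0) = p.G 0 j' - p.F 0 i by ring]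
          at this
      · have := h1.trans (stepF i' j' h0).symm
        rwa [show p.G 0 j' - p.F 0 i + -(p.G 0 j' - p.F 0 i' + 0) = p.F 0 i' - p.F 0 i by ring]
          at this
    rcases hf _ _ hstep with h | h
    · exact h.2 j
    · refine absurd ?_ (h.1 i)
      rw [sub_self]
      exact Diagram.Joined.refl (nX i)
  obtain ⟨L, hL⟩ := (hY.trans stepG).trans stepH
  have := hmas ⟨t, hred, p.locallyLiftable, i, L, _, hL⟩
  have key : ∀ a b c d : ℝ, (b - a + (c - b + 0) + (d - c + 0) - 1) / 2 = 0 → d - a = 1 := by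
    intros
    linarith
  exact key _ _ _ _ this

/-- A reduced liftable triangle on a connected morphism lifts to the `ℤ`-lift. -/
lemma HasCone.of_reduced (hmas : ∀ l : BasicLoop R.q, l.maslov = 0) (hf : EntryConnected f)
    (hX : 0 < X.dec.n) (hred : (decTriangle f dZ hT).Reduced)
    (p : (decTriangle f dZ hT).LongPotential R.q) : HasCone f := by
  classical
  obtain ⟨c₀, hF₀, hG₀⟩ := hf.potential_eq p hX 0
  obtain ⟨c₁, hF₁, -⟩ := hf.potential_eq p hX (1 + 0)
  let t := decTriangle f dZ hT
  -- The summands of `Z` which are met by `g` are placed relative to `Y`, all others relative to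
  -- `X[1]`.
  let θ : Fin dZ.n → ℝ := fun l => if ∃ j, t.entryG j l ≠ 0 then p.H 0 l - c₀ else p.H 0 l - c₁ + 1
  have hg : ∀ j l, t.entryG j l ∈ R.q.hom (Y.dec.summand j) (dZ.summand l)
      (θ l - Y.phase j) := by
    intro j l
    by_cases h0 : t.entryG j l = 0
    · rw [h0]; exact zero_mem _
    · have hθ : θ l = p.H 0 l - c₀ := if_pos ⟨j, h0⟩
      exact DecTriangle.mem_of_eq (p.g_mem 0 j l) (by rw [hG₀ j, hθ]; ring) rfl
  have hh : ∀ l i, t.entryH l i ∈ R.q.hom (dZ.summand l) ((X.dec.summand i).shift 1)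
      (X.phase i + 1 - θ l) := by
    intro l i
    by_cases h0 : t.entryH l i = 0
    · rw [h0]; exact zero_mem _
    · refine DecTriangle.mem_of_eq (p.h_mem 0 l i) ?_ rfl
      by_cases h1 : ∃ j, t.entryG j l ≠ 0
      · have hθ : θ l = p.H 0 l - c₀ := if_pos h1
        obtain ⟨j, hj⟩ := h1
        have := hf.shift_degree hmas hred p i j l hj h0
        have e₀ := hF₀ i
        rw [hθ]
        linarith
      · have hθ : θ l = p.H 0 l - c₁ + 1 := if_neg h1
        have e₁ := hF₁ i
        rw [hθ]
        linarith
  have hθ : ∀ l, ∃ m : ℤ, θ l = R.phase (dZ.summand l) + 2 * m := by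
    intro l
    by_cases h1 : ∃ j, t.entryG j l ≠ 0
    · obtain ⟨j, hj⟩ := h1
      obtain ⟨m, hm⟩ := R.degree _ _ _ _ hj (hg j l)
      obtain ⟨m', hm'⟩ := Y.phase_spec j
      refine ⟨m + m', ?_⟩
      have hm2 : θ l - Y.phase j = R.phase (dZ.summand l) - R.phase (Y.dec.summand j) + 2 * m := hm
      push_cast
      linarith
    · by_cases h2 : ∃ i, t.entryH l i ≠ 0
      · obtain ⟨i, hi⟩ := h2
        obtain ⟨m, hm⟩ := R.degree _ _ _ _ hi (hh l i)
        obtain ⟨m', hm'⟩ := X.phase_spec i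
        obtain ⟨m₁, hm₁⟩ := R.phase_shift (X.dec.summand i)
        refine ⟨m' - m - m₁, ?_⟩
        have hm2 : X.phase i + 1 - θ l =
          R.phase ((X.dec.summand i).shift 1) - R.phase (dZ.summand l) + 2 * m := hm
        push_cast
        linarith
      -- A summand of `Z` which meets neither `g` nor `h` is zero.
      · exfalso
        push Not at h1 h2
        have e₁ : g ≫ dZ.proj l = 0 := Y.dec.sumData.hom_ext fun j => (h1 j).trans comp_zero.symm
        have e₂ : dZ.inj l ≫ h = 0 :=
          (X.dec.shift 1).sumData.hom_ext' fun i => by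
            rw [zero_comp, Category.assoc]
            exact h2 i
        obtain ⟨r, hr⟩ := Triangle.coyoneda_exact₃ _ hT (dZ.inj l) e₂
        obtain ⟨r, hr'⟩ : ∃ r : (dZ.summand l).obj ⟶ Y.obj, dZ.inj l = r ≫ g := ⟨r, hr⟩
        apply (dZ.summand l).id_ne_zero
        rw [← dZ.inj_proj_self, hr', Category.assoc, e₁, comp_zero]
  let Z' : LiftedObj R := ⟨Z, dZ, θ, hθ⟩
  exact ⟨Z', ⟨g, hg⟩, ⟨h, fun l i => DecTriangle.mem_of_eq (hh l i) (by
    change _ = X.phase i + ((1 : ℤ) : ℝ) - θ l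
    rw [Int.cast_one]) rfl⟩, hT⟩

end

/-- Every morphism of the `ℤ`-lift has a cone. -/
theorem hasCone (hpre : R.q.PreLiftable) (hmas : ∀ l : BasicLoop R.q, l.maslov = 0)
    (f : X ⟶ Y) : HasCone f := by
  induction hn : X.dec.n + Y.dec.n using Nat.strong_induction_on generalizing X Y with
  | _ n ih =>
    have IH : SmallerHaveCones X Y := fun X' Y' f' h => ih _ (hn ▸ h) f' rfl
    by_cases hf : EntryConnected f
    swap
    · exact HasCone.of_not_entryConnected IH hf
    rcases Nat.eq_zero_or_pos X.dec.n with hX | hX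
    · exact HasCone.of_isZero_source (isZero_iff.2 hX)
    obtain ⟨Z, dZ, g, h, hT, hl⟩ := hpre _ _ X.dec Y.dec f.1 (liftable_arrow f)
    obtain ⟨p⟩ := (decTriangle f dZ hT).exists_longPotential hl
    by_contra hcon
    refine hcon (HasCone.of_reduced hmas hf hX ⟨fun i j hi => ?_, fun j l hi => ?_,
      fun l i hi => ?_⟩ p)
    · have : IsIso (X.incl i ≫ f ≫ Y.pr j).1 := hi
      exact hcon (HasCone.of_isIso_entry IH i j (isIso_of_isIso_val _))
    · exact hcon (HasCone.of_isIso_entryG IH hf hX p j l hi)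
    · exact hcon (HasCone.of_isIso_entryH IH hf hX p l i hi)

end LiftedObj

end ReducedCones

end CyclicStab

end

open CategoryTheory CategoryTheory.Limits CategoryTheory.Pretriangulated

noncomputable section

namespace CyclicStab

universe v u w w'

section PretriangulatedLift

variable {C : Type u} [Category.{v} C] [HasZeroObject C] [Preadditive C] [HasShift C ℤ]
  [∀ n : ℤ, (shiftFunctor C n).Additive] [Pretriangulated C]
  {k : Type w} [Field k] [Linear k C] {β : shiftFunctor C (2 : ℤ) ≅ 𝟭 C}
  {Λ : Type w'} [AddCommGroup Λ] {v : K0 C (distTriang C) →+ Λ} {R : ChargeTriple k β v}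

/-! ### The pretriangulated structure of the `ℤ`-lift -/

namespace LiftedObj

/-- A morphism of triangles of the `ℤ`-lift induces one of their images in `C`. -/
def mapTriangleIso {T₁ T₂ : Triangle (LiftedObj R)} (e : T₁ ≅ T₂) :
    Triangle.mk (C := C) ((π R).map T₁.mor₁) ((π R).map T₁.mor₂) ((π R).map T₁.mor₃) ≅
      Triangle.mk (C := C) ((π R).map T₂.mor₁) ((π R).map T₂.mor₂) ((π R).map T₂.mor₃) :=
  Triangle.isoMk _ _ ((π R).mapIso (Triangle.π₁.mapIso e)) ((π R).mapIso (Triangle.π₂.mapIso e))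
    ((π R).mapIso (Triangle.π₃.mapIso e)) (congrArg Subtype.val e.hom.comm₁)
    (congrArg Subtype.val e.hom.comm₂) (congrArg Subtype.val e.hom.comm₃)

lemma comp_degZero_eq {X Y Z : LiftedObj R} {f : X ⟶ Y} {c : Y.obj ⟶ Z.obj} {g : X ⟶ Z}
    (h : f.1 ≫ c = g.1) : f ≫ degZero c = g := by
  rw [← degZero_comp, h, degZero_val]

lemma degZero_comp_eq {X Y Z : LiftedObj R} {c : X.obj ⟶ Y.obj} {g : Y ⟶ Z} {f : X ⟶ Z}
    (h : c ≫ g.1 = f.1) : degZero c ≫ g = f := by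
  rw [← comp_degZero, h, degZero_val]

variable (R) in
/-- The `ℤ`-lift of a liftable category is pretriangulated: cones exist by `hasCone`, and fillers
are obtained from fillers in `C` by taking the part which belongs to the `ℤ`-lift. -/
abbrev pretriangulated (hpre : R.q.PreLiftable) (hmas : ∀ l : BasicLoop R.q, l.maslov = 0) :
    Pretriangulated (LiftedObj R) where
  distinguishedTriangles := distinguished R
  isomorphic_distinguished T₁ h₁ T₂ e :=
    isomorphic_distinguished _ h₁ _ (mapTriangleIso e)
  contractible_distinguished X := by
    change Triangle.mk (𝟙 X) 0 0 ∈ _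
    rw [mem_distinguished_iff,
      Pretriangulated.Triangle.distinguished_iff_of_isZero₃ _ (isZero_obj (isZero_zero _))]
    exact inferInstanceAs (IsIso (𝟙 X.obj))
  distinguished_cocone_triangle f := hasCone hpre hmas f
  rotate_distinguished_triangle T :=
    rotate_distinguished_triangle
      (Triangle.mk (C := C) ((π R).map T.mor₁) ((π R).map T.mor₂) ((π R).map T.mor₃))
  complete_distinguished_triangle_morphism T₁ T₂ h₁ h₂ a b hab := by
    obtain ⟨c, hc₁, hc₂⟩ := complete_distinguished_triangle_morphism _ _ h₁ h₂ a.1 b.1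
      (congrArg Subtype.val hab)
    exact ⟨degZero (X := T₁.obj₃) (Y := T₂.obj₃) c,
      comp_degZero_eq (Y := T₁.obj₃) (Z := T₂.obj₃) (g := b ≫ T₂.mor₂) hc₁,
      (degZero_comp_eq (X := T₁.obj₃) (Y := T₂.obj₃) (f := T₁.mor₃ ≫ a⟦(1 : ℤ)⟧') hc₂.symm).symm⟩

end LiftedObj

end PretriangulatedLift

end CyclicStab

end

open CategoryTheory CategoryTheory.Limits CategoryTheory.Pretriangulated

noncomputable section

namespace CyclicStab

universe v u w w'

section Slicings

variable {D : Type u} [Category.{v} D] [Preadditive D]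

/-! ### Slicings -/

variable {P : ℝ → ObjectProperty D} {φ φ' : ℝ} {E X A E' X' A' : D}

/-- Objects without nonzero morphisms to semistable objects of phase at most `φ`. -/
def Above (P : ℝ → ObjectProperty D) (φ : ℝ) (E : D) : Prop :=
  ∀ ψ ≤ φ, ∀ A, P ψ A → ∀ f : E ⟶ A, f = 0

lemma Above.mono (h : Above P φ E) (hφ : φ' ≤ φ) : Above P φ' E :=
  fun ψ hψ => h ψ (hψ.trans hφ)

lemma Above.of_isZero (h : IsZero E) : Above P φ E := fun _ _ _ _ _ => h.eq_of_src _ _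

variable [HasShift D ℤ]

/-- The axioms of a slicing other than the existence of Harder-Narasimhan filtrations. -/
structure IsPreslicing (P : ℝ → ObjectProperty D) : Prop where
  iso_mem : ∀ {φ : ℝ} {X Y : D}, (X ≅ Y) → P φ X → P φ Y
  zero_mem : ∀ (φ : ℝ) {X : D}, IsZero X → P φ X
  sum_mem : ∀ {φ : ℝ} {X Y Z : D}, BinSplit Z X Y → P φ X → P φ Y → P φ Z
  shift : ∀ (φ : ℝ) (X : D), P φ X ↔ P (φ + 1) (X⟦(1 : ℤ)⟧)
  hom_eq_zero : ∀ {φ₁ φ₂ : ℝ}, φ₂ < φ₁ → ∀ {X Y : D}, P φ₁ X → P φ₂ Y → ∀ f : X ⟶ Y, f = 0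

namespace IsPreslicing

lemma above_of_mem (hP : IsPreslicing P) (h : P φ' E) (hφ : φ < φ') : Above P φ E :=
  fun _ hψ _ hA f => hP.hom_eq_zero (hψ.trans_lt hφ) h hA f

lemma shift_neg_one (hP : IsPreslicing P) (h : P φ A) : P (φ - 1) (A⟦(-1 : ℤ)⟧) := by
  rw [hP.shift, sub_add_cancel]
  exact hP.iso_mem (shiftNegShift A (1 : ℤ)).symm h

variable [∀ n : ℤ, (shiftFunctor D n).Additive]

lemma above_shift (hP : IsPreslicing P) (h : Above P φ E) : Above P (φ + 1) (E⟦(1 : ℤ)⟧) := by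
  intro ψ hψ A hA f
  have h1 := h (ψ - 1) (by linarith) _ (hP.shift_neg_one hA)
    ((shiftShiftNeg E (1 : ℤ)).inv ≫ f⟦(-1 : ℤ)⟧')
  apply (shiftFunctor D (-1 : ℤ)).map_injective
  rw [Functor.map_zero, ← cancel_epi (shiftShiftNeg E (1 : ℤ)).inv, h1, comp_zero]

variable [HasZeroObject D] [Pretriangulated D]

lemma _root_.CyclicStab.Above.of_triangle {f : E ⟶ X} {p : X ⟶ A} {t : A ⟶ E⟦(1 : ℤ)⟧}
    (hT : Triangle.mk f p t ∈ distTriang D) (hE : Above P φ E) (hA : Above P φ A) :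
    Above P φ X := by
  intro ψ hψ B hB g
  obtain ⟨g', hg'⟩ : ∃ g' : A ⟶ B, g = p ≫ g' :=
    Triangle.yoneda_exact₂ _ hT g (hE ψ hψ B hB (f ≫ g))
  rw [hg', hA ψ hψ B hB g', comp_zero]

lemma isZero_of_mor₂_eq_zero (hP : IsPreslicing P) {f : E ⟶ X} {p : X ⟶ A} {t : A ⟶ E⟦(1 : ℤ)⟧}
    (hT : Triangle.mk f p t ∈ distTriang D) (hA : P φ A) (hE : Above P φ E) (hp : p = 0) :
    IsZero A := by
  obtain ⟨r, hr⟩ : ∃ r : E⟦(1 : ℤ)⟧ ⟶ A, 𝟙 A = t ≫ r :=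
    Triangle.yoneda_exact₃ _ hT (𝟙 A) (by change p ≫ 𝟙 A = 0; rw [hp, zero_comp])
  rw [IsZero.iff_id_eq_zero, hr, (hP.above_shift hE) φ (by linarith) A hA r, comp_zero]

lemma phase_le_of_iso (hP : IsPreslicing P) {f : E ⟶ X} {p : X ⟶ A} {t : A ⟶ E⟦(1 : ℤ)⟧} {f' : E' ⟶ X'}
    {p' : X' ⟶ A'} {t' : A' ⟶ E'⟦(1 : ℤ)⟧} (hT : Triangle.mk f p t ∈ distTriang D)
    (hT' : Triangle.mk f' p' t' ∈ distTriang D) (hA : P φ A) (hA' : P φ' A')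
    (hE : Above P φ E) (hE' : Above P φ' E') (hA₀ : ¬ IsZero A) (a : X ≅ X') : φ' ≤ φ := by
  by_contra! hlt
  refine hA₀ (hP.isZero_of_mor₂_eq_zero hT hA hE ?_)
  have h := (hE'.mono hlt.le).of_triangle hT' (hP.above_of_mem hA' hlt) φ le_rfl A hA (a.inv ≫ p)
  rw [← cancel_epi a.inv, h, comp_zero]

lemma eq_of_comp_mor₁ (hP : IsPreslicing P) {f' : E' ⟶ X'} {p' : X' ⟶ A'} {t' : A' ⟶ E'⟦(1 : ℤ)⟧}
    (hT' : Triangle.mk f' p' t' ∈ distTriang D) (hA' : P φ A') (hE : Above P φ E)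
    {g g' : E ⟶ E'} (h : g ≫ f' = g' ≫ f') : g = g' := by
  rw [← sub_eq_zero]
  apply (shiftFunctor D (1 : ℤ)).map_injective
  obtain ⟨r, hr⟩ : ∃ r : E⟦(1 : ℤ)⟧ ⟶ A', (g - g')⟦(1 : ℤ)⟧' = r ≫ t' :=
    Triangle.coyoneda_exact₁ _ hT' _ (by
      change (g - g')⟦(1 : ℤ)⟧' ≫ f'⟦(1 : ℤ)⟧' = 0
      rw [← Functor.map_comp, Preadditive.sub_comp, h, sub_self, Functor.map_zero])
  rw [hr, (hP.above_shift hE) φ (by linarith) A' hA' r, zero_comp, Functor.map_zero]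

/-- The last step of a Harder-Narasimhan filtration is functorial for isomorphisms. -/
lemma exists_iso_of_triangles (hP : IsPreslicing P) {f : E ⟶ X} {p : X ⟶ A} {t : A ⟶ E⟦(1 : ℤ)⟧} {f' : E' ⟶ X'}
    {p' : X' ⟶ A'} {t' : A' ⟶ E'⟦(1 : ℤ)⟧} (hT : Triangle.mk f p t ∈ distTriang D)
    (hT' : Triangle.mk f' p' t' ∈ distTriang D) (hA : P φ A) (hA' : P φ' A')
    (hE : Above P φ E) (hE' : Above P φ' E') (hA₀ : ¬ IsZero A) (hA₀' : ¬ IsZero A')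
    (a : X ≅ X') : ∃ (e : E ≅ E') (b : A ≅ A'), f ≫ a.hom = e.hom ≫ f' ∧
      p ≫ b.hom = a.hom ≫ p' ∧ t ≫ e.hom⟦(1 : ℤ)⟧' = b.hom ≫ t' := by
  obtain rfl : φ = φ' := le_antisymm (hP.phase_le_of_iso hT' hT hA' hA hE' hE hA₀' a.symm)
    (hP.phase_le_of_iso hT hT' hA hA' hE hE' hA₀ a)
  obtain ⟨e, he⟩ : ∃ e : E ⟶ E', f ≫ a.hom = e ≫ f' :=
    Triangle.coyoneda_exact₂ _ hT' (f ≫ a.hom) (hE φ le_rfl _ hA' _)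
  obtain ⟨e', he'⟩ : ∃ e' : E' ⟶ E, f' ≫ a.inv = e' ≫ f :=
    Triangle.coyoneda_exact₂ _ hT (f' ≫ a.inv) (hE' φ le_rfl _ hA _)
  let ee : E ≅ E' := ⟨e, e', hP.eq_of_comp_mor₁ hT hA hE (by
      rw [Category.assoc, ← he', ← reassoc_of% he, Iso.hom_inv_id, Category.comp_id,
        Category.id_comp]), hP.eq_of_comp_mor₁ hT' hA' hE' (by
      rw [Category.assoc, ← he, ← reassoc_of% he', Iso.inv_hom_id, Category.comp_id,
        Category.id_comp])⟩
  obtain ⟨b, hb₁, hb₂⟩ : ∃ b : A ⟶ A', p ≫ b = a.hom ≫ p' ∧ t ≫ e⟦(1 : ℤ)⟧' = b ≫ t' :=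
    complete_distinguished_triangle_morphism _ _ hT hT' e a.hom he
  have he₀ : IsIso e := ⟨e', ee.hom_inv_id, ee.inv_hom_id⟩
  let Φ : Triangle.mk f p t ⟶ Triangle.mk f' p' t' := Triangle.homMk _ _ e a.hom b he hb₁ hb₂
  have hb : IsIso b := isIso₃_of_isIso₁₂ Φ hT hT' he₀
    (Iso.isIso_hom a)
  exact ⟨ee, asIso b, he, hb₁, hb₂⟩

end IsPreslicing

variable [HasZeroObject D] [∀ n : ℤ, (shiftFunctor D n).Additive] [Pretriangulated D]

/-- A Harder-Narasimhan filtration of `X` with nonzero factors. -/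
structure HNTower (P : ℝ → ObjectProperty D) (X : D) where
  n : ℕ
  obj : Fin (n + 1) → D
  factor : Fin n → D
  f : ∀ i : Fin n, obj i.castSucc ⟶ obj i.succ
  p : ∀ i : Fin n, obj i.succ ⟶ factor i
  t : ∀ i : Fin n, factor i ⟶ (obj i.castSucc)⟦(1 : ℤ)⟧
  distinguished : ∀ i, Triangle.mk (f i) (p i) (t i) ∈ distTriang D
  isZero : IsZero (obj 0)
  e : obj (Fin.last n) ≅ X
  phase : Fin n → ℝ
  phase_anti : StrictAnti phase
  mem : ∀ i, P (phase i) (factor i)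
  not_isZero : ∀ i, ¬ IsZero (factor i)

namespace HNTower

lemma above_obj (hP : IsPreslicing P) (F : HNTower P X) (i : Fin (F.n + 1)) (φ : ℝ)
    (h : ∀ j : Fin F.n, j.castSucc < i → φ < F.phase j) : Above P φ (F.obj i) := by
  induction i using Fin.induction with
  | zero => exact .of_isZero F.isZero
  | succ i ih =>
    exact (ih fun j hj => h j (hj.trans i.castSucc_lt_succ)).of_triangle (F.distinguished i)
      (hP.above_of_mem (F.mem i) (h i i.castSucc_lt_succ))

lemma above (hP : IsPreslicing P) (F : HNTower P X) (i : Fin F.n) :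
    Above P (F.phase i) (F.obj i.castSucc) :=
  F.above_obj hP _ _ fun _ hj => F.phase_anti (Fin.castSucc_lt_castSucc_iff.1 hj)

lemma not_isZero_obj_succ (hP : IsPreslicing P) (F : HNTower P X) (i : Fin F.n) :
    ¬ IsZero (F.obj i.succ) := fun h => F.not_isZero i
  (hP.isZero_of_mor₂_eq_zero (F.distinguished i) (F.mem i) (F.above hP i) (h.eq_of_src _ _))

lemma exists_iso (hP : IsPreslicing P) (F : HNTower P X) (G : HNTower P X') (i : Fin F.n)
    (j : Fin G.n) (a : F.obj i.succ ≅ G.obj j.succ) :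
    ∃ (e : F.obj i.castSucc ≅ G.obj j.castSucc) (b : F.factor i ≅ G.factor j),
      F.f i ≫ a.hom = e.hom ≫ G.f j ∧ F.p i ≫ b.hom = a.hom ≫ G.p j ∧
        F.t i ≫ e.hom⟦(1 : ℤ)⟧' = b.hom ≫ G.t j :=
  hP.exists_iso_of_triangles (F.distinguished i) (G.distinguished j) (F.mem i) (G.mem j)
    (F.above hP i) (G.above hP j) (F.not_isZero i) (G.not_isZero j) a

lemma index_eq (hP : IsPreslicing P) (F : HNTower P X) (G : HNTower P X') (i : Fin (F.n + 1)) :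
    ∀ j : Fin (G.n + 1), (F.obj i ≅ G.obj j) → (i : ℕ) = j := by
  induction i using Fin.induction with
  | zero =>
    intro j a
    cases j using Fin.cases with
    | zero => rfl
    | succ j => exact absurd (F.isZero.of_iso a.symm) (G.not_isZero_obj_succ hP j)
  | succ i ih =>
    intro j a
    cases j using Fin.cases with
    | zero => exact absurd (G.isZero.of_iso a) (F.not_isZero_obj_succ hP i)
    | succ j =>
      obtain ⟨e, -⟩ := F.exists_iso hP G i j a
      have := ih _ e
      simp only [Fin.val_castSucc] at this
      simp [this]

/-- Harder-Narasimhan filtrations are unique up to isomorphism. -/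
theorem unique (hP : IsPreslicing P) (F G : HNTower P X) :
    ∃ (h : F.n = G.n)
      (a : ∀ i : Fin (F.n + 1), F.obj i ≅ G.obj (Fin.cast (congrArg (· + 1) h) i))
      (b : ∀ i : Fin F.n, F.factor i ≅ G.factor (Fin.cast h i)),
      (∀ i : Fin F.n, F.f i ≫ (a i.succ).hom = (a i.castSucc).hom ≫ G.f (Fin.cast h i)) ∧
      (∀ i : Fin F.n, F.p i ≫ (b i).hom = (a i.succ).hom ≫ G.p (Fin.cast h i)) ∧
      (∀ i : Fin F.n, F.t i ≫ ((a i.castSucc).hom)⟦(1 : ℤ)⟧' =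
        (b i).hom ≫ G.t (Fin.cast h i)) ∧
      (a (Fin.last F.n)).hom ≫
        eqToHom (congrArg G.obj (show Fin.cast _ (Fin.last F.n) = Fin.last G.n from Fin.ext h)) ≫
          G.e.hom = F.e.hom := by
  have hn : F.n = G.n := F.index_eq hP G _ (Fin.last G.n) (F.e ≪≫ G.e.symm)
  have key := F.exists_iso hP G
  revert hn key
  obtain ⟨n, obj, factor, f, p, t, -, -, e, -⟩ := F
  obtain ⟨n', obj', factor', f', p', t', -, -, e', -⟩ := G
  intro hn key
  obtain rfl : n = n' := hn
  have key' : ∀ (i : Fin n) (a : obj i.succ ≅ obj' i.succ), _ := fun i => key i i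
  choose! c b h₁ h₂ h₃ using key'
  let a : ∀ i, obj i ≅ obj' i :=
    Fin.reverseInduction (motive := fun i => obj i ≅ obj' i) (e ≪≫ e'.symm) c
  have ha : ∀ i : Fin n, a i.castSucc = c i (a i.succ) := fun i =>
    Fin.reverseInduction_castSucc ..
  have hl : a (Fin.last n) = e ≪≫ e'.symm := Fin.reverseInduction_last ..
  refine ⟨rfl, a, fun i => b i (a i.succ), fun i => ?_, fun i => h₂ i _, fun i => ?_, ?_⟩
  · change f i ≫ (a i.succ).hom = (a i.castSucc).hom ≫ f' i
    rw [ha]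
    exact h₁ i _
  · change t i ≫ ((a i.castSucc).hom)⟦(1 : ℤ)⟧' = (b i (a i.succ)).hom ≫ t' i
    rw [ha]
    exact h₃ i _
  · change (a (Fin.last n)).hom ≫ 𝟙 _ ≫ e'.hom = e.hom
    rw [hl, Category.id_comp]
    simp

end HNTower

end Slicings

end CyclicStab

end

open CategoryTheory CategoryTheory.Limits CategoryTheory.Pretriangulated

noncomputable section

namespace CyclicStab

universe v u w w'

section Filtrations

variable {D : Type u} [Category.{v} D] [HasZeroObject D] [Preadditive D] [HasShift D ℤ]
  [∀ n : ℤ, (shiftFunctor D n).Additive] [Pretriangulated D]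

/-! ### Filtrations with prescribed phases -/

/-- `X` has a filtration whose factors lie in `P φ`, where `φ` runs through the given list of
phases; the head of the list belongs to the last factor, which is a quotient of `X`. -/
inductive HNFilt (P : ℝ → ObjectProperty D) : List ℝ → D → Prop
  | nil {X : D} (h : IsZero X) : HNFilt P [] X
  | cons {φ : ℝ} {L : List ℝ} {E X A : D} {f : E ⟶ X} {p : X ⟶ A} {t : A ⟶ E⟦(1 : ℤ)⟧}
      (hT : Triangle.mk f p t ∈ distTriang D) (hE : HNFilt P L E) (hA : P φ A) :
      HNFilt P (φ :: L) X

/-- `X` has a Harder-Narasimhan filtration. -/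
def HasHN (P : ℝ → ObjectProperty D) (X : D) : Prop :=
  ∃ L : List ℝ, L.Pairwise (· < ·) ∧ HNFilt P L X

variable {P : ℝ → ObjectProperty D} {φ : ℝ} {L M : List ℝ} {X Y Z : D}

namespace HNFilt

lemma of_iso (h : HNFilt P L X) (e : X ≅ Y) : HNFilt P L Y := by
  cases h with
  | nil h => exact .nil (h.of_iso e.symm)
  | @cons φ L E _ A f p t hT hE hA =>
    refine .cons (f := f ≫ e.hom) (p := e.inv ≫ p) (t := t)
      (isomorphic_distinguished _ hT _ ?_) hE hA
    exact Triangle.isoMk _ _ (Iso.refl _) e.symm (Iso.refl _)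
      (by change (f ≫ e.hom) ≫ e.inv = 𝟙 E ≫ f; simp) (by change (e.inv ≫ p) ≫ 𝟙 A = e.inv ≫ p; simp)
      (by change t ≫ (𝟙 E)⟦(1 : ℤ)⟧' = 𝟙 A ≫ t; simp)

lemma mono {P' : ℝ → ObjectProperty D} (h : HNFilt P L X) (hP : ∀ φ A, P φ A → P' φ A) :
    HNFilt P' L X := by
  induction h with
  | nil h => exact .nil h
  | cons hT _ hA ih => exact .cons hT ih (hP _ _ hA)

lemma above (hP : IsPreslicing P) {ψ : ℝ} (h : HNFilt P L X) (hL : ∀ φ ∈ L, ψ < φ) :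
    Above P ψ X := by
  induction h with
  | nil h => exact .of_isZero h
  | cons hT hE hA ih =>
    exact (ih fun φ hφ => hL φ (List.mem_cons_of_mem _ hφ)).of_triangle hT
      (hP.above_of_mem hA (hL _ List.mem_cons_self))

lemma cons_of_zero_mem (hP : IsPreslicing P) (φ : ℝ) (h : HNFilt P L X) :
    HNFilt P (φ :: L) X :=
  .cons (contractible_distinguished X) h (hP.zero_mem φ (isZero_zero D))

/-- Phases may be added to the list, the corresponding factors being zero. -/
lemma refine (hP : IsPreslicing P) (hM : M.Pairwise (· < ·)) (hL : L.Pairwise (· < ·))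
    (hLM : L ⊆ M) (h : HNFilt P L X) : HNFilt P M X := by
  induction M generalizing L X with
  | nil => rwa [List.subset_nil.1 hLM] at h
  | cons m M ih =>
    rw [List.pairwise_cons] at hM
    cases h with
    | nil h => exact cons_of_zero_mem hP m (ih hM.2 .nil (List.nil_subset _) (.nil h))
    | @cons l L E _ A f p t hT hE hA =>
      have hL' := List.pairwise_cons.1 hL
      rcases List.mem_cons.1 (hLM List.mem_cons_self) with rfl | hl
      · refine .cons hT (ih hM.2 hL'.2 (fun x hx => ?_) hE) hA
        rcases List.mem_cons.1 (hLM (List.mem_cons_of_mem _ hx)) with rfl | hx'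
        · exact absurd (hL'.1 _ hx) (lt_irrefl _)
        · exact hx'
      · refine cons_of_zero_mem hP m (ih hM.2 hL (fun x hx => ?_) (.cons hT hE hA))
        rcases List.mem_cons.1 (hLM hx) with rfl | hx'
        · have h1 := hM.1 l hl
          rcases List.mem_cons.1 hx with rfl | hx''
          · exact absurd h1 (lt_irrefl _)
          · exact absurd (h1.trans (hL'.1 _ hx'')) (lt_irrefl _)
        · exact hx'

/-- Direct sums of filtrations. -/
lemma sum (hP : IsPreslicing P) (hX : HNFilt P L X) (hY : HNFilt P L Y) (s : BinSplit Z X Y) :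
    HNFilt P L Z := by
  induction hX generalizing Y Z with
  | nil hX =>
    cases hY with
    | nil hY =>
      refine .nil ?_
      rw [IsZero.iff_id_eq_zero]
      exact s.hom_ext (hX.eq_of_src _ _) (hY.eq_of_src _ _)
  | @cons φ L E X A f p t hT hE hA ih =>
    cases hY with
    | @cons _ _ E' _ A' f' p' t' hT' hE' hA' =>
      let b : ∀ U V : D, BinSplit (U ⊞ V) U V := fun U V =>
        ⟨biprod.inl, biprod.inr, biprod.fst, biprod.snd, by simp, by simp, by simp, by simp,
          by simp⟩
      let e := b E E'
      let a := b A A'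
      let F : E ⊞ E' ⟶ Z := e.p₁ ≫ f ≫ s.i₁ + e.p₂ ≫ f' ≫ s.i₂
      let G : Z ⟶ A ⊞ A' := s.p₁ ≫ p ≫ a.i₁ + s.p₂ ≫ p' ≫ a.i₂
      let H : A ⊞ A' ⟶ (E ⊞ E')⟦(1 : ℤ)⟧ := a.p₁ ≫ t ≫ e.i₁⟦(1 : ℤ)⟧' + a.p₂ ≫ t' ≫ e.i₂⟦(1 : ℤ)⟧'
      have hH₁ : H ≫ e.p₁⟦(1 : ℤ)⟧' = a.p₁ ≫ t := by
        simp only [H, Preadditive.add_comp, Category.assoc, ← Functor.map_comp, e.i₁_p₁, e.i₂_p₁,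
          Functor.map_zero, comp_zero, add_zero, CategoryTheory.Functor.map_id, Category.comp_id]
      have hH₂ : H ≫ e.p₂⟦(1 : ℤ)⟧' = a.p₂ ≫ t' := by
        simp only [H, Preadditive.add_comp, Category.assoc, ← Functor.map_comp, e.i₁_p₂, e.i₂_p₂,
          Functor.map_zero, comp_zero, zero_add, CategoryTheory.Functor.map_id, Category.comp_id]
      have hFGH : Triangle.mk F G H ∈ distTriang D :=
        distinguished_of_binSplit hT hT'
          (Triangle.homMk (Triangle.mk F G H) (Triangle.mk f p t) e.p₁ s.p₁ a.p₁
            (by change F ≫ s.p₁ = e.p₁ ≫ f; simp [F])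
            (by change G ≫ a.p₁ = s.p₁ ≫ p; simp [G]) hH₁)
          (Triangle.homMk (Triangle.mk F G H) (Triangle.mk f' p' t') e.p₂ s.p₂ a.p₂
            (by change F ≫ s.p₂ = e.p₂ ≫ f'; simp [F])
            (by change G ≫ a.p₂ = s.p₂ ≫ p'; simp [G]) hH₂) e rfl rfl s rfl rfl a rfl rfl
      exact .cons hFGH (ih hE' e) (hP.sum_mem a hA hA')

/-- Zero factors can be removed. -/
lemma exists_ne_zero (h : HNFilt P L X) (hL : L.Pairwise (· < ·)) :
    ∃ M : List ℝ, M ⊆ L ∧ M.Pairwise (· < ·) ∧ HNFilt (fun φ A => P φ A ∧ ¬ IsZero A) M X := by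
  induction h with
  | nil h => exact ⟨[], List.nil_subset _, .nil, .nil h⟩
  | @cons φ L E X A f p t hT hE hA ih =>
    rw [List.pairwise_cons] at hL
    obtain ⟨M, hML, hM, hE'⟩ := ih hL.2
    by_cases h0 : IsZero A
    · have : IsIso f := (Pretriangulated.Triangle.distinguished_iff_of_isZero₃ (Triangle.mk f p t)
        h0).1 hT
      exact ⟨M, fun x hx => List.mem_cons_of_mem _ (hML hx), hM, hE'.of_iso (asIso f)⟩
    · refine ⟨φ :: M, List.cons_subset_cons _ hML, List.pairwise_cons.2
        ⟨fun x hx => hL.1 x (hML hx), hM⟩, .cons hT hE' ⟨hA, h0⟩⟩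

/-- A filtration as a sequence of objects. -/
lemma exists_fin (h : HNFilt P L X) (hL : L.Pairwise (· < ·)) :
    ∃ (n : ℕ) (φ : Fin n → ℝ) (E : Fin (n + 1) → D), StrictAnti φ ∧ (∀ i, φ i ∈ L) ∧
      IsZero (E 0) ∧ E (Fin.last n) = X ∧ ∀ i, ∃ (A : D) (f : E i.castSucc ⟶ E i.succ)
        (p : E i.succ ⟶ A) (t : A ⟶ (E i.castSucc)⟦(1 : ℤ)⟧),
        Triangle.mk f p t ∈ distTriang D ∧ P (φ i) A := by
  induction h with
  | @nil X h => exact ⟨0, Fin.elim0, fun _ => X, fun i => i.elim0, fun i => i.elim0, h, rfl,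
      fun i => i.elim0⟩
  | @cons φ₀ L E₀ X A f p t hT hE hA ih =>
    rw [List.pairwise_cons] at hL
    obtain ⟨n, φ, E, hφ, hφL, hE₀, hEn, hstep⟩ := ih hL.2
    subst hEn
    refine ⟨n + 1, Fin.snoc (α := fun _ => ℝ) φ φ₀, Fin.snoc (α := fun _ => D) E X, ?_, ?_, ?_, ?_,
      ?_⟩
    · intro i j hij
      induction j using Fin.lastCases with
      | last =>
        induction i using Fin.lastCases with
        | last => exact absurd hij (lt_irrefl _)
        | cast i => simpa using hL.1 _ (hφL i)
      | cast j =>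
        induction i using Fin.lastCases with
        | last => exact absurd hij (Fin.castSucc_lt_last j).not_gt
        | cast i => simpa using hφ (Fin.castSucc_lt_castSucc_iff.1 hij)
    · intro i
      induction i using Fin.lastCases with
      | last => simp
      | cast i => simpa using Or.inr (hφL i)
    · have : Fin.snoc (α := fun _ => D) E X 0 = E 0 :=
        Fin.snoc_castSucc (α := fun _ => D) X E 0
      rwa [this]
    · simp
    · intro i
      induction i using Fin.lastCases with
      | last =>
        have h1 : Fin.snoc (α := fun _ => D) E X (Fin.last n).castSucc = E (Fin.last n) :=
          Fin.snoc_castSucc (α := fun _ => D) X E _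
        have h2 : Fin.snoc (α := fun _ => D) E X (Fin.last n).succ = X :=
          Fin.snoc_last (α := fun _ => D) X E
        rw [h1, h2, Fin.snoc_last]
        exact ⟨A, f, p, t, hT, hA⟩
      | cast i =>
        have h1 : Fin.snoc (α := fun _ => D) E X i.castSucc.castSucc = E i.castSucc :=
          Fin.snoc_castSucc (α := fun _ => D) X E _
        have h2 : Fin.snoc (α := fun _ => D) E X i.castSucc.succ = E i.succ :=
          Fin.snoc_castSucc (α := fun _ => D) X E i.succ
        rw [h1, h2, Fin.snoc_castSucc]
        exact hstep i

end HNFilt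

namespace HasHN

lemma of_iso (h : HasHN P X) (e : X ≅ Y) : HasHN P Y :=
  let ⟨L, hL, h⟩ := h
  ⟨L, hL, h.of_iso e⟩

lemma of_isZero (h : IsZero X) : HasHN P X := ⟨[], .nil, .nil h⟩

lemma sum (hP : IsPreslicing P) (hX : HasHN P X) (hY : HasHN P Y) (s : BinSplit Z X Y) :
    HasHN P Z := by
  obtain ⟨L, hL, hX⟩ := hX
  obtain ⟨L', hL', hY⟩ := hY
  let M := (L.toFinset ∪ L'.toFinset).sort (· ≤ ·)
  have hM : M.Pairwise (· < ·) := (Finset.sortedLT_sort _).pairwise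
  exact ⟨M, hM, (hX.refine hP hM hL fun x hx => by simp [M, hx]).sum hP
    (hY.refine hP hM hL' fun x hx => by simp [M, hx]) s⟩

/-- Harder-Narasimhan filtrations given by sequences of objects. -/
lemma of_fin {n : ℕ} {φ : Fin n → ℝ} {E : Fin (n + 1) → D} {A : Fin n → D}
    {f : ∀ i : Fin n, E i.castSucc ⟶ E i.succ} {p : ∀ i : Fin n, E i.succ ⟶ A i}
    {t : ∀ i : Fin n, A i ⟶ (E i.castSucc)⟦(1 : ℤ)⟧} (hφ : StrictAnti φ) (hE : IsZero (E 0))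
    (h : ∀ i, Triangle.mk (f i) (p i) (t i) ∈ distTriang D ∧ P (φ i) (A i)) :
    HasHN P (E (Fin.last n)) := by
  have key : ∀ i : Fin (n + 1), ∃ L : List ℝ, L.Pairwise (· < ·) ∧
      (∀ x ∈ L, ∃ j : Fin n, j.castSucc < i ∧ x = φ j) ∧ HNFilt P L (E i) := by
    intro i
    induction i using Fin.induction with
    | zero => exact ⟨[], .nil, by simp, .nil hE⟩
    | succ i ih =>
      obtain ⟨L, hL, hLφ, hi⟩ := ih
      refine ⟨φ i :: L, List.pairwise_cons.2 ⟨fun x hx => ?_, hL⟩, fun x hx => ?_,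
        .cons (h i).1 hi (h i).2⟩
      · obtain ⟨j, hj, rfl⟩ := hLφ x hx
        exact hφ (Fin.castSucc_lt_castSucc_iff.1 hj)
      · rcases List.mem_cons.1 hx with rfl | hx
        · exact ⟨i, i.castSucc_lt_succ, rfl⟩
        · obtain ⟨j, hj, rfl⟩ := hLφ x hx
          exact ⟨j, hj.trans i.castSucc_lt_succ, rfl⟩
  obtain ⟨L, hL, -, h⟩ := key (Fin.last n)
  exact ⟨L, hL, h⟩

lemma exists_tower (h : HasHN P X) : ∃ F : HNTower P X, F.obj (Fin.last F.n) = X := by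
  obtain ⟨L, hL, h⟩ := h
  obtain ⟨M, -, hM, h⟩ := h.exists_ne_zero hL
  obtain ⟨n, φ, E, hφ, -, hE₀, hEn, hE⟩ := h.exists_fin hM
  choose A f p t hT hA using hE
  exact ⟨⟨n, E, A, f, p, t, hT, hE₀, eqToIso hEn, φ, hφ, fun i => (hA i).1, fun i => (hA i).2⟩,
    hEn⟩

/-- Semistable objects are characterized by the vanishing of morphisms from semistable objects of
larger phase and to semistable objects of smaller phase. -/
lemma mem_of_orthogonal (hP : IsPreslicing P) (h : HasHN P X)
    (h₁ : ∀ ψ A, φ < ψ → P ψ A → ∀ f : A ⟶ X, f = 0)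
    (h₂ : ∀ ψ A, ψ < φ → P ψ A → ∀ f : X ⟶ A, f = 0) : P φ X := by
  obtain ⟨L, hL, h⟩ := h
  obtain ⟨M, -, hM, h⟩ := h.exists_ne_zero hL
  cases h with
  | nil h => exact hP.zero_mem φ h
  | @cons ψ M E _ A f p t hT hE hA =>
    rw [List.pairwise_cons] at hM
    have hE₁ : HNFilt P M E := hE.mono fun _ _ h => h.1
    have hEA : Above P ψ E := hE₁.above hP hM.1
    have hψ : φ ≤ ψ := by
      by_contra! hlt
      exact hA.2 (hP.isZero_of_mor₂_eq_zero hT hA.1 hEA (h₂ ψ A hlt hA.1 p))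
    -- As the phases of `E` are larger than `φ`, there are no morphisms `E → X`.
    have hf : f = 0 := by
      have key : ∀ {N : List ℝ} {U : D}, HNFilt P N U → (∀ x ∈ N, ψ < x) →
          ∀ g : U ⟶ X, g = 0 := by
        intro N U hU
        induction hU with
        | nil h => exact fun _ g => h.eq_of_src _ _
        | @cons x N V U B f' p' t' hT' hV hB ih =>
          intro hN g
          obtain ⟨g', hg'⟩ : ∃ g' : B ⟶ X, g = p' ≫ g' :=
            Triangle.yoneda_exact₂ _ hT' g (ih (fun y hy => hN y (List.mem_cons_of_mem _ hy)) _)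
          rw [hg', h₁ x B (hψ.trans_lt (hN x List.mem_cons_self)) hB g', comp_zero]
      exact key hE₁ hM.1 f
    have hE₀ : IsZero E := by
      obtain ⟨r, hr⟩ : ∃ r : E⟦(1 : ℤ)⟧ ⟶ A, 𝟙 (E⟦(1 : ℤ)⟧) = r ≫ t :=
        Triangle.coyoneda_exact₁ _ hT (𝟙 (E⟦(1 : ℤ)⟧))
          (by change 𝟙 _ ≫ f⟦(1 : ℤ)⟧' = 0; rw [hf, Functor.map_zero, comp_zero])
      rw [IsZero.iff_id_eq_zero]
      apply (shiftFunctor D (1 : ℤ)).map_injective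
      rw [CategoryTheory.Functor.map_id, hr, (hP.above_shift hEA) ψ (by linarith) A hA.1 r,
        zero_comp, Functor.map_zero]
    have hp : IsIso p := (Pretriangulated.Triangle.distinguished_iff_of_isZero₁ (Triangle.mk f p t)
      hE₀).1 hT
    have hφ : ψ = φ := by
      refine le_antisymm ?_ hψ
      by_contra! hlt
      have h0 := h₁ ψ A hlt hA.1 (inv p)
      refine hA.2 ?_
      rw [IsZero.iff_id_eq_zero, ← IsIso.inv_hom_id p, h0, zero_comp]
    exact hP.iso_mem (asIso p).symm (hφ ▸ hA.1)

/-- Direct summands of semistable objects are semistable. -/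
lemma mem_of_retract (hP : IsPreslicing P) (h : HasHN P X) (hY : P φ Y) (a : X ⟶ Y) (b : Y ⟶ X)
    (hab : a ≫ b = 𝟙 X) : P φ X := by
  refine h.mem_of_orthogonal hP (fun ψ A hψ hA f => ?_) (fun ψ A hψ hA f => ?_)
  · rw [← Category.comp_id f, ← hab, ← Category.assoc, hP.hom_eq_zero hψ hA hY (f ≫ a), zero_comp]
  · rw [← Category.id_comp f, ← hab, Category.assoc, hP.hom_eq_zero hψ hY hA (b ≫ f), comp_zero]

end HasHN

end Filtrations

end CyclicStab

end

open CategoryTheory CategoryTheory.Limits CategoryTheory.Pretriangulated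

noncomputable section

namespace CyclicStab

universe v u w w'

section Twists

variable {C : Type u} [Category.{v} C] [HasZeroObject C] [Preadditive C] [HasShift C ℤ]
  [∀ n : ℤ, (shiftFunctor C n).Additive] [Pretriangulated C]
  {k : Type w} [Field k] [Linear k C] {β : shiftFunctor C (2 : ℤ) ≅ 𝟭 C}
  {Λ : Type w'} [AddCommGroup Λ] {v : K0 C (distTriang C) →+ Λ} {R R₁ : ChargeTriple k β v}

/-! ### Deformation equivalent charge triples -/

namespace Zigzag

/-- Concatenation of zigzags. -/
def append : ∀ {E F G : IndecObj C}, Zigzag E F → Zigzag F G → Zigzag E G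
  | _, _, _, .nil _, l' => l'
  | _, _, _, .fwd f l, l' => .fwd f (l.append l')
  | _, _, _, .bwd f l, l' => .bwd f (l.append l')

variable {E F G : IndecObj C} {q : RealDecomposition k β} {a b : ℝ}

lemma HasDegree.append {l : Zigzag E F} {l' : Zigzag F G} (h : l.HasDegree q a)
    (h' : l'.HasDegree q b) : (l.append l').HasDegree q (a + b) := by
  induction l generalizing a with
  | nil E =>
    obtain rfl : a = 0 := h
    rwa [zero_add]
  | fwd f l ih =>
    obtain ⟨hf, c, d, hc, hd, rfl⟩ := h
    exact ⟨hf, c, d + b, hc, ih hd h', by ring⟩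
  | bwd f l ih =>
    obtain ⟨hf, c, d, hc, hd, rfl⟩ := h
    exact ⟨hf, c, d + b, hc, ih hd h', by ring⟩

lemma hasDegree_single {f : E.obj ⟶ F.obj} (hf : f ≠ 0) (h : f ∈ q.hom E F a) :
    (Zigzag.fwd f (.nil F)).HasDegree q a :=
  ⟨hf, a, 0, h, rfl, (add_zero a).symm⟩

lemma HasDegree.phase {l : Zigzag E F} (h : l.HasDegree R.q a) :
    ∃ m : ℤ, a = R.phase F - R.phase E + 2 * m := by
  induction l generalizing a with
  | nil E =>
    obtain rfl : a = 0 := h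
    exact ⟨0, by simp⟩
  | fwd f l ih =>
    obtain ⟨hf, c, d, hc, hd, rfl⟩ := h
    obtain ⟨m, rfl⟩ := ih hd
    obtain ⟨m', rfl⟩ := R.degree _ _ _ _ hf hc
    exact ⟨m + m', by push_cast; ring⟩
  | bwd f l ih =>
    obtain ⟨hf, c, d, hc, hd, rfl⟩ := h
    obtain ⟨m, rfl⟩ := ih hd
    obtain ⟨m', rfl⟩ := R.degree _ _ _ _ hf hc
    exact ⟨m - m', by push_cast; ring⟩

/-- A relation between indecomposable objects which holds along nonzero homogeneous morphisms holds
along connecting paths. -/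
lemma IsConnecting.induction {l : Zigzag E F} (h : l.IsConnecting q) {α : Type*}
    (κ : IndecObj C → α) (hκ : ∀ (E F : IndecObj C) (f : E.obj ⟶ F.obj) (a : ℝ), f ≠ 0 →
      f ∈ q.hom E F a → κ E = κ F) : κ E = κ F := by
  obtain ⟨a, h⟩ := h
  induction l generalizing a with
  | nil E => rfl
  | fwd f l ih =>
    obtain ⟨hf, c, d, hc, hd, rfl⟩ := h
    exact (hκ _ _ f c hf hc).trans (ih d hd)
  | bwd f l ih =>
    obtain ⟨hf, c, d, hc, hd, rfl⟩ := h
    exact (hκ _ _ f c hf hc).symm.trans (ih d hd)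

end Zigzag

/-- A function `η` on indecomposable objects by which the real decomposition and the phases of two
charge triples differ. -/
structure Twist (R R₁ : ChargeTriple k β v) where
  η : IndecObj C → ℝ
  mem_iff : ∀ {E F : IndecObj C} {f : E.obj ⟶ F.obj} {a : ℝ},
    f ∈ R.q.hom E F a ↔ f ∈ R₁.q.hom E F (a + η F - η E)
  shift_one : ∀ E : IndecObj C, η (E.shift 1) = η E
  phase : ∀ E : IndecObj C, ∃ m : ℤ, R₁.phase E = R.phase E + η E + 2 * m

namespace ChargeTriple

/-- Deformation equivalent charge triples differ by a twist: `η F` compares the degrees of any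
connecting path from a fixed object to `F`. -/
lemma DeformationEquivalent.exists_degree (h : R.DeformationEquivalent R₁)
    (hR : R.q.Connective) : ∃ η : IndecObj C → ℝ,
      (∀ {E F : IndecObj C} {f : E.obj ⟶ F.obj} {a : ℝ},
        f ∈ R.q.hom E F a ↔ f ∈ R₁.q.hom E F (a + η F - η E)) ∧
      ∀ E : IndecObj C, ∃ m : ℤ, R₁.phase E = R.phase E + η E + 2 * m := by
  rcases isEmpty_or_nonempty (IndecObj C) with he | ⟨⟨E₀⟩⟩
  · exact ⟨fun _ => 0, fun {E _ _ _} => (he.false E).elim, fun E => he.elim E⟩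
  have hconn : ∀ {E F : IndecObj C} (l : Zigzag E F), l.IsConnecting R.q ↔ l.IsConnecting R₁.q :=
    fun l => by simpa using (h _ _ l l).1
  choose l hl using hR E₀
  choose d hd using hl
  choose d₁ hd₁ using fun F => (hconn (l F)).1 ⟨d F, hd F⟩
  have hle : ∀ {E F : IndecObj C} {f : E.obj ⟶ F.obj} {a b : ℝ}, f ≠ 0 → f ∈ R.q.hom E F a →
      f ∈ R₁.q.hom E F b → b = a + (d₁ F - d F) - (d₁ E - d E) := by
    intro E F f a b hf ha hb
    have := (h _ _ ((l E).append (.fwd f (.nil F))) (l F)).2 _ _ _ _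
      ((hd E).append (Zigzag.hasDegree_single hf ha)) (hd F)
      ((hd₁ E).append (Zigzag.hasDegree_single hf hb)) (hd₁ F)
    linarith
  refine ⟨fun F => d₁ F - d F + (R₁.phase E₀ - R.phase E₀), fun {E F f a} => ?_, fun E => ?_⟩
  · by_cases hf : f = 0
    · simp [hf, zero_mem]
    constructor
    · intro ha
      obtain ⟨_, -, b, _, hb, -, -⟩ := (hconn _).1 ⟨a, Zigzag.hasDegree_single hf ha⟩
      have := hle hf ha hb
      rwa [show a + (d₁ F - d F + (R₁.phase E₀ - R.phase E₀)) -
        (d₁ E - d E + (R₁.phase E₀ - R.phase E₀)) = b by linarith]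
    · intro hb
      obtain ⟨_, -, a', _, ha', -, -⟩ := (hconn _).2 ⟨_, Zigzag.hasDegree_single hf hb⟩
      have := hle hf ha' hb
      rwa [show a = a' by linarith]
  · obtain ⟨m, hm⟩ := (hd E).phase
    obtain ⟨m₁, hm₁⟩ := (hd₁ E).phase
    refine ⟨m - m₁, ?_⟩
    simp only [hm, hm₁]
    push_cast
    ring

end ChargeTriple

namespace Twist

lemma eq_of_iso {η : IndecObj C → ℝ} (hη : ∀ {E F : IndecObj C} {f : E.obj ⟶ F.obj} {a : ℝ},
    f ∈ R.q.hom E F a → f ∈ R₁.q.hom E F (a + η F - η E)) {E F : IndecObj C}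
    {f : E.obj ⟶ F.obj} (hf : IsIso f) (h : f ∈ R.q.hom E F 0) : η E = η F := by
  have := R₁.q.degree_iso hf (hη h)
  linarith

end Twist

namespace ChargeTriple

theorem DeformationEquivalent.exists_twist (h : R.DeformationEquivalent R₁)
    (hR : R.q.Connective) : Nonempty (Twist R R₁) := by
  obtain ⟨η, hη, hphase⟩ := h.exists_degree hR
  refine ⟨⟨η, hη, fun E => ?_, hphase⟩⟩
  have hconst : ∀ E F : IndecObj C, η (E.shift 1) - η E = η (F.shift 1) - η F := by
    intro E F
    obtain ⟨l, hl⟩ := hR E F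
    refine hl.induction (fun E => η (E.shift 1) - η E) fun E F f a hf ha => ?_
    have h1 := R₁.q.shift_mem 1 (hη.1 ha)
    have h2 := hη.1 (R.q.shift_mem 1 ha)
    have hne : f⟦(1 : ℤ)⟧' ≠ 0 := fun h0 => hf ((shiftFunctor C (1 : ℤ)).map_injective
      (by rw [h0, Functor.map_zero]))
    have := RealDecomposition.degree_unique (E := E.shift 1) (F := F.shift 1) hne h1 h2
    linarith
  have h1 : η ((E.shift 1).shift 1) = η (E.shift (1 + 1)) :=
    (Twist.eq_of_iso hη.1 (E := E.shift (1 + 1)) (F := (E.shift 1).shift 1) inferInstance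
      (R.q.shiftAdd_mem E 1 1)).symm
  have h2 : η (E.shift 2) = η E :=
    Twist.eq_of_iso hη.1 (E := E.shift 2) (F := E) (f := β.hom.app E.obj) inferInstance (R.q.bott_mem E)
  have h3 := hconst (E.shift 1) E
  have h4 : η (E.shift (1 + 1)) = η (E.shift 2) := by norm_num
  linarith

end ChargeTriple

namespace Twist

variable (T : Twist R R₁)

lemma η_eq_of_iso {E F : IndecObj C} (hloc : ∀ E : IndecObj C, IsLocalRing (End E.obj))
    (e : E.obj ≅ F.obj) : T.η E = T.η F := by
  obtain ⟨e', he'⟩ := R.q.exists_homogeneous_iso hloc e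
  exact eq_of_iso T.mem_iff.1 (Iso.isIso_hom e') he'

lemma hasDegree_iff {E F : IndecObj C} {l : Zigzag E F} {a : ℝ} :
    l.HasDegree R.q a ↔ l.HasDegree R₁.q (a + T.η F - T.η E) := by
  induction l generalizing a with
  | nil E =>
    change a = 0 ↔ a + T.η E - T.η E = 0
    rw [add_sub_cancel_right]
  | @fwd E F G f l ih =>
    constructor
    · rintro ⟨hf, c, d, hc, hd, rfl⟩
      exact ⟨hf, _, _, T.mem_iff.1 hc, ih.1 hd, by ring⟩
    · rintro ⟨hf, c, d, hc, hd, h⟩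
      refine ⟨hf, c - T.η F + T.η E, d - T.η G + T.η F, T.mem_iff.2 ?_, ih.2 ?_, by linarith⟩
      · rwa [show c - T.η F + T.η E + T.η F - T.η E = c by ring]
      · rwa [show d - T.η G + T.η F + T.η G - T.η F = d by ring]
  | @bwd E F G f l ih =>
    constructor
    · rintro ⟨hf, c, d, hc, hd, rfl⟩
      exact ⟨hf, _, _, T.mem_iff.1 hc, ih.1 hd, by ring⟩
    · rintro ⟨hf, c, d, hc, hd, h⟩
      refine ⟨hf, c - T.η E + T.η F, d - T.η G + T.η F, T.mem_iff.2 ?_, ih.2 ?_, by linarith⟩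
      · rwa [show c - T.η E + T.η F + T.η E - T.η F = c by ring]
      · rwa [show d - T.η G + T.η F + T.η G - T.η F = d by ring]

lemma hasDegree_iff' {E F : IndecObj C} {l : Zigzag E F} {a : ℝ} :
    l.HasDegree R₁.q a ↔ l.HasDegree R.q (a - T.η F + T.η E) := by
  rw [T.hasDegree_iff]
  ring_nf

lemma mem_iff' {E F : IndecObj C} {f : E.obj ⟶ F.obj} {a : ℝ} :
    f ∈ R₁.q.hom E F a ↔ f ∈ R.q.hom E F (a - T.η F + T.η E) := by
  rw [T.mem_iff]
  ring_nf

lemma isConnecting_iff (T : Twist R R₁) {E F : IndecObj C} {l : Zigzag E F} :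
    l.IsConnecting R.q ↔ l.IsConnecting R₁.q :=
  ⟨fun ⟨_, h⟩ => ⟨_, T.hasDegree_iff.1 h⟩, fun ⟨_, h⟩ => ⟨_, T.hasDegree_iff'.1 h⟩⟩

lemma isHomogeneous_iff (T : Twist R R₁) {E F : IndecObj C} {f : E.obj ⟶ F.obj} :
    R.q.IsHomogeneous f ↔ R₁.q.IsHomogeneous f :=
  ⟨fun ⟨_, h⟩ => ⟨_, T.mem_iff.1 h⟩, fun ⟨_, h⟩ => ⟨_, T.mem_iff'.1 h⟩⟩

lemma deformationEquivalent (T : Twist R R₁) : R.DeformationEquivalent R₁ := by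
  intro E F l₁ l₂
  refine ⟨and_congr T.isConnecting_iff T.isConnecting_iff, fun a₁ a₂ b₁ b₂ h₁ h₂ h₁' h₂' => ?_⟩
  have e₁ := (T.hasDegree_iff.1 h₁).unique h₁'
  have e₂ := (T.hasDegree_iff.1 h₂).unique h₂'
  linarith

/-- The equivalence of `ℤ`-lifts `(E, θ) ↦ (E, θ + η E + 2 m)`. -/
def equivalence (m : ℤ) : LiftEquivalence R R₁ where
  h X := X.phase + T.η X.obj + 2 * m
  spec X := by
    obtain ⟨n, hn⟩ := X.phase_spec
    obtain ⟨n', hn'⟩ := T.phase X.obj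
    exact ⟨n - n' + m, by rw [hn, hn']; push_cast; ring⟩
  add_two X Y h h' := by rw [h', h]; ring
  hom_mem X Y f hf := by
    have := T.mem_iff.1 hf
    rwa [show Y.phase + T.η Y.obj + 2 * m - (X.phase + T.η X.obj + 2 * m) =
      Y.phase - X.phase + T.η Y.obj - T.η X.obj by ring]

end Twist

lemma LiftEquivalence.h_eq_of_obj_eq (H : LiftEquivalence R R₁) {X Y : LiftedIndec R}
    (h : X.obj = Y.obj) : H.h Y - Y.phase = H.h X - X.phase := by
  obtain ⟨E, θ, m, hm⟩ := X
  obtain ⟨F, θ', m', hm'⟩ := Y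
  obtain rfl : E = F := h
  have key : ∀ n : ℤ, ∀ hn : ∃ m : ℤ, θ + 2 * n = R.phase E + 2 * m,
      H.h ⟨E, θ + 2 * n, hn⟩ = H.h ⟨E, θ, m, hm⟩ + 2 * n := by
    intro n
    induction n using Int.induction_on with
    | zero => intro hn; simp
    | succ i ih =>
      intro hn
      have hi : ∃ m : ℤ, θ + 2 * ((i : ℤ) : ℝ) = R.phase E + 2 * m :=
        ⟨m + i, by rw [hm]; push_cast; ring⟩
      have := H.add_two ⟨E, θ + 2 * ((i : ℤ) : ℝ), hi⟩ ⟨E, _, hn⟩ rfl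
        (by push_cast; ring)
      rw [this, ih hi]
      push_cast
      ring
    | pred i ih =>
      intro hn
      have hi : ∃ m : ℤ, θ + 2 * ((-(i : ℤ) : ℤ) : ℝ) = R.phase E + 2 * m :=
        ⟨m - i, by rw [hm]; push_cast; ring⟩
      have := H.add_two ⟨E, _, hn⟩ ⟨E, θ + 2 * ((-(i : ℤ) : ℤ) : ℝ), hi⟩ rfl
        (by push_cast; ring)
      rw [ih hi] at this
      push_cast at this ⊢
      linarith
  have hθ : θ' = θ + 2 * ((m' - m : ℤ) : ℝ) := by rw [hm, hm']; push_cast; ring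
  subst hθ
  have := key _ ⟨m', hm'⟩
  change H.h ⟨E, _, _⟩ - (θ + _) = H.h ⟨E, θ, _⟩ - θ
  linarith

/-- All equivalences of `ℤ`-lifts over `C` are translates of the one given by a twist. -/
lemma LiftEquivalence.exists_eq (H : LiftEquivalence R R₁) (T : Twist R R₁)
    (hR : R.q.Connective) : ∃ m : ℤ, ∀ X, H.h X = X.phase + T.η X.obj + 2 * m := by
  rcases isEmpty_or_nonempty (LiftedIndec R) with he | ⟨⟨X₀⟩⟩
  · exact ⟨0, fun X => he.elim X⟩
  have hconst : ∀ X Y : LiftedIndec R, H.h X - X.phase - T.η X.obj =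
      H.h Y - Y.phase - T.η Y.obj := by
    intro X Y
    obtain ⟨l, hl⟩ := hR X.obj Y.obj
    let κ : IndecObj C → ℝ := fun E => H.h ⟨E, R.phase E, 0, by simp⟩ - R.phase E - T.η E
    have hκ : ∀ Z : LiftedIndec R, H.h Z - Z.phase - T.η Z.obj = κ Z.obj := fun Z => by
      have := H.h_eq_of_obj_eq (X := ⟨Z.obj, R.phase Z.obj, 0, by simp⟩) (Y := Z) rfl
      change H.h Z - Z.phase = H.h ⟨Z.obj, R.phase Z.obj, _⟩ - R.phase Z.obj at this
      change _ = H.h ⟨Z.obj, R.phase Z.obj, _⟩ - R.phase Z.obj - T.η Z.obj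
      rw [this]
    rw [hκ, hκ]
    refine hl.induction κ fun E F f a hf ha => ?_
    obtain ⟨m, hm⟩ := R.degree E F f a hf ha
    let Z : LiftedIndec R := ⟨E, R.phase E, 0, by simp⟩
    let Z' : LiftedIndec R := ⟨F, R.phase E + a, m, by rw [hm]; ring⟩
    have h1 := H.hom_mem Z Z' f (by
      change f ∈ R.q.hom E F (R.phase E + a - R.phase E)
      rwa [add_sub_cancel_left])
    have h2 := RealDecomposition.degree_unique hf h1 (T.mem_iff.1 ha)
    have e₁ := hκ Z
    have e₂ := hκ Z'
    change _ = κ E at e₁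
    change _ = κ F at e₂
    rw [← e₁, ← e₂]
    change H.h Z - R.phase E - T.η E = H.h Z' - (R.phase E + a) - T.η F
    linarith
  obtain ⟨m, hm⟩ := H.spec X₀
  obtain ⟨m', hm'⟩ := X₀.phase_spec
  obtain ⟨n, hn⟩ := T.phase X₀.obj
  refine ⟨m - m' + n, fun X => ?_⟩
  have := hconst X X₀
  push_cast
  linarith

end Twists

end CyclicStab

end

open CategoryTheory CategoryTheory.Limits CategoryTheory.Pretriangulated

noncomputable section

namespace CyclicStab

universe v u w w'

section Semistable

variable {C : Type u} [Category.{v} C] [HasZeroObject C] [Preadditive C] [HasShift C ℤ]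
  [∀ n : ℤ, (shiftFunctor C n).Additive] [Pretriangulated C]
  {k : Type w} [Field k] [Linear k C] {β : shiftFunctor C (2 : ℤ) ≅ 𝟭 C}
  {Λ : Type w'} [AddCommGroup Λ] {v : K0 C (distTriang C) →+ Λ} {R R₁ : ChargeTriple k β v}

/-! ### Semistable objects of the `ℤ`-lift -/

/-- An object with a splitting is the biproduct of the summands. -/
def BinSplit.isoBiprod {X X₁ X₂ : C} (s : BinSplit X X₁ X₂) : X ≅ X₁ ⊞ X₂ where
  hom := biprod.lift s.p₁ s.p₂
  inv := biprod.desc s.i₁ s.i₂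
  hom_inv_id := by rw [biprod.lift_desc, s.total]
  inv_hom_id := by ext <;> simp

lemma K0.of_binSplit {X X₁ X₂ : C} (s : BinSplit X X₁ X₂) :
    K0.of (distTriang C) X = K0.of (distTriang C) X₁ + K0.of (distTriang C) X₂ := by
  have hT : Triangle.mk s.i₁ s.p₂ (0 : X₂ ⟶ X₁⟦(1 : ℤ)⟧) ∈ distTriang C := by
    refine isomorphic_distinguished _ (binaryBiproductTriangle_distinguished X₁ X₂) _ ?_
    refine Triangle.isoMk _ _ (Iso.refl _) s.isoBiprod (Iso.refl _) ?_ ?_ ?_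
    · change s.i₁ ≫ biprod.lift s.p₁ s.p₂ = 𝟙 _ ≫ biprod.inl
      ext <;> simp
    · change s.p₂ ≫ 𝟙 _ = biprod.lift s.p₁ s.p₂ ≫ biprod.snd
      simp
    · change (0 : X₂ ⟶ X₁⟦(1 : ℤ)⟧) ≫ (𝟙 X₁)⟦(1 : ℤ)⟧' = 𝟙 X₂ ≫ 0
      simp
  have h : K0.of (distTriang C) X - K0.of (distTriang C) X₁ - K0.of (distTriang C) X₂ = 0 :=
    (QuotientAddGroup.eq_zero_iff _).2 (AddSubgroup.subset_closure ⟨_, hT, rfl⟩)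
  rw [← sub_eq_zero, ← h]
  abel

lemma K0.of_isZero {X : C} (h : IsZero X) : K0.of (distTriang C) X = 0 := by
  have := K0.of_binSplit (BinSplit.zeroLeft X h)
  simpa using this

open ZeroObject in
lemma K0.of_iso {X Y : C} (e : X ≅ Y) :
    K0.of (distTriang C) X = K0.of (distTriang C) Y := by
  have hZ := isZero_zero C
  have := K0.of_binSplit (X := X) (X₁ := (0 : C)) (X₂ := Y) ⟨0, e.inv, 0, e.hom, hZ.eq_of_src _ _, by simp,
    by simp, by simp, by simp⟩
  rw [this, K0.of_isZero hZ, zero_add]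

namespace LiftedObj

lemma exists_isIso_pr (hloc : ∀ E : IndecObj C, IsLocalRing (End E.obj)) (X : LiftedObj R)
    {N : LiftedIndec R} (a : N.lift ⟶ X) (b : X ⟶ N.lift) (h : IsIso (a ≫ b)) :
    ∃ i, IsIso (a ≫ X.pr i) := by
  have := isLocalRing_end_lift hloc N
  have (i : Fin X.dec.n) := isLocalRing_end_lift hloc (X.summand i)
  exact X.sumData.exists_isIso_proj N.not_isZero a b

/-- Every object is obtained from the objects `(E, θ)` by direct sums. -/
lemma induction {p : LiftedObj R → Prop} (zero : ∀ X, IsZero X → p X)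
    (sum : ∀ X Y Z, BinSplit Z X Y → p X → p Y → p Z) (single : ∀ L : LiftedIndec R, p L.lift)
    (X : LiftedObj R) : p X := by
  classical
  induction hn : X.dec.n generalizing X with
  | zero => exact zero X (isZero_iff.2 hn)
  | succ n ih =>
    let i₀ : Fin X.dec.n := ⟨0, by omega⟩
    obtain ⟨X', hX', ⟨s'⟩⟩ := exists_sumData_compl X i₀
    have : IsIso (X.sumData.inj i₀ ≫ X.sumData.proj i₀) := by
      rw [X.sumData.inj_proj_self]
      infer_instance
    obtain ⟨b, -⟩ := X.sumData.exists_split_of_proj i₀ s' (X.sumData.proj i₀)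
    exact sum _ _ _ b (single _) (ih X' (by omega))

/-- A lift of a decomposed object of `C`. -/
def ofDecomposition {X : C} (d : Decomposition X) : LiftedObj R :=
  ⟨X, d, fun i => R.phase (d.summand i), fun _ => ⟨0, by simp⟩⟩

end LiftedObj

namespace StabilityCondition

variable {σ : StabilityCondition k β v} {ψ : Set.Ioc (0 : ℝ) 2} {X Y : C} {E F : IndecObj C}

variable (σ) in
/-- Semistable indecomposable objects. -/
def Semistable (E : IndecObj C) : Prop := ∃ ψ, σ.Q ψ E.obj

lemma Semistable.of_iso (h : σ.Semistable E) (e : E.obj ≅ F.obj) : σ.Semistable F :=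
  let ⟨ψ, h⟩ := h
  ⟨ψ, σ.iso_mem ψ _ _ e h⟩

lemma Semistable.mem_iff (h : σ.Semistable E) : σ.Q ψ E.obj ↔ σ.phase E = ψ := by
  constructor
  · exact fun h' => (σ.semistable ψ E h').1
  · intro h'
    obtain ⟨ψ', h⟩ := h
    obtain rfl : ψ' = ψ := Subtype.ext ((σ.semistable ψ' E h).1.symm.trans h')
    exact h

/-- Every real number is congruent modulo `2` to a unique element of `(0, 2]`. -/
lemma exists_mem_Ioc (a : ℝ) : ∃ (ψ : Set.Ioc (0 : ℝ) 2) (m : ℤ), a = ψ + 2 * m := by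
  have h2 : (0 : ℝ) < 2 := two_pos
  refine ⟨⟨toIocMod h2 0 a, ?_⟩, toIocDiv h2 0 a, ?_⟩
  · simpa using toIocMod_mem_Ioc h2 0 a
  · have := toIocMod_add_toIocDiv_zsmul h2 0 a
    rw [zsmul_eq_mul] at this
    change a = toIocMod h2 0 a + _
    linarith

lemma Ioc_ext {ψ ψ' : Set.Ioc (0 : ℝ) 2} {m m' : ℤ} (h : (ψ : ℝ) + 2 * m = ψ' + 2 * m') :
    ψ = ψ' := by
  obtain ⟨x, hx⟩ := ψ
  obtain ⟨y, hy⟩ := ψ'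
  have h1 : x + 2 * m = y + 2 * m' := h
  have h2 : m = m' := by
    have a1 : (m : ℝ) < m' + 1 := by linarith [hx.1, hx.2, hy.1, hy.2]
    have a2 : (m' : ℝ) < m + 1 := by linarith [hx.1, hx.2, hy.1, hy.2]
    have b1 : m < m' + 1 := by exact_mod_cast a1
    have b2 : m' < m + 1 := by exact_mod_cast a2
    omega
  subst h2
  exact Subtype.ext (by linarith)

lemma semistable_shift_iff : σ.Semistable (E.shift 1) ↔ σ.Semistable E := by
  constructor
  · rintro ⟨ψ', h⟩
    obtain ⟨ψ, m, hm⟩ := exists_mem_Ioc ((ψ' : ℝ) - 1)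
    exact ⟨ψ, (σ.slicing_shift ψ ψ' ⟨m, by linarith⟩ E.obj).2 h⟩
  · rintro ⟨ψ, h⟩
    obtain ⟨ψ', m, hm⟩ := exists_mem_Ioc ((ψ : ℝ) + 1)
    exact ⟨ψ', (σ.slicing_shift ψ ψ' ⟨-m, by push_cast; linarith⟩ E.obj).1 h⟩

lemma mem_of_binSplit {Z : C} (s : BinSplit Z X Y) : σ.Q ψ Z ↔ σ.Q ψ X ∧ σ.Q ψ Y :=
  ⟨fun h => (σ.sum_mem ψ X Y).1 (σ.iso_mem ψ _ _ s.isoBiprod h),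
    fun h => σ.iso_mem ψ _ _ s.isoBiprod.symm ((σ.sum_mem ψ X Y).2 h)⟩

/-- Indecomposable direct summands of objects of `Q ψ` belong to `Q ψ`. -/
lemma mem_of_retract (hKS : IsKrullSchmidt C) (h : σ.Q ψ X) (a : E.obj ⟶ X) (b : X ⟶ E.obj)
    (hab : IsIso (a ≫ b)) : σ.Q ψ E.obj := by
  obtain ⟨d⟩ := hKS.1 X
  have := hKS.2 E
  let X' : LiftedObj σ.toChargeTriple := .ofDecomposition d
  have key : σ.Q ψ X'.obj → ∀ (a : E.obj ⟶ X'.obj) (b : X'.obj ⟶ E.obj), IsIso (a ≫ b) →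
      σ.Q ψ E.obj := by
    induction X' using LiftedObj.induction with
    | zero X hX =>
      intro _ a b hab
      have h0 : a ≫ b = 0 := by
        rw [(LiftedObj.isZero_obj hX).eq_of_tgt a 0, zero_comp]
      rw [h0] at hab
      exact absurd ((IsIso.hom_inv_id (0 : E.obj ⟶ E.obj)).symm.trans zero_comp) E.id_ne_zero
    | sum X Y Z s hX hY =>
      intro h a b hab
      let s' := LiftedObj.mapBinSplit s
      obtain ⟨h₁, h₂⟩ := (mem_of_binSplit s').1 h
      have e : a ≫ b = (a ≫ s'.p₁) ≫ s'.i₁ ≫ b + (a ≫ s'.p₂) ≫ s'.i₂ ≫ b := by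
        conv_lhs => rw [← Category.id_comp b, ← s'.total]
        simp
      rcases isIso_or_isIso_of_isIso_add (e ▸ hab) with h' | h'
      · exact hX h₁ _ _ h'
      · exact hY h₂ _ _ h'
    | single L =>
      intro h a b hab
      have := hKS.2 L.obj
      have : IsIso a := isIso_of_isIso_comp E.indecomposable.1 a b
      exact σ.iso_mem ψ _ _ (asIso a).symm h
  exact key h a b hab

end StabilityCondition

namespace Twist

variable {σ₁ : StabilityCondition k β v} (T : Twist R σ₁.toChargeTriple) (m : ℤ)

/-- The pullback to the `ℤ`-lift of the slicing of a stability condition whose charge triple is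
twisted by `T`: direct sums of objects `(E, θ)` with `E` semistable and `θ + η E + 2 m` the given
phase. -/
def pull : ℝ → ObjectProperty (LiftedObj R) := fun ψ X =>
  ∀ i, X.phase i + T.η (X.dec.summand i) + 2 * m = ψ ∧ σ₁.Semistable (X.dec.summand i)

lemma phase_congr (L : LiftedIndec R) :
    ∃ n : ℤ, L.phase + T.η L.obj + 2 * m = σ₁.phase L.obj + 2 * n := by
  obtain ⟨n, hn⟩ := L.phase_spec
  obtain ⟨n', hn'⟩ := T.phase L.obj
  exact ⟨n - n' + m, by rw [hn, hn']; push_cast; ring⟩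

/-- The description of the pullback by phases in `(0, 2]`. -/
lemma pull_iff {ψ : ℝ} {X : LiftedObj R} : T.pull m ψ X ↔ ∀ i,
    X.phase i + T.η (X.dec.summand i) + 2 * m = ψ ∧ ∃ ψ' : Set.Ioc (0 : ℝ) 2,
      (∃ n : ℤ, ψ = ψ' + 2 * n) ∧ σ₁.Q ψ' (X.dec.summand i).obj := by
  refine forall_congr' fun i => and_congr_right fun h => ⟨fun ⟨ψ', hψ'⟩ => ⟨ψ', ?_, hψ'⟩,
    fun ⟨ψ', _, hψ'⟩ => ⟨ψ', hψ'⟩⟩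
  obtain ⟨n, hn⟩ := T.phase_congr m (X.summand i)
  have := (σ₁.semistable ψ' _ hψ').1
  exact ⟨n, by rw [← h, ← this]; exact hn⟩

lemma pull_lift_iff {ψ : ℝ} {L : LiftedIndec R} :
    T.pull m ψ L.lift ↔ L.phase + T.η L.obj + 2 * m = ψ ∧ σ₁.Semistable L.obj :=
  ⟨fun h => h (0 : Fin 1), fun h _ => h⟩

/-- Isomorphic objects `(E, θ)` and `(F, θ')` have the same phases. -/
lemma lift_eq_of_isIso {L M : LiftedIndec R} (f : L.lift ⟶ M.lift) (hf : IsIso f) :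
    L.phase = M.phase ∧ T.η L.obj = T.η M.obj := by
  have hv : IsIso f.1 := LiftedObj.isIso_val f
  have h := R.q.degree_iso hv (LiftedIndec.hom_mem f)
  refine ⟨by linarith, Twist.eq_of_iso T.mem_iff.1 hv ?_⟩
  rw [← h]
  exact LiftedIndec.hom_mem f

lemma pull_of_isIso {ψ : ℝ} {L : LiftedIndec R} {X : LiftedObj R} (h : T.pull m ψ X)
    (i : Fin X.dec.n) (f : L.lift ⟶ (X.summand i).lift) (hf : IsIso f) : T.pull m ψ L.lift := by
  obtain ⟨h₁, h₂⟩ := T.lift_eq_of_isIso f hf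
  have hv : IsIso f.1 := LiftedObj.isIso_val f
  obtain ⟨h₃, h₄⟩ := h i
  rw [pull_lift_iff, h₁, h₂]
  exact ⟨h₃, h₄.of_iso (asIso f.1).symm⟩

lemma pull_iff_summand {ψ : ℝ} {X : LiftedObj R} :
    T.pull m ψ X ↔ ∀ i, T.pull m ψ (X.summand i).lift :=
  forall_congr' fun i => (T.pull_lift_iff m (L := X.summand i)).symm

lemma pull_isPreslicing (hloc : ∀ E : IndecObj C, IsLocalRing (End E.obj)) :
    IsPreslicing (T.pull m) where
  iso_mem {φ X Y} e h := by
    rw [pull_iff_summand]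
    intro j
    obtain ⟨i, hi⟩ := X.exists_isIso_pr hloc (Y.incl j ≫ e.inv) (e.hom ≫ Y.pr j) (by
      rw [Category.assoc, e.inv_hom_id_assoc]
      have : Y.incl j ≫ Y.pr j = 𝟙 _ := Y.sumData.inj_proj_self j
      rw [this]
      infer_instance)
    exact T.pull_of_isIso m h i _ hi
  zero_mem φ X hX := fun i => absurd i.2 (by have := LiftedObj.isZero_iff.1 hX; omega)
  sum_mem {φ X Y Z} s hX hY := by
    rw [pull_iff_summand]
    intro j
    have := LiftedObj.isLocalRing_end_lift hloc (Z.summand j)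
    have e : 𝟙 (Z.summand j).lift = (Z.incl j ≫ s.p₁) ≫ s.i₁ ≫ Z.pr j +
        (Z.incl j ≫ s.p₂) ≫ s.i₂ ≫ Z.pr j := by
      have h1 : Z.incl j ≫ Z.pr j = 𝟙 _ := Z.sumData.inj_proj_self j
      rw [← h1]
      conv_lhs => rw [← Category.id_comp (Z.pr j), ← s.total]
      simp
    rcases isIso_or_isIso_of_isIso_add (e ▸ (inferInstance : IsIso (𝟙 _))) with h' | h'
    · obtain ⟨i, hi⟩ := X.exists_isIso_pr hloc _ _ h'
      exact T.pull_of_isIso m hX i _ hi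
    · obtain ⟨i, hi⟩ := Y.exists_isIso_pr hloc _ _ h'
      exact T.pull_of_isIso m hY i _ hi
  shift φ X := by
    refine forall_congr' fun i => and_congr ?_ StabilityCondition.semistable_shift_iff.symm
    change _ ↔ X.phase i + ((1 : ℤ) : ℝ) + T.η ((X.dec.summand i).shift 1) + 2 * m = φ + 1
    rw [T.shift_one]
    push_cast
    constructor <;> intro h <;> linarith
  hom_eq_zero {φ₁ φ₂} hlt X Y hX hY f := by
    refine Subtype.ext (X.dec.hom_ext Y.dec fun i j => ?_)
    have h0 : X.dec.inj i ≫ (0 : X ⟶ Y).1 ≫ Y.dec.proj j = 0 := by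
      rw [LiftedObj.zero_val, zero_comp, comp_zero]
    rw [h0]
    by_contra hne
    obtain ⟨h₁, ψ, h₂⟩ := hX i
    obtain ⟨h₃, ψ', h₄⟩ := hY j
    have := σ₁.degree_nonneg ψ ψ' _ _ h₂ h₄ _ _ hne (T.mem_iff.1 (f.2 i j))
    linarith

lemma exp_congr {a b : ℝ} {n : ℤ} (h : a = b + 2 * n) :
    Complex.exp (Complex.I * Real.pi * a) = Complex.exp (Complex.I * Real.pi * b) := by
  rw [h]
  push_cast
  rw [show Complex.I * Real.pi * ((b : ℂ) + 2 * (n : ℂ)) =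
    Complex.I * Real.pi * b + n * (2 * Real.pi * Complex.I) by ring,
    Complex.exp_periodic.int_mul n]

lemma pull_charge (hloc : ∀ E : IndecObj C, IsLocalRing (End E.obj)) {ψ : ℝ} {X : LiftedObj R}
    (h : T.pull m ψ X) : ∃ r : ℝ, 0 ≤ r ∧ (¬ IsZero X → 0 < r) ∧
      σ₁.Z (K0.of _ X.obj) = r * Complex.exp (Complex.I * Real.pi * ψ) := by
  have hP := T.pull_isPreslicing m hloc
  have hret : ∀ {X Y Z : LiftedObj R}, BinSplit Z X Y → T.pull m ψ Z → T.pull m ψ X := by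
    intro X Y Z s hZ
    rw [pull_iff_summand]
    intro j
    obtain ⟨i, hi⟩ := Z.exists_isIso_pr hloc (X.incl j ≫ s.i₁) (s.p₁ ≫ X.pr j) (by
      have : X.incl j ≫ X.pr j = 𝟙 _ := X.sumData.inj_proj_self j
      rw [Category.assoc, s.i₁_p₁_assoc, this]
      infer_instance)
    exact T.pull_of_isIso m hZ i _ hi
  induction X using LiftedObj.induction with
  | zero X hX =>
    exact ⟨0, le_rfl, fun h' => absurd hX h', by
      rw [K0.of_isZero (LiftedObj.isZero_obj hX), map_zero]; simp⟩
  | sum X Y Z s ihX ihY =>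
    obtain ⟨a, ha, ha', hXa⟩ := ihX (hret s h)
    obtain ⟨b, hb, hb', hYb⟩ := ihY (hret s.symm h)
    refine ⟨a + b, add_nonneg ha hb, fun hZ => ?_, ?_⟩
    · by_cases hX : IsZero X
      · refine add_pos_of_nonneg_of_pos ha (hb' fun hY => hZ ?_)
        rw [IsZero.iff_id_eq_zero]
        exact s.hom_ext (hX.eq_of_src _ _) (hY.eq_of_src _ _)
      · exact add_pos_of_pos_of_nonneg (ha' hX) hb
    · rw [K0.of_binSplit (LiftedObj.mapBinSplit s), map_add, hXa, hYb]
      push_cast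
      ring
  | single L =>
    obtain ⟨h₁, ψ', h₂⟩ := (T.pull_lift_iff m).1 h
    obtain ⟨-, r, hr, hZ⟩ := σ₁.semistable ψ' L.obj h₂
    obtain ⟨n, hn⟩ := T.phase_congr m L
    refine ⟨r, hr.le, fun _ => hr, hZ.trans ?_⟩
    rw [exp_congr (h₁.symm.trans hn)]

end Twist

end Semistable

end CyclicStab

end

open CategoryTheory CategoryTheory.Limits CategoryTheory.Pretriangulated

noncomputable section

namespace CyclicStab

universe v u w w'

section LiftFiltrations

variable {C : Type u} [Category.{v} C] [HasZeroObject C] [Preadditive C] [HasShift C ℤ]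
  [∀ n : ℤ, (shiftFunctor C n).Additive] [Pretriangulated C]
  {k : Type w} [Field k] [Linear k C] {β : shiftFunctor C (2 : ℤ) ≅ 𝟭 C}
  {Λ : Type w'} [AddCommGroup Λ] {v : K0 C (distTriang C) →+ Λ} {R R₁ : ChargeTriple k β v}

/-! ### Harder-Narasimhan filtrations lift to the `ℤ`-lift -/

/-- An unrolled potential of a diagram with connective base increases by a constant under the
shift. -/
lemma ShiftDiagram.exists_level_potential {D : ShiftDiagram C} {q : RealDecomposition k β}
    (hb : D.base.Connective q) (hu : D.unroll.Liftable q) :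
    ∃ (p : D.unroll.Node → ℝ) (c : ℝ), D.unroll.IsPotential q p ∧
      D.base.IsPotential q (fun x => p ⟨(x.1, 0), x.2⟩) ∧
      ∀ (v w : D.V) (e : D.Edge₁ v w) (i : Fin (D.dec v).n) (j : Fin (D.dec w).n),
        D.comp₁ e i j ∈ q.hom ((D.dec v).summand i) (((D.dec w).summand j).shift 1)
          (p ⟨(w, 0), j⟩ + c - p ⟨(v, 0), i⟩) := by
  obtain ⟨p, hp⟩ := Diagram.liftable_iff_exists_isPotential.1 hu
  obtain ⟨h₀, h₁⟩ := (D.isPotential_unroll_iff p).1 hp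
  have hb₀ : D.base.IsPotential q (fun x => p ⟨(x.1, 0), x.2⟩) := fun v w e i j => h₀ v w e i j 0
  have hb₁ : D.base.IsPotential q (fun x => p ⟨(x.1, 1 + 0), x.2⟩) :=
    fun v w e i j => h₀ v w e i j (1 + 0)
  have hc : ∃ c, ∀ x : D.base.Node, p ⟨(x.1, 1 + 0), x.2⟩ = p ⟨(x.1, 0), x.2⟩ + c := by
    rcases isEmpty_or_nonempty D.base.Node with he | ⟨⟨x₀⟩⟩
    · exact ⟨0, fun x => he.elim x⟩
    · refine ⟨p ⟨(x₀.1, 1 + 0), x₀.2⟩ - p ⟨(x₀.1, 0), x₀.2⟩, fun x => ?_⟩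
      obtain ⟨a, ha⟩ := Diagram.connective_iff.1 hb x₀ x
      have e₀ := ha.degree_eq hb₀
      have e₁ := ha.degree_eq hb₁
      linarith
  obtain ⟨c, hc⟩ := hc
  refine ⟨p, c, hp, hb₀, fun v w e i j => ?_⟩
  have := h₁ v w e i j 0
  rwa [hc ⟨w, j⟩] at this

/-- An indecomposable object has only one summand. -/
lemma Decomposition.isIso_inj (hloc : ∀ E : IndecObj C, IsLocalRing (End E.obj)) {X : C}
    (d : Decomposition X) {E : IndecObj C} (e : X ≅ E.obj) (j : Fin d.n) : IsIso (d.inj j) := by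
  have := hloc E
  have h : 𝟙 E.obj = ∑ j, (e.inv ≫ d.proj j) ≫ d.inj j ≫ e.hom := by
    have : ∑ j, (e.inv ≫ d.proj j) ≫ d.inj j ≫ e.hom =
        e.inv ≫ (∑ j, d.proj j ≫ d.inj j) ≫ e.hom := by
      simp [Preadditive.comp_sum, Preadditive.sum_comp]
    rw [this, d.sum_proj_inj, Category.id_comp, e.inv_hom_id]
  obtain ⟨j₀, -, hj₀⟩ := exists_isIso_of_isIso_sum (X := E.obj) (s := Finset.univ)
    (f := fun j => (e.inv ≫ d.proj j) ≫ d.inj j ≫ e.hom) (h ▸ inferInstance)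
  have := hloc (d.summand j₀)
  have h1 : IsIso (e.inv ≫ d.proj j₀) :=
    isIso_of_isIso_comp E.indecomposable.1 _ (d.inj j₀ ≫ e.hom)
  have h2 : IsIso (d.proj j₀) := IsIso.of_isIso_comp_left e.inv _
  obtain rfl : j = j₀ := by
    by_contra hne
    have h0 : d.inj j = 0 := by
      rw [← cancel_mono (d.proj j₀), d.inj_proj_ne j j₀ hne, zero_comp]
    exact (d.summand j).id_ne_zero (by rw [← d.inj_proj_self, h0, zero_comp])
  have h3 : IsIso (d.inj j ≫ d.proj j) := by
    rw [d.inj_proj_self]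
    infer_instance
  exact IsIso.of_isIso_comp_right _ (d.proj j)

lemma Decomposition.eq_of_indecomposable (hloc : ∀ E : IndecObj C, IsLocalRing (End E.obj)) {X : C}
    (d : Decomposition X) {E : IndecObj C} (e : X ≅ E.obj) (i j : Fin d.n) : i = j := by
  by_contra hne
  have := d.isIso_inj hloc e i
  have h0 : d.proj j = 0 := by
    rw [← cancel_epi (d.inj i), d.inj_proj_ne i j hne, comp_zero]
  exact (d.summand j).id_ne_zero (by rw [← d.inj_proj_self, h0, comp_zero])

lemma Decomposition.exists_index {X : C} (d : Decomposition X) (h : ¬ IsZero X) :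
    Nonempty (Fin d.n) := by
  refine ⟨⟨0, Nat.pos_of_ne_zero fun h0 => h (d.isZero_iff.2 h0)⟩⟩

section Connectivity

variable {E : IndecObj C} {F : Filtration E} {dE : ∀ i, Decomposition (F.obj i)}
  {dQ : ∀ i, Decomposition (F.factor i)} {q : RealDecomposition k β}

lemma Filtration.f_ne_zero_of_connective (hb : (F.diagram dE dQ).base.Connective q) {i i' : Fin F.n}
    (hi : (i : ℕ) + 1 = i') (hn : (i' : ℕ) + 1 = F.n) (h₁ : ¬ IsZero (F.obj i'.succ))
    (h₂ : ¬ IsZero (F.factor i)) : F.f i' ≠ 0 := by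
  intro h0
  obtain ⟨a⟩ := (dE i'.succ).exists_index h₁
  obtain ⟨b⟩ := (dQ i).exists_index h₂
  obtain ⟨d, hd⟩ := Diagram.connective_iff.1 hb ⟨.inl i'.succ, a⟩ ⟨.inr i, b⟩
  let S : Fin (F.n + 1) ⊕ Fin F.n → Prop := fun x => x = .inl i'.succ ∨ x = .inr i'
  have : S (.inl i'.succ) ↔ S (.inr i) := hd.invariant (P := fun x => S x.1) (by
    rintro _ _ e x y hne
    cases e with
    | f l =>
      have hl : l ≠ i' := by
        rintro rfl
        refine hne ?_
        change (dE l.castSucc).inj x ≫ F.f l ≫ (dE l.succ).proj y = 0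
        rw [h0, zero_comp, comp_zero]
      have h1 : (l : ℕ) ≠ i' := fun h => hl (Fin.ext h)
      have h2 := l.2
      change S (.inl l.castSucc) ↔ S (.inl l.succ)
      simp only [S, Sum.inl.injEq, reduceCtorEq, or_false, Fin.ext_iff, Fin.val_castSucc,
        Fin.val_succ]
      omega
    | p l =>
      change S (.inl l.succ) ↔ S (.inr l)
      simp [S])
  simp only [S, true_or, reduceCtorEq, Sum.inr.injEq, false_or, Fin.ext_iff, true_iff] at this
  omega

lemma Filtration.p_ne_zero_of_connective (hb : (F.diagram dE dQ).base.Connective q) {i : Fin F.n}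
    (hn : (i : ℕ) + 1 = F.n) (h₁ : ¬ IsZero (F.obj i.succ)) (h₂ : ¬ IsZero (F.factor i)) :
    F.p i ≠ 0 := by
  intro h0
  obtain ⟨a⟩ := (dE i.succ).exists_index h₁
  obtain ⟨b⟩ := (dQ i).exists_index h₂
  obtain ⟨d, hd⟩ := Diagram.connective_iff.1 hb ⟨.inl i.succ, a⟩ ⟨.inr i, b⟩
  let S : Fin (F.n + 1) ⊕ Fin F.n → Prop := fun x => x = .inr i
  have : S (.inl i.succ) ↔ S (.inr i) := hd.invariant (P := fun x => S x.1) (by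
    rintro _ _ e x y hne
    cases e with
    | f l =>
      change S (.inl l.castSucc) ↔ S (.inl l.succ)
      simp [S]
    | p l =>
      have hl : l ≠ i := by
        rintro rfl
        refine hne ?_
        change (dE l.succ).inj x ≫ F.p l ≫ (dQ l).proj y = 0
        rw [h0, zero_comp, comp_zero]
      change S (.inl l.succ) ↔ S (.inr l)
      simp [S, hl])
  simp [S] at this

end Connectivity

section

variable [Pretriangulated (LiftedObj R)]

/-- The underlying filtration in `C` of a filtration in the `ℤ`-lift. -/
def HNTower.toFiltration {P : ℝ → ObjectProperty (LiftedObj R)} {L : LiftedIndec R}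
    (hT : distTriang (LiftedObj R) = LiftedObj.distinguished R) (t : HNTower P L.lift) :
    Filtration L.obj where
  n := t.n
  obj i := (t.obj i).obj
  factor i := (t.factor i).obj
  f i := (t.f i).1
  p i := (t.p i).1
  t i := (t.t i).1
  distinguished i := (LiftedObj.mem_distinguished_iff _ _ _).1 (hT ▸ t.distinguished i)
  isZero := LiftedObj.isZero_obj t.isZero
  e := (LiftedObj.π R).mapIso t.e

/-- If `X → Y → Z` are morphisms of the `ℤ`-lift which are part of a distinguished triangle in `C`
whose third morphism has no part in the `ℤ`-lift, and `Y` is indecomposable, then one of the two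
morphisms vanishes: in comparison with a cone in the `ℤ`-lift, `Y` has an idempotent. -/
lemma LiftedObj.eq_zero_or_eq_zero (hT : distTriang (LiftedObj R) = LiftedObj.distinguished R)
    {X Y Z : LiftedObj R} {L : LiftedIndec R} [IsLocalRing (End L.lift)] (e : Y ≅ L.lift) (f : X ⟶ Y) (p : Y ⟶ Z)
    (t : Z.obj ⟶ (X⟦(1 : ℤ)⟧).obj)
    (h : Triangle.mk (C := C) (X := X.obj) (Y := Y.obj) (Z := Z.obj) f.1 p.1 t ∈ distTriang C)
    (ht : degZero t = 0) : f = 0 ∨ p = 0 := by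
  obtain ⟨Z', p', t', hT'⟩ := distinguished_cocone_triangle f
  have hT₁ := (mem_distinguished_iff f p' t').1 (hT ▸ hT')
  obtain ⟨w, hw₁, hw₂⟩ : ∃ w : Z.obj ⟶ Z'.obj, p.1 ≫ w = 𝟙 Y.obj ≫ p'.1 ∧
      t ≫ (𝟙 X.obj)⟦(1 : ℤ)⟧' = w ≫ t'.1 :=
    complete_distinguished_triangle_morphism _ _ h hT₁ (𝟙 X.obj) (𝟙 Y.obj)
      (by change f.1 ≫ 𝟙 _ = 𝟙 _ ≫ f.1; simp)
  rw [Category.id_comp] at hw₁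
  rw [CategoryTheory.Functor.map_id] at hw₂
  replace hw₂ : t = w ≫ t'.1 := (Category.comp_id t).symm.trans hw₂
  have hw : IsIso w := by
    let Φ : Triangle.mk (C := C) (X := X.obj) (Y := Y.obj) (Z := Z.obj) f.1 p.1 t ⟶
        Triangle.mk (C := C) (X := X.obj) (Y := Y.obj) (Z := Z'.obj) f.1 p'.1 t'.1 :=
      Triangle.homMk _ _ (𝟙 X.obj) (𝟙 Y.obj) w (by change f.1 ≫ 𝟙 _ = 𝟙 _ ≫ f.1; simp)
        (by change p.1 ≫ w = 𝟙 _ ≫ p'.1; rw [hw₁, Category.id_comp])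
        (by
          change t ≫ (𝟙 X.obj)⟦(1 : ℤ)⟧' = w ≫ t'.1
          rw [CategoryTheory.Functor.map_id]
          exact (Category.comp_id t).trans hw₂)
    exact isIso₃_of_isIso₁₂ Φ h hT₁ (inferInstanceAs (IsIso (𝟙 X.obj)))
      (inferInstanceAs (IsIso (𝟙 Y.obj)))
  have hp : p ≫ degZero w = p' := comp_degZero_eq hw₁
  have h0 : degZero w ≫ t' = 0 := by
    rw [← comp_degZero, ← hw₂, ht]
  obtain ⟨u, hu⟩ : ∃ u : Z ⟶ Y, degZero w = u ≫ p' := Triangle.coyoneda_exact₃ _ hT' _ h0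
  have h1 : IsIso (e.inv ≫ (p ≫ u) ≫ e.hom + e.inv ≫ (𝟙 Y - p ≫ u) ≫ e.hom) := by
    rw [← Preadditive.comp_add, ← Preadditive.add_comp, add_sub_cancel]
    infer_instance
  have hconj : ∀ g : Y ⟶ Y, IsIso (e.inv ≫ g ≫ e.hom) → IsIso g := fun g hg => by
    have := IsIso.of_isIso_comp_left e.inv (g ≫ e.hom)
    exact IsIso.of_isIso_comp_right g e.hom
  have hfp : f ≫ p = 0 := Subtype.ext (comp_distTriang_mor_zero₁₂ _ h)
  rcases isIso_or_isIso_of_isIso_add h1 with h1 | h1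
  · left
    have := hconj _ h1
    rw [← cancel_mono (p ≫ u), reassoc_of% hfp, zero_comp, zero_comp]
  · right
    have := hconj _ h1
    have h2 : (𝟙 Y - p ≫ u) ≫ p' = 0 := by
      rw [Preadditive.sub_comp, Category.assoc, ← hu, hp, Category.id_comp, sub_self]
    have h3 : p' = 0 := by rw [← cancel_epi (𝟙 Y - p ≫ u), h2, comp_zero]
    refine Subtype.ext ?_
    rw [← cancel_mono w, hw₁, h3]
    exact zero_comp.symm

end

end LiftFiltrations

end CyclicStab

end

open CategoryTheory CategoryTheory.Limits CategoryTheory.Pretriangulated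

noncomputable section

namespace CyclicStab

universe v u w w'

section LiftTowers

variable {C : Type u} [Category.{v} C] [HasZeroObject C] [Preadditive C] [HasShift C ℤ]
  [∀ n : ℤ, (shiftFunctor C n).Additive] [Pretriangulated C]
  {k : Type w} [Field k] [Linear k C] {β : shiftFunctor C (2 : ℤ) ≅ 𝟭 C}
  {Λ : Type w'} [AddCommGroup Λ] {v : K0 C (distTriang C) →+ Λ} {R : ChargeTriple k β v}

variable [Pretriangulated (LiftedObj R)]

lemma HNTower.toFiltration_isomorphic {P : ℝ → ObjectProperty (LiftedObj R)}
    (hT : distTriang (LiftedObj R) = LiftedObj.distinguished R) (hP : IsPreslicing P)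
    {L : LiftedIndec R} (s t : HNTower P L.lift) :
    (s.toFiltration hT).Isomorphic (t.toFiltration hT) := by
  obtain ⟨h, a, b, h₁, h₂, h₃, h₄⟩ := s.unique hP t
  refine ⟨h, fun i => (LiftedObj.π R).mapIso (a i), fun i => (LiftedObj.π R).mapIso (b i),
    fun i => congrArg Subtype.val (h₁ i), fun i => congrArg Subtype.val (h₂ i),
    fun i => congrArg Subtype.val (h₃ i), ?_⟩
  have h₅ := congrArg Subtype.val h₄
  refine Eq.trans ?_ h₅
  have key : ∀ {i j : Fin (t.n + 1)} (h : i = j), (eqToHom (congrArg t.obj h) : t.obj i ⟶ t.obj j).1 =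
      eqToHom (congrArg (t.toFiltration hT).obj h) := by
    rintro i _ rfl
    rfl
  exact (congrArg (fun g => (a (Fin.last s.n)).hom.1 ≫ g ≫ t.e.hom.1)
    (key (i := Fin.cast (congrArg (· + 1) h) (Fin.last s.n)) (j := Fin.last t.n)
      (Fin.ext h))).symm

/-- Adjacent values decide whether a function on `Fin n` is strictly decreasing. -/
lemma strictAnti_of_adjacent {n : ℕ} {φ : Fin n → ℝ}
    (h : ∀ i i' : Fin n, (i : ℕ) + 1 = i' → φ i' < φ i) : StrictAnti φ := by
  cases n with
  | zero => exact fun i => i.elim0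
  | succ n => exact Fin.strictAnti_iff_succ_lt.2 fun i => h _ _ (by simp)

variable {σ₁ : StabilityCondition k β v} (T : Twist R σ₁.toChargeTriple) (m : ℤ)

/-- Every Harder-Narasimhan filtration of `E` with respect to a stability condition in the
deformation class is the image of a Harder-Narasimhan filtration of `(E, θ)` in the `ℤ`-lift. The
potential of its diagram provides the phases; that the shift increases it by `1` follows from
`LiftedObj.eq_zero_or_eq_zero`. -/
theorem Twist.exists_tower (hKS : IsKrullSchmidt C)
    (hT : distTriang (LiftedObj R) = LiftedObj.distinguished R) (L : LiftedIndec R)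
    (F : Filtration L.obj) (hF : F.IsHarderNarasimhan σ₁.q σ₁.Q) :
    ∃ t : HNTower (T.pull m) L.lift, t.toFiltration hT = F := by
  obtain ⟨dE, dQ, he, hb, -, hu, hQ, hc⟩ := hF
  have hlast : ¬ IsZero (F.obj (Fin.last F.n)) := fun h =>
    L.obj.indecomposable.1 (h.of_iso F.e.symm)
  have hn : 0 < F.n := by
    refine Nat.pos_of_ne_zero fun h0 => hlast ?_
    rw [show Fin.last F.n = 0 from Fin.ext h0]
    exact F.isZero
  obtain ⟨jl⟩ := (dE (Fin.last F.n)).exists_index hlast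
  obtain ⟨p, c, hp, hb₀, hp₁⟩ := ShiftDiagram.exists_level_potential hb hu
  -- The identification of the last object with `E` has degree zero.
  let El : IndecObj C := (dE (Fin.last F.n)).summand jl
  have hiso : IsIso ((dE (Fin.last F.n)).inj jl) := Decomposition.isIso_inj hKS.2 _ F.e jl
  let e' : El.obj ≅ L.obj.obj := asIso ((dE (Fin.last F.n)).inj jl) ≪≫ F.e
  have hηl : T.η El = T.η L.obj := T.η_eq_of_iso hKS.2 e'
  have he' : e'.hom ∈ R.q.hom El L.obj 0 := by
    obtain ⟨a, ha⟩ := he jl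
    have h0 : a = 0 := σ₁.q.degree_iso (E := El) (F := L.obj) (Iso.isIso_hom e') ha
    rw [h0] at ha
    have := T.mem_iff'.1 ha
    rwa [show 0 - T.η L.obj + T.η ((dE (Fin.last F.n)).summand jl) = 0 by
      rw [← hηl]; ring] at this
  -- The phases of the summands are given by the potential, normalized at `E`.
  let u : (F.diagram dE dQ).base.Node → ℝ := fun x => p ⟨(x.1, 0), x.2⟩
  let xl : (F.diagram dE dQ).base.Node := ⟨.inl (Fin.last F.n), jl⟩
  let s : ℝ := L.phase + T.η L.obj - u xl
  let θ : (F.diagram dE dQ).base.Node → ℝ := fun x =>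
    u x - T.η ((F.diagram dE dQ).base.summand x) + s
  have hspec : ∀ x, ∃ m : ℤ, θ x = R.phase ((F.diagram dE dQ).base.summand x) + 2 * m := by
    intro x
    obtain ⟨a, l, hl⟩ := Diagram.connective_iff.1 hb xl x
    have h1 : a = u x - u xl := hb₀.degree_eq l hl
    obtain ⟨m₁, hm₁⟩ := (T.hasDegree_iff'.1 hl).phase
    obtain ⟨m₂, hm₂⟩ := L.phase_spec
    obtain ⟨m₃, hm₃⟩ := R.phase_of_iso e' he'
    have e₁ : (F.diagram dE dQ).base.summand xl = El := rfl
    rw [e₁] at hm₁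
    refine ⟨m₁ + m₂ + m₃, ?_⟩
    simp only [θ, s]
    push_cast
    linarith
  have hmem : ∀ (x y : (F.diagram dE dQ).base.Node) (f : ((F.diagram dE dQ).base.summand x).obj ⟶
      ((F.diagram dE dQ).base.summand y).obj), f ∈ σ₁.q.hom _ _ (u y - u x) →
      f ∈ R.q.hom _ _ (θ y - θ x) := by
    intro x y f hf
    have := T.mem_iff'.1 hf
    rwa [show θ y - θ x = u y - u x - T.η ((F.diagram dE dQ).base.summand y) +
      T.η ((F.diagram dE dQ).base.summand x) by simp only [θ]; ring]
  let E' : Fin (F.n + 1) → LiftedObj R := fun i =>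
    ⟨F.obj i, dE i, fun j => θ ⟨.inl i, j⟩, fun j => hspec ⟨.inl i, j⟩⟩
  let Q' : Fin F.n → LiftedObj R := fun i =>
    ⟨F.factor i, dQ i, fun j => θ ⟨.inr i, j⟩, fun j => hspec ⟨.inr i, j⟩⟩
  let f' : ∀ i : Fin F.n, E' i.castSucc ⟶ E' i.succ := fun i => ⟨F.f i, fun a b =>
    hmem ⟨.inl i.castSucc, a⟩ ⟨.inl i.succ, b⟩ _ (hb₀ _ _ (.f i) a b)⟩
  let p' : ∀ i : Fin F.n, E' i.succ ⟶ Q' i := fun i => ⟨F.p i, fun a b =>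
    hmem ⟨.inl i.succ, a⟩ ⟨.inr i, b⟩ _ (hb₀ _ _ (.p i) a b)⟩
  have ht' : ∀ (i : Fin F.n) (a : Fin (dQ i).n) (b : Fin (dE i.castSucc).n),
      (dQ i).inj a ≫ F.t i ≫ ((dE i.castSucc).proj b)⟦(1 : ℤ)⟧' ∈
        R.q.hom ((dQ i).summand a) (((dE i.castSucc).summand b).shift 1)
          (θ ⟨.inl i.castSucc, b⟩ + c - θ ⟨.inr i, a⟩) := by
    intro i a b
    have h1 : (dQ i).inj a ≫ F.t i ≫ ((dE i.castSucc).proj b)⟦(1 : ℤ)⟧' ∈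
        σ₁.q.hom ((dQ i).summand a) (((dE i.castSucc).summand b).shift 1)
          (u ⟨.inl i.castSucc, b⟩ + c - u ⟨.inr i, a⟩) := hp₁ _ _ (.t i) a b
    have h2 := T.mem_iff'.1 h1
    rw [T.shift_one] at h2
    refine DecTriangle.mem_of_eq h2 ?_ rfl
    change _ = u ⟨.inl i.castSucc, b⟩ - T.η ((dE i.castSucc).summand b) + s + c -
      (u ⟨.inr i, a⟩ - T.η ((dQ i).summand a) + s)
    ring
  have hE'l : ∃ e : E' (Fin.last F.n) ≅ L.lift, e.hom.1 = F.e.hom := by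
    let e₁ : E' (Fin.last F.n) ⟶ L.lift := ⟨F.e.hom, fun j j' => by
      have hj : j = jl := Decomposition.eq_of_indecomposable hKS.2 (dE (Fin.last F.n)) F.e _ _
      rw [hj]
      refine DecTriangle.mem_of_eq he' ?_ ?_
      · change 0 = L.phase - (u xl - T.η El + s)
        simp only [s]
        rw [hηl]
        ring
      · change (dE (Fin.last F.n)).inj jl ≫ F.e.hom ≫ 𝟙 _ = _
        rw [Category.comp_id]
        rfl⟩
    have : IsIso e₁.1 := Iso.isIso_hom F.e
    have := LiftedObj.isIso_of_isIso_val e₁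
    exact ⟨asIso e₁, rfl⟩
  obtain ⟨el, hel⟩ := hE'l
  have hc₁ : 1 < F.n → c = 1 := by
    intro hn₁
    by_contra hc1
    let i : Fin F.n := ⟨F.n - 2, by omega⟩
    let i' : Fin F.n := ⟨F.n - 1, by omega⟩
    have hi : (i : ℕ) + 1 = i' := by simp only [i, i']; omega
    have hi' : (i' : ℕ) + 1 = F.n := by simp only [i']; omega
    have hi'l : i'.succ = Fin.last F.n := Fin.ext hi'
    have := LiftedObj.isLocalRing_end_lift hKS.2 L
    have h0 := LiftedObj.eq_zero_or_eq_zero hT (eqToIso (congrArg E' hi'l) ≪≫ el) (f' i') (p' i')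
      (F.t i') (F.distinguished i') (LiftedObj.degZero_eq_zero fun a b => ⟨_, ?_, ht' i' a b⟩)
    · have hz : ¬ IsZero (F.obj i'.succ) := by rw [hi'l]; exact hlast
      rcases h0 with h0 | h0
      · exact Filtration.f_ne_zero_of_connective hb hi hi' hz (hQ i).1 (congrArg Subtype.val h0)
      · exact Filtration.p_ne_zero_of_connective hb hi' hz (hQ i').1 (congrArg Subtype.val h0)
    · change _ ≠ θ ⟨.inl i'.castSucc, b⟩ + ((1 : ℤ) : ℝ) - θ ⟨.inr i', a⟩
      intro h
      apply hc1
      push_cast at h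
      linarith
  let t' : ∀ i : Fin F.n, Q' i ⟶ (E' i.castSucc)⟦(1 : ℤ)⟧ := fun i => ⟨F.t i, fun a b => by
    rcases Nat.lt_or_ge 1 F.n with h1 | h1
    · refine DecTriangle.mem_of_eq (ht' i a b) ?_ rfl
      rw [hc₁ h1]
      change _ = θ ⟨.inl i.castSucc, b⟩ + ((1 : ℤ) : ℝ) - θ ⟨.inr i, a⟩
      push_cast
      ring
    · have hi : i.castSucc = 0 := Fin.ext (by have := i.2; simp; omega)
      have hz : (dE i.castSucc).n = 0 := (dE i.castSucc).isZero_iff.1 (by rw [hi]; exact F.isZero)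
      exact absurd (show (b : ℕ) < (dE i.castSucc).n from b.2) (by omega)⟩
  have hstep : ∀ i i' : Fin F.n, (i : ℕ) + 1 = i' → ∃ d : ℝ, d < 0 ∧
      ∀ j j', u ⟨.inr i', j'⟩ - u ⟨.inr i, j⟩ = d := by
    intro i i' hi
    obtain ⟨d, hd, h⟩ := hc i i' hi
    refine ⟨d, hd, fun j j' => ?_⟩
    obtain ⟨⟨l, hl, a, ha⟩, h⟩ := h j j'
    exact (hp.degree_eq l ha).symm.trans (h l hl a ha)
  have hconst : ∀ i j j', u ⟨.inr i, j⟩ = u ⟨.inr i, j'⟩ := by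
    intro i j j'
    rcases Nat.lt_or_ge (i + 1) F.n with h1 | h1
    · obtain ⟨d, -, hd⟩ := hstep i ⟨i + 1, h1⟩ rfl
      obtain ⟨j₁⟩ := (dQ ⟨i + 1, h1⟩).exists_index (hQ _).1
      have e₁ := hd j j₁
      have e₂ := hd j' j₁
      linarith
    · rcases Nat.eq_zero_or_pos (i : ℕ) with h0 | h0
      · have hi : i.castSucc = 0 := Fin.ext h0
        have hil : i.succ = Fin.last F.n := Fin.ext (by have := i.2; simp; omega)
        have hz : IsZero (F.obj i.castSucc) := by rw [hi]; exact F.isZero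
        have : IsIso (F.p i) := (Pretriangulated.Triangle.distinguished_iff_of_isZero₁
          (Triangle.mk (F.f i) (F.p i) (F.t i)) hz).1 (F.distinguished i)
        rw [(dQ i).eq_of_indecomposable hKS.2
          ((asIso (F.p i)).symm ≪≫ eqToIso (congrArg F.obj hil) ≪≫ F.e) j j']
      · obtain ⟨d, -, hd⟩ := hstep ⟨i - 1, by omega⟩ i (by simp only; omega)
        obtain ⟨j₁⟩ := (dQ ⟨i - 1, by omega⟩).exists_index (hQ _).1
        have e₁ := hd j₁ j
        have e₂ := hd j₁ j'
        linarith
  have j₀ : ∀ i, Fin (dQ i).n := fun i => ((dQ i).exists_index (hQ i).1).some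
  refine ⟨⟨F.n, E', Q', f', p', t', fun i => ?_, ?_, el, fun i => u ⟨.inr i, j₀ i⟩ + s + 2 * m,
    strictAnti_of_adjacent fun i i' hi => ?_, fun i j => ⟨?_, ?_⟩, fun i hi => ?_⟩, ?_⟩
  · rw [hT, LiftedObj.mem_distinguished_iff]
    exact F.distinguished i
  · rw [LiftedObj.isZero_iff]
    exact (dE 0).isZero_iff.1 F.isZero
  · obtain ⟨d, hd, h⟩ := hstep i i' hi
    have := h (j₀ i) (j₀ i')
    linarith
  · change u ⟨.inr i, j⟩ - T.η ((dQ i).summand j) + s + T.η ((dQ i).summand j) + 2 * m = _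
    rw [hconst i j (j₀ i)]
    ring
  · obtain ⟨ψ, hψ⟩ := (hQ i).2
    refine ⟨ψ, StabilityCondition.mem_of_retract hKS hψ ((dQ i).inj j) ((dQ i).proj j) ?_⟩
    rw [(dQ i).inj_proj_self]
    exact inferInstanceAs (IsIso (𝟙 _))
  · exact (hQ i).1 (LiftedObj.isZero_obj hi)
  · have : (LiftedObj.π R).mapIso el = F.e := Iso.ext hel
    exact congrArg (fun e => (⟨F.n, F.obj, F.factor, F.f, F.p, F.t, F.distinguished, F.isZero, e⟩ :
      Filtration L.obj)) this

end LiftTowers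

end CyclicStab

end

open CategoryTheory CategoryTheory.Limits CategoryTheory.Pretriangulated

noncomputable section

namespace CyclicStab

universe v u w w'

section Pullback

variable {C : Type u} [Category.{v} C] [HasZeroObject C] [Preadditive C] [HasShift C ℤ]
  [∀ n : ℤ, (shiftFunctor C n).Additive] [Pretriangulated C]
  {k : Type w} [Field k] [Linear k C] {β : shiftFunctor C (2 : ℤ) ≅ 𝟭 C}
  {Λ : Type w'} [AddCommGroup Λ] {v : K0 C (distTriang C) →+ Λ} {R : ChargeTriple k β v}

/-! ### Pullbacks of stability conditions -/

lemma LiftedObj.π₀_of (X : LiftedObj R) :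
    LiftedObj.π₀ R (K0.of (LiftedObj.distinguished R) X) = K0.of (distTriang C) X.obj := by
  change QuotientAddGroup.mk' _ (FreeAbelianGroup.map (LiftedObj.π R).obj (.of X)) = _
  rw [FreeAbelianGroup.map_of_apply]
  rfl

section Bridgeland

variable {σ₁ : StabilityCondition k β v} {τ : LiftedStability R}

/-- All equivalences of `ℤ`-lifts being translates of the one given by a twist, so are the
pullbacks of a stability condition. -/
lemma LiftedStability.isPullback_iff {T : Twist R σ₁.toChargeTriple} {m : ℤ}
    {H : LiftEquivalence R σ₁.toChargeTriple} (hH : ∀ X, H.h X = X.phase + T.η X.obj + 2 * m) :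
    τ.IsPullback σ₁ H ↔ τ.Z = σ₁.Z.comp (LiftedObj.π₀ R) ∧ τ.P = T.pull m := by
  refine and_congr_right fun _ => ⟨fun h => ?_, fun h ψ X => ?_⟩
  · ext ψ X
    rw [h, T.pull_iff]
    simp only [hH]
    rfl
  · rw [h, T.pull_iff]
    simp only [hH]
    rfl

lemma LiftedStability.exists_isPullback_iff (T : Twist R σ₁.toChargeTriple)
    (hR : R.q.Connective) : (∃ H, τ.IsPullback σ₁ H) ↔
      τ.Z = σ₁.Z.comp (LiftedObj.π₀ R) ∧ ∃ m : ℤ, τ.P = T.pull m := by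
  constructor
  · rintro ⟨H, h⟩
    obtain ⟨m, hm⟩ := H.exists_eq T hR
    obtain ⟨h₁, h₂⟩ := (isPullback_iff hm).1 h
    exact ⟨h₁, m, h₂⟩
  · rintro ⟨h₁, m, h₂⟩
    exact ⟨T.equivalence m, (isPullback_iff fun _ => rfl).2 ⟨h₁, h₂⟩⟩

variable (τ) in
lemma LiftedStability.isPreslicing : IsPreslicing τ.P where
  iso_mem e h := τ.iso_mem _ _ _ e h
  zero_mem φ X h := τ.zero_mem φ X h
  sum_mem s hX hY := τ.sum_mem _ _ _ s.toBicone s.isBilimit_toBicone.some hX hY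
  shift := τ.shift
  hom_eq_zero h _ _ hX hY f := τ.hom_eq_zero _ _ h _ _ hX hY f

variable [Pretriangulated (LiftedObj R)]

variable (τ) in
lemma LiftedStability.hasHN (hT : distTriang (LiftedObj R) = LiftedObj.distinguished R)
    (X : LiftedObj R) : HasHN τ.P X := by
  by_cases hX : IsZero X
  · exact .of_isZero hX
  obtain ⟨n, φ, E, A, f, p, t, hφ, hE, ⟨e⟩, h⟩ := τ.harderNarasimhan X hX
  exact (HasHN.of_fin hφ hE fun i => by rw [hT]; exact h i).of_iso e

lemma HNTower.hasHN {P : ℝ → ObjectProperty (LiftedObj R)} {X : LiftedObj R} (t : HNTower P X) :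
    HasHN P X :=
  (HasHN.of_fin t.phase_anti t.isZero fun i => ⟨t.distinguished i, t.mem i⟩).of_iso t.e

lemma Twist.hasHN (T : Twist R σ₁.toChargeTriple) (m : ℤ) (hKS : IsKrullSchmidt C)
    (hT : distTriang (LiftedObj R) = LiftedObj.distinguished R) (X : LiftedObj R) :
    HasHN (T.pull m) X := by
  have hP := T.pull_isPreslicing m hKS.2
  induction X using LiftedObj.induction with
  | zero X hX => exact .of_isZero hX
  | sum X Y Z s hX hY => exact hX.sum hP hY s
  | single L =>
    obtain ⟨F, hF⟩ := σ₁.harderNarasimhan L.obj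
    obtain ⟨t, -⟩ := T.exists_tower m hKS hT L F hF
    exact t.hasHN

/-- Stability conditions in the deformation class can be pulled back to the `ℤ`-lift. -/
theorem Twist.exists_liftedStability (T : Twist R σ₁.toChargeTriple) (m : ℤ)
    (hKS : IsKrullSchmidt C) (hT : distTriang (LiftedObj R) = LiftedObj.distinguished R) :
    ∃ τ : LiftedStability R, τ.Z = σ₁.Z.comp (LiftedObj.π₀ R) ∧ τ.P = T.pull m := by
  have hP := T.pull_isPreslicing m hKS.2
  refine ⟨{
    Z := σ₁.Z.comp (LiftedObj.π₀ R)
    factors := ?_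
    P := T.pull m
    iso_mem := fun _ _ _ e h => hP.iso_mem e h
    zero_mem := fun φ _ h => hP.zero_mem φ h
    sum_mem := fun φ X Y b hb hX hY => hP.sum_mem (X := X) (Y := Y)
      ⟨b.inl, b.inr, b.fst, b.snd, b.inl_fst, b.inl_snd, b.inr_fst, b.inr_snd, Limits.IsBilimit.binary_total hb⟩
      hX hY
    charge := fun φ X h hX => ?_
    shift := hP.shift
    hom_eq_zero := fun _ _ h _ _ hX hY f => hP.hom_eq_zero h hX hY f
    harderNarasimhan := fun X _ => ?_ }, rfl, rfl⟩
  · obtain ⟨g, hg⟩ := σ₁.factors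
    exact ⟨g, by rw [hg, AddMonoidHom.comp_assoc]⟩
  · obtain ⟨r, -, hr, hZ⟩ := T.pull_charge m hKS.2 h
    refine ⟨r, hr hX, ?_⟩
    rw [AddMonoidHom.comp_apply, LiftedObj.π₀_of, hZ]
  · obtain ⟨L, hL, h⟩ := T.hasHN m hKS hT X
    obtain ⟨n, φ, E, hφ, -, hE, hEn, h⟩ := h.exists_fin hL
    choose A f p t h using h
    exact ⟨n, φ, E, A, f, p, t, hφ, hE, ⟨eqToIso hEn⟩, hT ▸ h⟩

/-- Harder-Narasimhan filtrations with respect to two stability conditions with the same pullback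
are isomorphic, by uniqueness in the `ℤ`-lift. -/
theorem Twist.isomorphic {σ₂ : StabilityCondition k β v} (T₁ : Twist R σ₁.toChargeTriple)
    (T₂ : Twist R σ₂.toChargeTriple) (m₁ m₂ : ℤ) (h : T₁.pull m₁ = T₂.pull m₂)
    (hKS : IsKrullSchmidt C) (hT : distTriang (LiftedObj R) = LiftedObj.distinguished R)
    {E : IndecObj C} {F G : Filtration E} (hF : F.IsHarderNarasimhan σ₁.q σ₁.Q)
    (hG : G.IsHarderNarasimhan σ₂.q σ₂.Q) : F.Isomorphic G := by
  let L : LiftedIndec R := ⟨E, R.phase E, 0, by simp⟩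
  obtain ⟨s, rfl⟩ := T₁.exists_tower m₁ hKS hT L F hF
  obtain ⟨t, rfl⟩ := T₂.exists_tower m₂ hKS hT L G hG
  revert t
  rw [← h]
  intro t _
  exact HNTower.toFiltration_isomorphic hT (T₁.pull_isPreslicing m₁ hKS.2) s t

lemma Twist.good (T : Twist R σ₁.toChargeTriple) (hKS : IsKrullSchmidt C)
    (hT : distTriang (LiftedObj R) = LiftedObj.distinguished R) : σ₁.Good :=
  fun _ _ _ hF hG => T.isomorphic T 0 0 rfl hKS hT hF hG

end Bridgeland

end Pullback

end CyclicStab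

end

open CategoryTheory CategoryTheory.Limits CategoryTheory.Pretriangulated

noncomputable section

namespace CyclicStab

universe v u w w'

section TowerDiagrams

variable {C : Type u} [Category.{v} C] [HasZeroObject C] [Preadditive C] [HasShift C ℤ]
  [∀ n : ℤ, (shiftFunctor C n).Additive] [Pretriangulated C]
  {k : Type w} [Field k] [Linear k C] {β : shiftFunctor C (2 : ℤ) ≅ 𝟭 C}
  {Λ : Type w'} [AddCommGroup Λ] {v : K0 C (distTriang C) →+ Λ} {R : ChargeTriple k β v}


/-! ### Harder-Narasimhan diagrams of filtrations in the `ℤ`-lift -/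

namespace Diagram

variable {D : Diagram C} {q : RealDecomposition k β}

lemma Path.exists_suffix {x y : D.Node} (l : D.Path x y) (h : l.toZigzag.IsConnecting q)
    {z : D.Node} (hz : z ∈ l.nodes) :
    ∃ l' : D.Path z y, l'.nodes.Sublist l.nodes ∧ l'.toZigzag.IsConnecting q := by
  induction l with
  | nil x =>
    obtain rfl : z = x := List.mem_singleton.1 hz
    exact ⟨.nil _, List.Sublist.refl _, h⟩
  | fwd e i j l ih =>
    rcases List.mem_cons.1 hz with rfl | hz
    · exact ⟨.fwd e i j l, List.Sublist.refl _, h⟩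
    · obtain ⟨a, hf, c, d, hc, hd, rfl⟩ := h
      obtain ⟨l', h₁, h₂⟩ := ih ⟨d, hd⟩ hz
      exact ⟨l', h₁.trans (List.sublist_cons_self _ _), h₂⟩
  | bwd e i j l ih =>
    rcases List.mem_cons.1 hz with rfl | hz
    · exact ⟨.bwd e i j l, List.Sublist.refl _, h⟩
    · obtain ⟨a, hf, c, d, hc, hd, rfl⟩ := h
      obtain ⟨l', h₁, h₂⟩ := ih ⟨d, hd⟩ hz
      exact ⟨l', h₁.trans (List.sublist_cons_self _ _), h₂⟩

/-- Erasure of loops from a connecting path. -/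
lemma Joined.exists_isSimple {x y : D.Node} {a : ℝ} (h : D.Joined q x y a) :
    ∃ l : D.Path x y, l.IsSimple ∧ l.toZigzag.IsConnecting q := by
  obtain ⟨l, hl⟩ := h
  induction l generalizing a with
  | nil x => exact ⟨.nil x, List.nodup_singleton _, a, hl⟩
  | @fwd v w z e i j l ih =>
    obtain ⟨hf, c, d, hc, hd, rfl⟩ := hl
    obtain ⟨l', h₁, h₂⟩ := ih hd
    by_cases hx : ⟨v, i⟩ ∈ l'.nodes
    · obtain ⟨l'', h₃, h₄⟩ := l'.exists_suffix h₂ hx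
      exact ⟨l'', h₃.nodup h₁, h₄⟩
    · obtain ⟨d', hd'⟩ := h₂
      exact ⟨.fwd e i j l', List.nodup_cons.2 ⟨hx, h₁⟩, c + d', hf, c, d', hc, hd', rfl⟩
  | @bwd v w z e i j l ih =>
    obtain ⟨hf, c, d, hc, hd, rfl⟩ := hl
    obtain ⟨l', h₁, h₂⟩ := ih hd
    by_cases hx : ⟨w, j⟩ ∈ l'.nodes
    · obtain ⟨l'', h₃, h₄⟩ := l'.exists_suffix h₂ hx
      exact ⟨l'', h₃.nodup h₁, h₄⟩
    · obtain ⟨d', hd'⟩ := h₂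
      exact ⟨.bwd e i j l', List.nodup_cons.2 ⟨hx, h₁⟩, -c + d', hf, c, d', hc, hd', rfl⟩

end Diagram

/-- The base of a shift diagram is contained in its unrolled diagram. -/
lemma ShiftDiagram.joined_unroll {D : ShiftDiagram C} {q : RealDecomposition k β}
    {x y : D.base.Node} {a : ℝ} (h : D.base.Joined q x y a) :
    D.unroll.Joined q ⟨(x.1, 0), x.2⟩ ⟨(y.1, 0), y.2⟩ a := by
  have hne : ∀ {v w : D.V} (e : D.Edge v w) (i : Fin (D.dec v).n) (j : Fin (D.dec w).n),
      D.base.comp e i j ≠ 0 →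
        D.unroll.comp (v := (v, 0)) (w := (w, 0)) (.zero e 0) i j ≠ 0 := by
    intro v w e i j h h0
    rw [unroll_comp_zero] at h0
    exact h ((shiftFunctor C (0 : ℤ)).map_injective (h0.trans (Functor.map_zero _ _ _).symm))
  have hmem : ∀ {v w : D.V} (e : D.Edge v w) (i : Fin (D.dec v).n) (j : Fin (D.dec w).n) (b : ℝ),
      D.base.comp e i j ∈ q.hom _ _ b →
        D.unroll.comp (v := (v, 0)) (w := (w, 0)) (.zero e 0) i j ∈ q.hom _ _ b := by
    intro v w e i j b h
    rw [unroll_comp_zero]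
    exact q.shift_mem 0 h
  obtain ⟨l, hl⟩ := h
  induction l generalizing a with
  | nil x => exact ⟨.nil _, hl⟩
  | fwd e i j l ih =>
    obtain ⟨hf, c, d, hc, hd, rfl⟩ := hl
    obtain ⟨l', hl'⟩ := ih hd
    exact ⟨@Diagram.Path.fwd _ _ _ _ _ _ _ D.unroll (_, 0) (_, 0) _
      (ShiftDiagram.UnrolledEdge.zero e 0) i j l', hne e i j hf, c, d, hmem e i j c hc, hl', rfl⟩
  | bwd e i j l ih =>
    obtain ⟨hf, c, d, hc, hd, rfl⟩ := hl
    obtain ⟨l', hl'⟩ := ih hd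
    exact ⟨@Diagram.Path.bwd _ _ _ _ _ _ _ D.unroll (_, 0) (_, 0) _
      (ShiftDiagram.UnrolledEdge.zero e 0) i j l', hne e i j hf, c, d, hmem e i j c hc, hl', rfl⟩

lemma Twist.joined {R₁ : ChargeTriple k β v} (T : Twist R R₁) {D : Diagram C} {x y : D.Node}
    {a : ℝ} (h : D.Joined R.q x y a) : ∃ b, D.Joined R₁.q x y b := by
  obtain ⟨l, hl⟩ := h
  exact ⟨_, l, T.hasDegree_iff.1 hl⟩

namespace LiftedObj

variable {X Y : LiftedObj R}

lemma exists_entry_ne_zero_of_incl {f : X ⟶ Y} {i : Fin X.dec.n} (h : X.incl i ≫ f ≠ 0) :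
    ∃ j, X.dec.inj i ≫ f.1 ≫ Y.dec.proj j ≠ 0 := by
  by_contra! hc
  refine h (Y.sumData.hom_ext' fun j => ?_)
  rw [zero_comp, Category.assoc]
  exact incl_comp_pr_eq_zero (hc j)

lemma exists_entry_ne_zero_of_pr {f : X ⟶ Y} {j : Fin Y.dec.n} (h : f ≫ Y.pr j ≠ 0) :
    ∃ i, X.dec.inj i ≫ f.1 ≫ Y.dec.proj j ≠ 0 := by
  by_contra! hc
  refine h (X.sumData.hom_ext fun i => ?_)
  rw [comp_zero]
  exact incl_comp_pr_eq_zero (hc i)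

lemma incl_pr (X : LiftedObj R) (i : Fin X.dec.n) : X.incl i ≫ X.pr i = 𝟙 _ :=
  X.sumData.inj_proj_self i

lemma incl_ne_zero (X : LiftedObj R) (i : Fin X.dec.n) : X.incl i ≠ 0 := fun h =>
  (X.summand i).not_isZero ((IsZero.iff_id_eq_zero _).2 (by rw [← X.incl_pr, h, zero_comp]))

lemma pr_ne_zero (X : LiftedObj R) (i : Fin X.dec.n) : X.pr i ≠ 0 := fun h =>
  (X.summand i).not_isZero ((IsZero.iff_id_eq_zero _).2 (by rw [← X.incl_pr, h, comp_zero]))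

end LiftedObj

namespace HNTower

variable [Pretriangulated (LiftedObj R)] {P : ℝ → ObjectProperty (LiftedObj R)}

/-- No summand of `E_{i-1}` maps to zero in `E_i`, as there are no morphisms from `E_{i-1}` to
`Q_i[-1]`. -/
lemma incl_comp_f_ne_zero (hP : IsPreslicing P) {X : LiftedObj R} (t : HNTower P X) (i : Fin t.n)
    (a : Fin (t.obj i.castSucc).dec.n) : (t.obj i.castSucc).incl a ≫ t.f i ≠ 0 := by
  intro h0
  have h1 : (t.obj i.castSucc).pr a ≫ (t.obj i.castSucc).incl a = 0 :=
    hP.eq_of_comp_mor₁ (t.distinguished i) (t.mem i) (t.above hP i) (by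
      rw [Category.assoc, h0, comp_zero, zero_comp])
  refine (t.obj i.castSucc).incl_ne_zero a ?_
  rw [← Category.id_comp ((t.obj i.castSucc).incl a), ← LiftedObj.incl_pr, Category.assoc, h1,
    comp_zero]

/-- No projection of `Q_i` to a summand vanishes on `E_i`. -/
lemma p_comp_pr_ne_zero (hP : IsPreslicing P) {X : LiftedObj R} (t : HNTower P X) (i : Fin t.n)
    (b : Fin (t.factor i).dec.n) : t.p i ≫ (t.factor i).pr b ≠ 0 := by
  intro h0
  obtain ⟨r, hr⟩ : ∃ r : (t.obj i.castSucc)⟦(1 : ℤ)⟧ ⟶ ((t.factor i).summand b).lift,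
      (t.factor i).pr b = t.t i ≫ r :=
    Triangle.yoneda_exact₃ _ (t.distinguished i) ((t.factor i).pr b) h0
  have h1 : r ≫ (t.factor i).incl b = 0 :=
    hP.above_shift (t.above hP i) (t.phase i) (by linarith) _ (t.mem i) _
  refine (t.factor i).pr_ne_zero b ?_
  rw [hr, ← Category.comp_id r, ← LiftedObj.incl_pr, reassoc_of% h1, zero_comp, comp_zero]

variable {L : LiftedIndec R} (hT : distTriang (LiftedObj R) = LiftedObj.distinguished R)
  (t : HNTower P L.lift)

/-- The Harder-Narasimhan diagram of a filtration in the `ℤ`-lift. -/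
abbrev diagram : ShiftDiagram C :=
  (t.toFiltration hT).diagram (fun i => (t.obj i).dec) fun i => (t.factor i).dec

/-- The phases of the summands of the objects of a filtration in the `ℤ`-lift. -/
def nodePhase : (t.diagram hT).base.Node → ℝ
  | ⟨.inl i, j⟩ => (t.obj i).phase j
  | ⟨.inr i, j⟩ => (t.factor i).phase j

lemma isPotential_nodePhase : (t.diagram hT).base.IsPotential R.q (t.nodePhase hT) := by
  intro v w e
  cases e with
  | f i => exact (t.f i).2
  | p i => exact (t.p i).2

lemma comp₁_mem {v w : (t.diagram hT).V} (e : (t.diagram hT).Edge₁ v w)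
    (i : Fin ((t.diagram hT).dec v).n) (j : Fin ((t.diagram hT).dec w).n) :
    (t.diagram hT).comp₁ e i j ∈ R.q.hom (((t.diagram hT).dec v).summand i)
      ((((t.diagram hT).dec w).summand j).shift 1)
      (t.nodePhase hT ⟨w, j⟩ + 1 - t.nodePhase hT ⟨v, i⟩) := by
  cases e with
  | t l =>
    refine DecTriangle.mem_of_eq ((t.t l).2 i j) ?_ rfl
    change (t.obj l.castSucc).phase j + ((1 : ℤ) : ℝ) - (t.factor l).phase i =
      (t.obj l.castSucc).phase j + 1 - (t.factor l).phase i
    push_cast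
    rfl

/-- The diagram of a Harder-Narasimhan filtration in the `ℤ`-lift is connective: by descending
induction, all summands are joined to the last object. -/
lemma connective_diagram (hP : IsPreslicing P)
    (hloc : ∀ E : IndecObj C, IsLocalRing (End E.obj)) :
    (t.diagram hT).base.Connective R.q := by
  have hlast : ¬ IsZero (t.obj (Fin.last t.n)).obj := fun h =>
    L.obj.indecomposable.1 (h.of_iso ((LiftedObj.π R).mapIso t.e).symm)
  obtain ⟨jl⟩ := (t.obj (Fin.last t.n)).dec.exists_index hlast
  let xl : (t.diagram hT).base.Node := ⟨.inl (Fin.last t.n), jl⟩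
  have hpot := t.isPotential_nodePhase hT
  have hobj : ∀ (i : Fin (t.n + 1)) (a : Fin (t.obj i).dec.n),
      ∃ d, (t.diagram hT).base.Joined R.q ⟨.inl i, a⟩ xl d := by
    intro i
    induction i using Fin.reverseInduction with
    | last =>
      intro a
      obtain rfl : a = jl := Decomposition.eq_of_indecomposable hloc (t.obj (Fin.last t.n)).dec
        (E := L.obj) ((LiftedObj.π R).mapIso t.e) a jl
      exact ⟨0, .refl _⟩
    | cast i ih =>
      intro a
      obtain ⟨b, hb⟩ := LiftedObj.exists_entry_ne_zero_of_incl (t.incl_comp_f_ne_zero hP i a)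
      obtain ⟨d, hd⟩ := ih b
      exact ⟨_, hd.cons (D := (t.diagram hT).base) (v := .inl i.castSucc) (w := .inl i.succ)
        (Filtration.Edge.f (F := t.toFiltration hT) i) hb
        (hpot _ _ (Filtration.Edge.f (F := t.toFiltration hT) i) a b)⟩
  have hall : ∀ x, ∃ d, (t.diagram hT).base.Joined R.q x xl d := by
    rintro ⟨i | i, a⟩
    · exact hobj i a
    · obtain ⟨b, hb⟩ := LiftedObj.exists_entry_ne_zero_of_pr (t.p_comp_pr_ne_zero hP i a)
      obtain ⟨d, hd⟩ := hobj i.succ b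
      exact ⟨_, hd.cons' (D := (t.diagram hT).base) (v := .inl i.succ) (w := .inr i)
        (Filtration.Edge.p (F := t.toFiltration hT) i) hb
        (hpot _ _ (Filtration.Edge.p (F := t.toFiltration hT) i) b a)⟩
  refine Diagram.connective_iff.2 fun x y => ?_
  obtain ⟨c, hc⟩ := hall x
  obtain ⟨d, hd⟩ := hall y
  exact ⟨_, hc.trans hd.symm⟩

/-- Harder-Narasimhan filtrations in the `ℤ`-lift give Harder-Narasimhan filtrations in `C`. -/
theorem isHarderNarasimhan (hP : IsPreslicing P)
    (hloc : ∀ E : IndecObj C, IsLocalRing (End E.obj)) {R₁ : ChargeTriple k β v} (T : Twist R R₁)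
    {Q : Set.Ioc (0 : ℝ) 2 → ObjectProperty C}
    (hη : ∀ i j, (t.factor i).phase j + T.η ((t.factor i).dec.summand j) = t.phase i)
    (hQ : ∀ i, ∃ ψ, Q ψ (t.factor i).obj) :
    (t.toFiltration hT).IsHarderNarasimhan R₁.q Q := by
  let η : (t.diagram hT).base.Node → ℝ := fun x => T.η ((t.diagram hT).base.summand x)
  let p : (t.diagram hT).unroll.Node → ℝ := fun x =>
    t.nodePhase hT ⟨x.1.1, x.2⟩ + η ⟨x.1.1, x.2⟩ + x.1.2
  have hb : (t.diagram hT).base.Connective R₁.q := Diagram.connective_iff.2 fun x y => by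
    obtain ⟨a, ha⟩ := Diagram.connective_iff.1 (t.connective_diagram hT hP hloc) x y
    exact T.joined ha
  have hp₀ : (t.diagram hT).base.IsPotential R₁.q fun x => p ⟨(x.1, 0), x.2⟩ := by
    intro v w e i j
    refine DecTriangle.mem_of_eq (T.mem_iff.1 (t.isPotential_nodePhase hT v w e i j)) ?_ rfl
    change _ + η ⟨w, j⟩ - η ⟨v, i⟩ = _
    simp only [p]
    ring
  have hp : (t.diagram hT).unroll.IsPotential R₁.q p := by
    refine ((t.diagram hT).isPotential_unroll_iff p).2 ⟨fun v w e i j n => ?_,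
      fun v w e i j n => ?_⟩
    · refine DecTriangle.mem_of_eq (T.mem_iff.1 (t.isPotential_nodePhase hT v w e i j)) ?_ rfl
      change _ + η ⟨w, j⟩ - η ⟨v, i⟩ = _
      simp only [p]
      ring
    · refine DecTriangle.mem_of_eq (T.mem_iff.1 (t.comp₁_mem hT e i j)) ?_ rfl
      rw [T.shift_one]
      change _ + η ⟨w, j⟩ - η ⟨v, i⟩ = _
      simp only [p]
      push_cast
      ring
  refine ⟨fun i => (t.obj i).dec, fun i => (t.factor i).dec, fun j => ?_, hb,
    Diagram.liftable_iff_exists_isPotential.2 ⟨_, hp₀⟩,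
    Diagram.liftable_iff_exists_isPotential.2 ⟨_, hp⟩,
    fun i => ⟨fun h => t.not_isZero i ?_, hQ i⟩,
    fun i i' hi => ⟨t.phase i' - t.phase i, sub_neg.2 (t.phase_anti ?_), fun j j' => ⟨?_, ?_⟩⟩⟩
  · refine ⟨_, DecTriangle.mem_of_eq (T.mem_iff.1 (t.e.hom.2 j (0 : Fin 1))) rfl ?_⟩
    exact congrArg _ (Category.comp_id t.e.hom.1).symm
  · rw [LiftedObj.isZero_iff]
    exact (t.factor i).dec.isZero_iff.1 h
  · exact Fin.lt_def.2 (by omega)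
  · obtain ⟨a, ha⟩ := Diagram.connective_iff.1 hb ⟨.inr i, j⟩ ⟨.inr i', j'⟩
    exact (ShiftDiagram.joined_unroll ha).exists_isSimple
  · intro l _ a ha
    rw [hp.degree_eq l ha, ← hη i j, ← hη i' j']
    change (t.factor i').phase j' + T.η ((t.factor i').dec.summand j') + ((0 : ℤ) : ℝ) -
      ((t.factor i).phase j + T.η ((t.factor i).dec.summand j) + ((0 : ℤ) : ℝ)) = _
    ring

end HNTower

end TowerDiagrams

end CyclicStab

end

open CategoryTheory CategoryTheory.Limits CategoryTheory.Pretriangulated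

noncomputable section

namespace CyclicStab

universe v u w w'

section TwistedTriples

variable {C : Type u} [Category.{v} C] [HasZeroObject C] [Preadditive C] [HasShift C ℤ]
  [∀ n : ℤ, (shiftFunctor C n).Additive] [Pretriangulated C]
  {k : Type w} [Field k] [Linear k C] {β : shiftFunctor C (2 : ℤ) ≅ 𝟭 C}
  {Λ : Type w'} [AddCommGroup Λ] {v : K0 C (distTriang C) →+ Λ} {R : ChargeTriple k β v}


/-! ### Twisting charge triples -/

/-- The real decomposition with degrees changed by the differences of a function on indecomposable
objects. -/
def RealDecomposition.twist (q : RealDecomposition k β) (η : IndecObj C → ℝ)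
    (hη : ∀ E F : IndecObj C, (E.obj ≅ F.obj) → η E = η F)
    (hη' : ∀ (E : IndecObj C) (n : ℤ), η (E.shift n) = η E) : RealDecomposition k β where
  hom E F a := q.hom E F (a - η F + η E)
  isInternal E F := by
    have h := q.isInternal E F
    rw [DirectSum.isInternal_submodule_iff_iSupIndep_and_iSup_eq_top] at h ⊢
    let e : ℝ ≃ ℝ := (Equiv.subRight (η F)).trans (Equiv.addRight (η E))
    exact ⟨h.1.comp e.injective, (e.iSup_comp (g := q.hom E F)).trans h.2⟩
  shift_mem {E F a f} n h := by
    rw [hη', hη']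
    exact q.shift_mem n h
  comp_mem {E F G a b f g} hf hg := by
    have := q.comp_mem hf hg
    rwa [show a - η F + η E + (b - η G + η F) = a + b - η G + η E by ring] at this
  id_mem E := by
    rw [show 0 - η E + η E = 0 by ring]
    exact q.id_mem E
  bott_mem E := by
    rw [hη', show 0 - η E + η E = 0 by ring]
    exact q.bott_mem E
  shiftZero_mem E := by
    rw [hη', show 0 - η E + η E = 0 by ring]
    exact q.shiftZero_mem E
  shiftAdd_mem E m n := by
    rw [hη', hη', hη', show 0 - η E + η E = 0 by ring]
    exact q.shiftAdd_mem E m n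
  degree_iso {E F a f} hf h := by
    have h1 := q.degree_iso hf h
    rw [hη E F (asIso f)] at h1
    linarith

/-- The charge triple twisted by a function `η`, with a given central charge. -/
lemma ChargeTriple.exists_twist_of_charge (R : ChargeTriple k β v) (η : IndecObj C → ℝ)
    (hη : ∀ E F : IndecObj C, (E.obj ≅ F.obj) → η E = η F)
    (hη' : ∀ (E : IndecObj C) (n : ℤ), η (E.shift n) = η E)
    (Z : K0 C (distTriang C) →+ ℂ) (hZ : ∃ g : Λ →+ ℂ, Z = g.comp v)
    (hc : ∀ E, ∃ r : ℝ, 0 ≤ r ∧ Z (K0.of _ E.obj) =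
      r * Complex.exp (Complex.I * Real.pi * (R.phase E + η E : ℝ))) :
    ∃ (R₁ : ChargeTriple k β v) (T : Twist R R₁), R₁.Z = Z ∧ T.η = η := by
  choose ψ m hψ using fun E => StabilityCondition.exists_mem_Ioc (R.phase E + η E)
  refine ⟨{
    Z := Z
    factors := hZ
    phase := fun E => ψ E
    phase_mem := fun E => (ψ E).2
    q := R.q.twist η hη hη'
    phase_shift := fun E => ?_
    charge := fun E => ?_
    degree := fun E F f a hf h => ?_ }, ⟨η, fun {E F f a} => ?_, fun E => hη' E 1, fun E => ?_⟩,
    rfl, rfl⟩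
  · obtain ⟨n, hn⟩ := R.phase_shift E
    have h1 := hψ E
    have h2 := hψ (E.shift 1)
    rw [hη'] at h2
    exact ⟨n + m E - m (E.shift 1), by push_cast; linarith⟩
  · obtain ⟨r, hr, h⟩ := hc E
    exact ⟨r, hr, by rw [h, Twist.exp_congr (hψ E)]⟩
  · obtain ⟨n, hn⟩ := R.degree E F f _ hf h
    have h1 := hψ E
    have h2 := hψ F
    exact ⟨n + m F - m E, by push_cast; linarith⟩
  · change _ ↔ f ∈ R.q.hom E F (a + η F - η E - η F + η E)
    rw [show a + η F - η E - η F + η E = a by ring]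
  · exact ⟨-m E, by push_cast; linarith [hψ E]⟩

namespace Twist

variable {R₁ : ChargeTriple k β v} (T : Twist R R₁)

lemma liftable (T : Twist R R₁) {D : Diagram C} (h : D.Liftable R.q) : D.Liftable R₁.q :=
  ⟨fun v w e i j => T.isHomogeneous_iff.1 (h.1 v w e i j), fun x l a hl => by
    have := h.2 x l _ (T.hasDegree_iff'.1 hl)
    linarith⟩

lemma liftable' (T : Twist R R₁) {D : Diagram C} (h : D.Liftable R₁.q) : D.Liftable R.q :=
  ⟨fun v w e i j => T.isHomogeneous_iff.2 (h.1 v w e i j), fun x l a hl => by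
    have := h.2 x l _ (T.hasDegree_iff.1 hl)
    linarith⟩

lemma preLiftable (T : Twist R R₁) (h : R.q.PreLiftable) : R₁.q.PreLiftable :=
  fun X Y dX dY f hf =>
    let ⟨Z, dZ, g, t, hT, hl⟩ := h X Y dX dY f (T.liftable' hf)
    ⟨Z, dZ, g, t, hT, T.liftable hl⟩

/-- Direct summands of objects of the pullback. -/
lemma pull_of_binSplit {σ₁ : StabilityCondition k β v} (T : Twist R σ₁.toChargeTriple) (m : ℤ)
    (hloc : ∀ E : IndecObj C, IsLocalRing (End E.obj)) {ψ : ℝ} {X Y Z : LiftedObj R}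
    (s : BinSplit Z X Y) (hZ : T.pull m ψ Z) : T.pull m ψ X := by
  rw [pull_iff_summand]
  intro j
  obtain ⟨i, hi⟩ := Z.exists_isIso_pr hloc (X.incl j ≫ s.i₁) (s.p₁ ≫ X.pr j) (by
    rw [Category.assoc, s.i₁_p₁_assoc, X.incl_pr]
    infer_instance)
  exact T.pull_of_isIso m hZ i _ hi

end Twist

/-! ### Semistable objects of the `ℤ`-lift and the shift -/

lemma IsPreslicing.shift_int {D : Type u} [Category.{v} D] [Preadditive D] [HasShift D ℤ]
    {P : ℝ → ObjectProperty D} (hP : IsPreslicing P) {φ : ℝ} {X : D} (n : ℤ) :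
    P φ X ↔ P (φ + n) (X⟦n⟧) := by
  have hiso : ∀ {φ : ℝ} {X Y : D}, (X ≅ Y) → (P φ X ↔ P φ Y) :=
    fun e => ⟨hP.iso_mem e, hP.iso_mem e.symm⟩
  have step : ∀ n : ℤ, P (φ + n) (X⟦n⟧) ↔ P (φ + (n + 1 : ℤ)) (X⟦n + 1⟧) := by
    intro n
    rw [hP.shift, hiso ((shiftFunctorAdd D n 1).app X)]
    push_cast
    rw [add_assoc]
    rfl
  induction n using Int.induction_on with
  | zero =>
    rw [hiso ((shiftFunctorZero D ℤ).app X)]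
    simp
  | succ i ih => exact ih.trans (step i)
  | pred i ih =>
    have := step (-i - 1)
    rw [sub_add_cancel] at this
    exact ih.trans this.symm

namespace LiftedIndec

/-- An isomorphism of degree `θ' - θ` is an isomorphism from `(E, θ)` to `(F, θ')`. -/
lemma nonempty_iso {L M : LiftedIndec R} (e : L.obj.obj ≅ M.obj.obj)
    (he : e.hom ∈ R.q.hom L.obj M.obj (M.phase - L.phase)) : Nonempty (L.lift ≅ M.lift) := by
  have : IsIso (homMk e.hom he).1 := Iso.isIso_hom e
  have := LiftedObj.isIso_of_isIso_val (homMk e.hom he)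
  exact ⟨asIso (homMk e.hom he)⟩

/-- The shift `(E, θ)[n] = (E[n], θ + n)`. -/
lemma nonempty_shift_iso {L M : LiftedIndec R} (n : ℤ) (e : (L.obj.shift n).obj ≅ M.obj.obj)
    (he : e.hom ∈ R.q.hom (L.obj.shift n) M.obj (M.phase - (L.phase + n))) :
    Nonempty (L.lift⟦n⟧ ≅ M.lift) := by
  let f : L.lift⟦n⟧ ⟶ M.lift := ⟨e.hom, fun i j => by
    refine DecTriangle.mem_of_eq he rfl ?_
    change (𝟙 L.obj.obj)⟦n⟧' ≫ e.hom ≫ 𝟙 _ = _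
    rw [CategoryTheory.Functor.map_id, Category.id_comp, Category.comp_id]⟩
  have : IsIso f.1 := Iso.isIso_hom e
  have := LiftedObj.isIso_of_isIso_val f
  exact ⟨asIso f⟩

end LiftedIndec

namespace IsPreslicing

variable {P : ℝ → ObjectProperty (LiftedObj R)}

lemma mem_shift_one (hP : IsPreslicing P) {ψ : ℝ} {L M : LiftedIndec R}
    (h : M.obj = L.obj.shift 1) (h' : M.phase = L.phase + 1) :
    P ψ L.lift ↔ P (ψ + 1) M.lift := by
  obtain ⟨E, θ, hθ⟩ := M
  obtain rfl : E = L.obj.shift 1 := h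
  obtain ⟨e⟩ := LiftedIndec.nonempty_shift_iso (L := L) (M := ⟨_, θ, hθ⟩) 1 (Iso.refl _) (by
    change 𝟙 _ ∈ R.q.hom _ _ (θ - _)
    rw [show θ = L.phase + 1 from h', Int.cast_one, sub_self]
    exact R.q.id_mem _)
  rw [hP.shift]
  exact ⟨hP.iso_mem e, hP.iso_mem e.symm⟩

/-- The phase of a semistable object `(E, θ)` increases with `θ`. -/
lemma mem_add_two (hP : IsPreslicing P) {ψ : ℝ} {L M : LiftedIndec R}
    (h : M.obj = L.obj) {n : ℤ} (h' : M.phase = L.phase + 2 * n) (hL : P ψ L.lift) :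
    P (ψ + 2 * n) M.lift := by
  have step : ∀ {ψ : ℝ} {L M : LiftedIndec R}, M.obj = L.obj → M.phase = L.phase + 2 →
      (P ψ L.lift ↔ P (ψ + 2) M.lift) := by
    intro ψ L M h h'
    obtain ⟨E, θ, hθ⟩ := M
    obtain rfl : E = L.obj := h
    obtain ⟨e⟩ := LiftedIndec.nonempty_shift_iso (L := L) (M := ⟨_, θ, hθ⟩) 2 (β.app L.obj.obj) (by
      change β.hom.app L.obj.obj ∈ R.q.hom (L.obj.shift 2) L.obj (θ - _)
      rw [show θ = L.phase + 2 from h', Int.cast_ofNat, sub_self]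
      exact R.q.bott_mem _)
    rw [hP.shift_int 2, Int.cast_ofNat]
    exact ⟨hP.iso_mem e, hP.iso_mem e.symm⟩
  obtain ⟨E, θ, hθ⟩ := M
  obtain rfl : E = L.obj := h
  obtain rfl : θ = L.phase + 2 * n := h'
  obtain ⟨r, hr⟩ := L.phase_spec
  have hi : ∀ i : ℤ, ∃ m : ℤ, L.phase + 2 * i = R.phase L.obj + 2 * m :=
    fun i => ⟨r + i, by rw [hr]; push_cast; ring⟩
  induction n using Int.induction_on with
  | zero =>
    have e : (⟨L.obj, L.phase + 2 * ((0 : ℤ) : ℝ), hθ⟩ : LiftedIndec R) = L := by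
      obtain ⟨E, θ, _⟩ := L
      simp
    rw [e]
    simpa using hL
  | succ i ih =>
    have := (step (L := ⟨L.obj, _, hi i⟩) (M := ⟨L.obj, _, hθ⟩) rfl
      (by push_cast; ring)).1 (ih (hi _))
    rwa [show ψ + 2 * ((i : ℤ) : ℝ) + 2 = ψ + 2 * ((i + 1 : ℤ) : ℝ) by push_cast; ring] at this
  | pred i ih =>
    refine (step (L := ⟨L.obj, _, hθ⟩) (M := ⟨L.obj, _, hi (-i)⟩) rfl
      (by push_cast; ring)).2 ?_
    rw [show ψ + 2 * ((-i - 1 : ℤ) : ℝ) + 2 = ψ + 2 * ((-i : ℤ) : ℝ) by push_cast; ring]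
    exact ih (hi _)

lemma phase_unique {D : Type u} [Category.{v} D] [Preadditive D] [HasShift D ℤ]
    {P : ℝ → ObjectProperty D} (hP : IsPreslicing P) {φ ψ : ℝ} {X : D}
    (hX : ¬ IsZero X) (h₁ : P φ X) (h₂ : P ψ X) : φ = ψ := by
  by_contra hne
  rcases lt_or_gt_of_ne hne with h | h
  · exact hX ((IsZero.iff_id_eq_zero _).2 (hP.hom_eq_zero h h₂ h₁ _))
  · exact hX ((IsZero.iff_id_eq_zero _).2 (hP.hom_eq_zero h h₁ h₂ _))

end IsPreslicing

end TwistedTriples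

end CyclicStab

end

open CategoryTheory CategoryTheory.Limits CategoryTheory.Pretriangulated

noncomputable section

namespace CyclicStab

universe v u w w'

section FromLift

variable {C : Type u} [Category.{v} C] [HasZeroObject C] [Preadditive C] [HasShift C ℤ]
  [∀ n : ℤ, (shiftFunctor C n).Additive] [Pretriangulated C]
  {k : Type w} [Field k] [Linear k C] {β : shiftFunctor C (2 : ℤ) ≅ 𝟭 C}
  {Λ : Type w'} [AddCommGroup Λ] {v : K0 C (distTriang C) →+ Λ} {R : ChargeTriple k β v}


/-! ### Stability conditions on `C` from stability conditions on the `ℤ`-lift -/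

open ZeroObject in
lemma K0.of_shift (X : C) : K0.of (distTriang C) (X⟦(1 : ℤ)⟧) = -K0.of (distTriang C) X := by
  have h : K0.of (distTriang C) (0 : C) - K0.of (distTriang C) X -
      K0.of (distTriang C) (X⟦(1 : ℤ)⟧) = 0 :=
    (QuotientAddGroup.eq_zero_iff _).2
      (AddSubgroup.subset_closure ⟨_, contractible_distinguished₂ X, rfl⟩)
  rw [K0.of_isZero (isZero_zero C), zero_sub] at h
  exact (sub_eq_zero.1 h).symm

lemma exp_add_one {a b : ℝ} {n : ℤ} (h : a = b + 1 + 2 * n) :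
    Complex.exp (Complex.I * Real.pi * a) = -Complex.exp (Complex.I * Real.pi * b) := by
  rw [Twist.exp_congr h]
  push_cast
  rw [mul_add, mul_one, Complex.exp_add, mul_comm Complex.I, Complex.exp_pi_mul_I, mul_neg_one]

section Offsets

variable (P : ℝ → ObjectProperty (LiftedObj R)) (Z : K0 C (distTriang C) →+ ℂ)

/-- The possible values of a twist relating `R` to the charge triple determined by a slicing and a
central charge on the `ℤ`-lift: they are prescribed on semistable objects, and up to even integers
on objects with nonzero central charge. -/
def offsets (E : IndecObj C) : Set ℝ :=
  {x | (∀ (L : LiftedIndec R) (ψ : ℝ), L.obj = E → P ψ L.lift → L.phase + x = ψ) ∧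
    ∃ r : ℝ, 0 ≤ r ∧ Z (K0.of _ E.obj) =
      r * Complex.exp (Complex.I * Real.pi * (R.phase E + x : ℝ))}

variable {P Z}

lemma offsets_nonempty (hP : IsPreslicing P)
    (hc : ∀ (L : LiftedIndec R) (ψ : ℝ), P ψ L.lift → ∃ r : ℝ, 0 < r ∧
      Z (K0.of _ L.obj.obj) = r * Complex.exp (Complex.I * Real.pi * ψ)) (E : IndecObj C) :
    (offsets P Z E).Nonempty := by
  by_cases h : ∃ (L : LiftedIndec R) (ψ : ℝ), L.obj = E ∧ P ψ L.lift
  · obtain ⟨L, ψ, rfl, hL⟩ := h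
    obtain ⟨n, hn⟩ := L.phase_spec
    refine ⟨ψ - L.phase, fun M φ hM hφ => ?_, ?_⟩
    · obtain ⟨n', hn'⟩ := M.phase_spec
      rw [hM] at hn'
      have h1 : M.phase = L.phase + 2 * ((n' - n : ℤ) : ℝ) := by
        rw [hn, hn']; push_cast; ring
      have h2 := hP.phase_unique M.not_isZero hφ (hP.mem_add_two hM h1 hL)
      linarith
    · obtain ⟨r, hr, hZ⟩ := hc L ψ hL
      refine ⟨r, hr.le, ?_⟩
      rw [hZ, Twist.exp_congr (show ψ = R.phase L.obj + (ψ - L.phase) + 2 * n by linarith)]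
  · let z := Z (K0.of _ E.obj)
    refine ⟨Complex.arg z / Real.pi - R.phase E, fun L ψ hL hψ => absurd ⟨L, ψ, hL, hψ⟩ h,
      ‖z‖, norm_nonneg _, ?_⟩
    have : Complex.I * Real.pi * ((R.phase E + (Complex.arg z / Real.pi - R.phase E) : ℝ) : ℂ) =
        Complex.arg z * Complex.I := by
      push_cast
      have : (Real.pi : ℂ) ≠ 0 := Complex.ofReal_ne_zero.2 Real.pi_ne_zero
      field_simp
      ring
    rw [this, Complex.norm_mul_exp_arg_mul_I]

lemma offsets_subset_of_iso (hP : IsPreslicing P)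
    (hloc : ∀ E : IndecObj C, IsLocalRing (End E.obj)) {E F : IndecObj C} (e : E.obj ≅ F.obj) :
    offsets P Z E ⊆ offsets P Z F := by
  obtain ⟨e', he'⟩ := R.q.exists_homogeneous_iso hloc e
  obtain ⟨n, hn⟩ := R.phase_of_iso e' he'
  rintro x ⟨h₁, r, hr, h₂⟩
  refine ⟨fun L ψ hL hψ => ?_, r, hr, ?_⟩
  · subst hL
    obtain ⟨m, hm⟩ := L.phase_spec
    let M : LiftedIndec R := ⟨E, L.phase, n + m, by rw [hm, hn]; push_cast; ring⟩
    obtain ⟨i⟩ := LiftedIndec.nonempty_iso (L := M) (M := L) e' (by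
      change _ ∈ R.q.hom E L.obj (L.phase - L.phase)
      rwa [sub_self])
    exact h₁ M ψ rfl (hP.iso_mem i.symm hψ)
  · rw [← K0.of_iso e, h₂, Twist.exp_congr (show R.phase F + x = R.phase E + x + 2 * n by
      rw [hn]; ring)]

lemma offsets_shift (hP : IsPreslicing P) (E : IndecObj C) :
    offsets P Z (E.shift 1) = offsets P Z E := by
  obtain ⟨n, hn⟩ := R.phase_shift E
  have hexp : ∀ x : ℝ, Complex.exp (Complex.I * Real.pi * (R.phase (E.shift 1) + x : ℝ)) =
      -Complex.exp (Complex.I * Real.pi * (R.phase E + x : ℝ)) := fun x =>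
    exp_add_one (n := n) (by rw [hn]; ring)
  ext x
  refine and_congr ⟨fun h L ψ hL hψ => ?_, fun h M ψ hM hψ => ?_⟩ (exists_congr fun r =>
    and_congr_right fun _ => ?_)
  · subst hL
    obtain ⟨m, hm⟩ := L.phase_spec
    let M : LiftedIndec R := ⟨L.obj.shift 1, L.phase + 1, m - n, by
      rw [hn, hm]; push_cast; ring⟩
    have := h M (ψ + 1) rfl ((hP.mem_shift_one (M := M) rfl rfl).1 hψ)
    have e : M.phase = L.phase + 1 := rfl
    linarith
  · obtain ⟨m, hm⟩ := M.phase_spec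
    rw [hM] at hm
    let L : LiftedIndec R := ⟨E, M.phase - 1, m + n, by rw [hm, hn]; push_cast; ring⟩
    have e : M.phase = L.phase + 1 := by change _ = M.phase - 1 + 1; ring
    have := h L (ψ - 1) rfl ((hP.mem_shift_one (L := L) hM e).2 (by rwa [sub_add_cancel]))
    linarith
  · rw [hexp, K0.of_shift, map_neg, mul_neg, neg_inj]

/-- The values of the twist can be chosen invariant under isomorphisms and shifts. -/
lemma exists_offset (hP : IsPreslicing P) (hloc : ∀ E : IndecObj C, IsLocalRing (End E.obj))
    (hc : ∀ (L : LiftedIndec R) (ψ : ℝ), P ψ L.lift → ∃ r : ℝ, 0 < r ∧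
      Z (K0.of _ L.obj.obj) = r * Complex.exp (Complex.I * Real.pi * ψ)) :
    ∃ η : IndecObj C → ℝ, (∀ E, η E ∈ offsets P Z E) ∧
      (∀ E F : IndecObj C, (E.obj ≅ F.obj) → η E = η F) ∧
      ∀ (E : IndecObj C) (n : ℤ), η (E.shift n) = η E := by
  -- Choosing an element depends on the set of possible values only.
  let η : IndecObj C → ℝ := fun E => Classical.epsilon fun x => x ∈ offsets P Z E
  have hη : ∀ {E F}, offsets P Z E = offsets P Z F → η E = η F := fun h => by
    simp only [η, h]
  have hiso : ∀ E F : IndecObj C, (E.obj ≅ F.obj) → η E = η F := fun E F e =>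
    hη ((offsets_subset_of_iso hP hloc e).antisymm (offsets_subset_of_iso hP hloc e.symm))
  have h1 : ∀ E : IndecObj C, η (E.shift 1) = η E := fun E => hη (offsets_shift hP E)
  have step : ∀ (E : IndecObj C) (n : ℤ), η (E.shift (n + 1)) = η (E.shift n) := fun E n =>
    (hiso (E.shift (n + 1)) ((E.shift n).shift 1) ((shiftFunctorAdd C n 1).app E.obj)).trans (h1 _)
  refine ⟨η, fun E => Classical.epsilon_spec (offsets_nonempty hP hc E), hiso, fun E n => ?_⟩
  induction n using Int.induction_on with
  | zero => exact hiso (E.shift 0) E ((shiftFunctorZero C ℤ).app E.obj)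
  | succ i ih => exact (step E i).trans ih
  | pred i ih =>
    have := step E (-i - 1)
    rw [sub_add_cancel] at this
    exact this.symm.trans ih

end Offsets

/-! ### The induced circle slicing -/

section CircleSlicing

variable (P : ℝ → ObjectProperty (LiftedObj R))

/-- `E` has a semistable lift `(E, θ)` whose phase is congruent to `ψ` modulo `2`. -/
def HasSemistableLift (ψ : ℝ) (E : IndecObj C) : Prop :=
  ∃ L : LiftedIndec R, L.obj = E ∧ ∃ n : ℤ, P (ψ + 2 * n) L.lift

/-- The objects of `C` all of whose indecomposable direct summands have a semistable lift of
phase `ψ` modulo `2`. -/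
def circleSlicing (ψ : ℝ) : ObjectProperty C := fun X =>
  ∀ (N : IndecObj C) (a : N.obj ⟶ X) (b : X ⟶ N.obj), a ≫ b = 𝟙 _ → HasSemistableLift P ψ N

variable {P}

lemma HasSemistableLift.of_iso (hP : IsPreslicing P)
    (hloc : ∀ E : IndecObj C, IsLocalRing (End E.obj)) {ψ : ℝ} {E F : IndecObj C}
    (e : E.obj ≅ F.obj) (h : HasSemistableLift P ψ E) : HasSemistableLift P ψ F := by
  obtain ⟨L, rfl, n, hL⟩ := h
  obtain ⟨e', he'⟩ := R.q.exists_homogeneous_iso hloc e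
  obtain ⟨m, hm⟩ := R.phase_of_iso e' he'
  obtain ⟨l, hl⟩ := L.phase_spec
  obtain ⟨i⟩ := LiftedIndec.nonempty_iso (L := L)
    (M := ⟨F, L.phase, l - m, by rw [hl, hm]; push_cast; ring⟩) e' (by
      change _ ∈ R.q.hom L.obj F (L.phase - L.phase)
      rwa [sub_self])
  exact ⟨_, rfl, n, hP.iso_mem i hL⟩

lemma HasSemistableLift.shift (hP : IsPreslicing P) {ψ ψ' : ℝ} {m : ℤ} (h : ψ' = ψ + 1 + 2 * m)
    {E : IndecObj C} : HasSemistableLift P ψ E ↔ HasSemistableLift P ψ' (E.shift 1) := by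
  obtain ⟨r, hr⟩ := R.phase_shift E
  constructor
  · rintro ⟨L, rfl, n, hL⟩
    obtain ⟨l, hl⟩ := L.phase_spec
    let M : LiftedIndec R := ⟨L.obj.shift 1, L.phase + 1, l - r, by rw [hl, hr]; push_cast; ring⟩
    refine ⟨M, rfl, n - m, ?_⟩
    have := (hP.mem_shift_one (M := M) rfl rfl).1 hL
    rwa [show ψ' + 2 * ((n - m : ℤ) : ℝ) = ψ + 2 * n + 1 by rw [h]; push_cast; ring]
  · rintro ⟨M, hM, n, h'⟩
    obtain ⟨l, hl⟩ := M.phase_spec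
    rw [hM] at hl
    let L : LiftedIndec R := ⟨E, M.phase - 1, l + r, by rw [hl, hr]; push_cast; ring⟩
    have e : M.phase = L.phase + 1 := by change _ = M.phase - 1 + 1; ring
    refine ⟨L, rfl, n + m, (hP.mem_shift_one (L := L) hM e).2 ?_⟩
    rwa [show ψ + 2 * ((n + m : ℤ) : ℝ) + 1 = ψ' + 2 * n by rw [h]; push_cast; ring]

/-- A semistable lift with prescribed phase in the `ℤ`-lift. -/
lemma HasSemistableLift.exists_mem (hP : IsPreslicing P) {ψ : ℝ} {L : LiftedIndec R}
    (h : HasSemistableLift P ψ L.obj) : ∃ n : ℤ, P (ψ + 2 * n) L.lift := by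
  obtain ⟨M, hM, n, h⟩ := h
  obtain ⟨l, hl⟩ := L.phase_spec
  obtain ⟨m, hm⟩ := M.phase_spec
  rw [hM] at hm
  have := hP.mem_add_two (L := M) (M := L) (n := l - m) hM.symm
    (by rw [hl, hm]; push_cast; ring) h
  exact ⟨n + (l - m), by push_cast at this ⊢; rwa [mul_add, ← add_assoc]⟩

namespace IsPreslicing

lemma circleSlicing_indec (hP : IsPreslicing P)
    (hloc : ∀ E : IndecObj C, IsLocalRing (End E.obj)) {ψ : ℝ} {E : IndecObj C} :
    circleSlicing P ψ E.obj ↔ HasSemistableLift P ψ E := by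
  refine ⟨fun h => h E (𝟙 _) (𝟙 _) (Category.comp_id _), fun h N a b hab => ?_⟩
  have := hloc E
  have : IsIso (a ≫ b) := by rw [hab]; infer_instance
  have : IsIso a := isIso_of_isIso_comp N.indecomposable.1 a b
  exact h.of_iso hP hloc (asIso a).symm

lemma circleSlicing_of_summands (hP : IsPreslicing P)
    (hloc : ∀ E : IndecObj C, IsLocalRing (End E.obj)) {ψ : ℝ} {X : C} (d : Decomposition X)
    (h : ∀ i, HasSemistableLift P ψ (d.summand i)) : circleSlicing P ψ X := by
  intro N a b hab
  have := hloc N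
  have (i : Fin d.n) := hloc (d.summand i)
  have : IsIso (a ≫ b) := by rw [hab]; infer_instance
  obtain ⟨i, hi⟩ := d.sumData.exists_isIso_proj N.indecomposable.1 a b
  exact (h i).of_iso hP hloc (asIso (a ≫ d.sumData.proj i)).symm

lemma _root_.CyclicStab.circleSlicing_sum
    (hloc : ∀ E : IndecObj C, IsLocalRing (End E.obj)) {ψ : ℝ} {X Y : C} :
    circleSlicing P ψ (X ⊞ Y) ↔ circleSlicing P ψ X ∧ circleSlicing P ψ Y := by
  constructor
  · refine fun h => ⟨fun N a b hab => h N (a ≫ biprod.inl) (biprod.fst ≫ b) ?_,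
      fun N a b hab => h N (a ≫ biprod.inr) (biprod.snd ≫ b) ?_⟩ <;> simpa
  · rintro ⟨hX, hY⟩ N a b hab
    have := hloc N
    have e : 𝟙 N.obj = (a ≫ biprod.fst) ≫ biprod.inl ≫ b + (a ≫ biprod.snd) ≫ biprod.inr ≫ b := by
      have h : a ≫ b = a ≫ (biprod.fst ≫ biprod.inl + biprod.snd ≫ biprod.inr) ≫ b := by
        rw [biprod.total, Category.id_comp]
      simp only [← hab, Category.assoc]
      rw [h]
      simp only [Preadditive.add_comp, Preadditive.comp_add, Category.assoc]
    rcases isIso_or_isIso_of_isIso_add (e ▸ (inferInstance : IsIso (𝟙 _))) with h | h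
    · exact hX N (a ≫ biprod.fst) ((biprod.inl ≫ b) ≫ inv ((a ≫ biprod.fst) ≫ biprod.inl ≫ b))
        ((Category.assoc _ _ _).symm.trans (IsIso.hom_inv_id _))
    · exact hY N (a ≫ biprod.snd) ((biprod.inr ≫ b) ≫ inv ((a ≫ biprod.snd) ≫ biprod.inr ≫ b))
        ((Category.assoc _ _ _).symm.trans (IsIso.hom_inv_id _))

lemma circleSlicing_shift (hP : IsPreslicing P)
    (hloc : ∀ E : IndecObj C, IsLocalRing (End E.obj)) {ψ ψ' : ℝ} {m : ℤ}
    (h : ψ' = ψ + 1 + 2 * m) {X : C} :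
    circleSlicing P ψ X ↔ circleSlicing P ψ' (X⟦(1 : ℤ)⟧) := by
  constructor
  · intro hX N a b hab
    let e := (shiftShiftNeg X (1 : ℤ))
    let e' := (shiftNegShift N.obj (1 : ℤ))
    have h1 := hX (N.shift (-1)) (a⟦(-1 : ℤ)⟧' ≫ e.hom) (e.inv ≫ b⟦(-1 : ℤ)⟧') (by
      rw [Category.assoc, e.hom_inv_id_assoc, ← Functor.map_comp, hab,
        CategoryTheory.Functor.map_id])
    exact ((HasSemistableLift.shift hP h).1 h1).of_iso hP hloc e'
  · intro hX N a b hab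
    exact (HasSemistableLift.shift hP h).2 (hX (N.shift 1) (a⟦(1 : ℤ)⟧') (b⟦(1 : ℤ)⟧') (by
      rw [← Functor.map_comp, hab, CategoryTheory.Functor.map_id]))

end IsPreslicing

end CircleSlicing

end FromLift

end CyclicStab

end

open CategoryTheory CategoryTheory.Limits CategoryTheory.Pretriangulated

noncomputable section

namespace CyclicStab

universe v u w w'

section FromLift

variable {C : Type u} [Category.{v} C] [HasZeroObject C] [Preadditive C] [HasShift C ℤ]
  [∀ n : ℤ, (shiftFunctor C n).Additive] [Pretriangulated C]
  {k : Type w} [Field k] [Linear k C] {β : shiftFunctor C (2 : ℤ) ≅ 𝟭 C}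
  {Λ : Type w'} [AddCommGroup Λ] {v : K0 C (distTriang C) →+ Λ} {R : ChargeTriple k β v}


variable [Pretriangulated (LiftedObj R)]

/-- Every stability condition on the `ℤ`-lift is a pullback of a stability condition on `C`. -/
theorem LiftedStability.exists_stabilityCondition (τ : LiftedStability R) (hKS : IsKrullSchmidt C)
    (hT : distTriang (LiftedObj R) = LiftedObj.distinguished R) (hpre : R.q.PreLiftable) :
    ∃ (σ₁ : StabilityCondition k β v) (T : Twist R σ₁.toChargeTriple),
      τ.Z = σ₁.Z.comp (LiftedObj.π₀ R) ∧ τ.P = T.pull 0 := by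
  have hP := τ.isPreslicing
  have hloc := hKS.2
  obtain ⟨g, hg⟩ := τ.factors
  have hτZ : τ.Z = (g.comp v).comp (LiftedObj.π₀ R) := by rw [hg, AddMonoidHom.comp_assoc]
  have hc : ∀ (L : LiftedIndec R) (ψ : ℝ), τ.P ψ L.lift → ∃ r : ℝ, 0 < r ∧
      g.comp v (K0.of _ L.obj.obj) = r * Complex.exp (Complex.I * Real.pi * ψ) := by
    intro L ψ hL
    obtain ⟨r, hr, h⟩ := τ.charge ψ _ hL L.not_isZero
    rw [hτZ, AddMonoidHom.comp_apply, LiftedObj.π₀_of] at h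
    exact ⟨r, hr, h⟩
  obtain ⟨η, hη, hηiso, hηshift⟩ := exists_offset hP hloc hc
  obtain ⟨R₁, T, hZ, rfl⟩ := R.exists_twist_of_charge η hηiso hηshift (g.comp v) ⟨g, rfl⟩
    fun E => (hη E).2
  have hphase : ∀ (L : LiftedIndec R) (ψ : ℝ), τ.P ψ L.lift → L.phase + T.η L.obj = ψ :=
    fun L ψ hL => (hη L.obj).1 L ψ rfl hL
  -- Lifts of semistable objects are semistable, of the phase given by the twist.
  have hmem : ∀ (L : LiftedIndec R) (ψ : ℝ), HasSemistableLift τ.P ψ L.obj →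
      τ.P (L.phase + T.η L.obj) L.lift := by
    intro L ψ h
    obtain ⟨n, hn⟩ := HasSemistableLift.exists_mem hP h
    rwa [hphase L _ hn]
  have hphase₁ : ∀ (ψ : Set.Ioc (0 : ℝ) 2) (E : IndecObj C), HasSemistableLift τ.P ψ E →
      R₁.phase E = ψ := by
    rintro ψ _ ⟨L, rfl, n, hL⟩
    obtain ⟨l, hl⟩ := L.phase_spec
    obtain ⟨m, hm⟩ := T.phase L.obj
    have h1 := hphase L _ hL
    exact congrArg Subtype.val (StabilityCondition.Ioc_ext (ψ := ⟨_, R₁.phase_mem L.obj⟩)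
      (ψ' := ψ) (m := l) (m' := n + m) (by push_cast; linarith))
  have hretract : ∀ {ψ : ℝ} {X : LiftedObj R}, τ.P ψ X → ∀ i, τ.P ψ (X.summand i).lift :=
    fun h i => HasHN.mem_of_retract hP (τ.hasHN hT _) h (LiftedObj.incl _ i) (LiftedObj.pr _ i)
      (LiftedObj.incl_pr _ i)
  let σ₁ : StabilityCondition k β v :=
    { toChargeTriple := R₁
      preLiftable := T.preLiftable hpre
      Q := fun ψ => circleSlicing τ.P ψ
      iso_mem := fun ψ X Y e hX N a b hab => hX N (a ≫ e.inv) (e.hom ≫ b) (by simpa)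
      zero_mem := fun ψ X hX N a b hab => absurd (by rw [← hab, hX.eq_of_tgt a 0, zero_comp])
        N.id_ne_zero
      sum_mem := fun ψ X Y => circleSlicing_sum hloc
      slicing_shift := fun ψ ψ' ⟨m, hm⟩ X => hP.circleSlicing_shift hloc hm
      semistable := fun ψ E hE => by
        have hE' := (hP.circleSlicing_indec hloc).1 hE
        refine ⟨hphase₁ ψ E hE', ?_⟩
        obtain ⟨L, rfl, n, hL⟩ := hE'
        obtain ⟨r, hr, h⟩ := hc L _ hL
        exact ⟨r, hr, by rw [hZ, h, hphase₁ ψ _ ⟨L, rfl, n, hL⟩, Twist.exp_congr rfl]⟩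
      degree_nonneg := fun ψ ψ' E F hE hF f a hf ha => by
        have hE' := (hP.circleSlicing_indec hloc).1 hE
        have hF' := (hP.circleSlicing_indec hloc).1 hF
        have ha' := T.mem_iff'.1 ha
        obtain ⟨n, hn⟩ := R.degree E F f _ hf ha'
        let L : LiftedIndec R := ⟨E, R.phase E, 0, by simp⟩
        let M : LiftedIndec R := ⟨F, R.phase E + (a - T.η F + T.η E), n, by rw [hn]; ring⟩
        by_contra! hlt
        have hlt' : M.phase + T.η M.obj < L.phase + T.η L.obj := by
          change R.phase E + (a - T.η F + T.η E) + T.η F < R.phase E + T.η E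
          linarith
        have h0 := hP.hom_eq_zero hlt' (hmem L ψ hE') (hmem M ψ' hF')
          (LiftedIndec.homMk f (by
            change f ∈ R.q.hom E F (R.phase E + (a - T.η F + T.η E) - R.phase E)
            rwa [add_sub_cancel_left]))
        exact hf (congrArg Subtype.val h0)
      harderNarasimhan := fun E => by
        let L : LiftedIndec R := ⟨E, R.phase E, 0, by simp⟩
        obtain ⟨t, -⟩ := (τ.hasHN hT L.lift).exists_tower
        refine ⟨t.toFiltration hT, t.isHarderNarasimhan hT hP hloc T
          (fun i j => hphase _ _ (hretract (t.mem i) j)) fun i => ?_⟩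
        obtain ⟨ψ, m, hm⟩ := StabilityCondition.exists_mem_Ioc (t.phase i)
        exact ⟨ψ, hP.circleSlicing_of_summands hloc (t.factor i).dec fun j =>
          ⟨_, rfl, m, hm ▸ hretract (t.mem i) j⟩⟩ }
  have hsemi : ∀ E : IndecObj C, σ₁.Semistable E ↔ ∃ ψ : ℝ, HasSemistableLift τ.P ψ E := by
    intro E
    constructor
    · rintro ⟨ψ, h⟩
      exact ⟨ψ, (hP.circleSlicing_indec hloc).1 h⟩
    · rintro ⟨ψ, L, rfl, n, hL⟩
      obtain ⟨ψ', m, hm⟩ := StabilityCondition.exists_mem_Ioc ψ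
      refine ⟨ψ', (hP.circleSlicing_indec hloc).2 ⟨L, rfl, m + n, ?_⟩⟩
      rw [hm] at hL
      push_cast
      rwa [mul_add, ← add_assoc]
  refine ⟨σ₁, T, by rw [hτZ]; exact congrArg (fun Z => AddMonoidHom.comp Z (LiftedObj.π₀ R)) hZ.symm, ?_⟩
  ext ψ X
  constructor
  · intro hX i
    have h1 := hretract hX i
    refine ⟨?_, (hsemi _).2 ⟨ψ, _, rfl, 0, by simpa using h1⟩⟩
    have h2 := hphase _ _ h1
    rw [Int.cast_zero, mul_zero, add_zero]
    exact h2
  · have hret : ∀ {X Y Z : LiftedObj R}, BinSplit Z X Y → Twist.pull (σ₁ := σ₁) T 0 ψ Z →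
        Twist.pull (σ₁ := σ₁) T 0 ψ X := fun s h => Twist.pull_of_binSplit (σ₁ := σ₁) T 0 hloc s h
    induction X using LiftedObj.induction with
    | zero X hX => exact fun _ => hP.zero_mem ψ hX
    | sum X Y Z s hX hY => exact fun h => hP.sum_mem s (hX (hret s h)) (hY (hret s.symm h))
    | single L =>
      intro h
      obtain ⟨h₁, h₂⟩ := (Twist.pull_lift_iff (σ₁ := σ₁) T 0).1 h
      obtain ⟨ψ', h₂⟩ := (hsemi _).1 h₂
      rw [Int.cast_zero, mul_zero, add_zero] at h₁
      rw [← h₁]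
      exact hmem L ψ' h₂

end FromLift

end CyclicStab

end

open CategoryTheory CategoryTheory.Limits CategoryTheory.Pretriangulated

noncomputable section

namespace CyclicStab

universe v u w w'

section Comparison

variable {C : Type u} [Category.{v} C] [HasZeroObject C] [Preadditive C] [HasShift C ℤ]
  [∀ n : ℤ, (shiftFunctor C n).Additive] [Pretriangulated C]
  {k : Type w} [Field k] [Linear k C] {β : shiftFunctor C (2 : ℤ) ≅ 𝟭 C}
  {Λ : Type w'} [AddCommGroup Λ] {v : K0 C (distTriang C) →+ Λ} {R : ChargeTriple k β v}


/-! ### Comparison of stability conditions -/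

lemma K0.hom_ext {D : Type u} [Category.{v} D] [Preadditive D] [HasShift D ℤ]
    {T : Set (Triangle D)} {A : Type*} [AddCommGroup A] {f g : K0 D T →+ A}
    (h : ∀ X, f (K0.of T X) = g (K0.of T X)) : f = g :=
  QuotientAddGroup.addMonoidHom_ext _ (FreeAbelianGroup.lift_ext _ _ h)

lemma K0.of_shift_even (X : C) (n : ℤ) :
    K0.of (distTriang C) (X⟦2 * n⟧) = K0.of (distTriang C) X := by
  have h1 : ∀ m : ℤ, K0.of (distTriang C) (X⟦m + 1⟧) = -K0.of (distTriang C) (X⟦m⟧) := fun m => by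
    rw [K0.of_iso ((shiftFunctorAdd C m 1).app X)]
    exact K0.of_shift _
  have h2 : ∀ m l : ℤ, l = m + 1 + 1 →
      K0.of (distTriang C) (X⟦l⟧) = K0.of (distTriang C) (X⟦m⟧) := by
    rintro m _ rfl
    rw [h1, h1, neg_neg]
  induction n using Int.induction_on with
  | zero => exact K0.of_iso ((shiftFunctorZero C ℤ).app X)
  | succ i ih => exact (h2 _ _ (by ring)).trans ih
  | pred i ih => exact (h2 _ _ (by ring)).symm.trans ih

lemma LiftedStability.evenShift_iff {τ τ' : LiftedStability R} : τ.EvenShift τ' ↔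
    ∃ n : ℤ, (∀ (φ : ℝ) (X : LiftedObj R), τ'.P φ X ↔ τ.P (φ - 2 * n) X) ∧ τ'.Z = τ.Z := by
  obtain ⟨g, hg⟩ := τ.factors
  refine exists_congr fun n => and_congr (forall_congr' fun φ => forall_congr' fun X => ?_) ?_
  · rw [τ.isPreslicing.shift_int (φ := φ - 2 * n) (2 * n)]
    push_cast
    rw [sub_add_cancel]
  · have hZ : ∀ X : LiftedObj R, τ.Z (K0.of _ (X⟦2 * n⟧)) = τ.Z (K0.of _ X) := by
      intro X
      rw [hg, AddMonoidHom.comp_apply, AddMonoidHom.comp_apply, AddMonoidHom.comp_apply,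
        AddMonoidHom.comp_apply, LiftedObj.π₀_of, LiftedObj.π₀_of]
      exact congrArg (fun x => g (v x)) (K0.of_shift_even X.obj n)
    simp only [hZ]
    exact ⟨K0.hom_ext, fun h X => by rw [h]⟩

namespace Twist

variable {σ₁ σ₂ : StabilityCondition k β v} (T₁ : Twist R σ₁.toChargeTriple)
  (T₂ : Twist R σ₂.toChargeTriple) {m₁ m₂ : ℤ}

lemma pull_sub (m n : ℤ) {φ : ℝ} {X : LiftedObj R} :
    T₁.pull m (φ - 2 * n) X ↔ T₁.pull (m + n) φ X := by
  refine forall_congr' fun i => and_congr_left fun _ => ?_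
  push_cast
  constructor <;> intro h <;> linarith

/-- Pullbacks agree if and only if the semistable objects are the same and, up to an even integer,
so are the twists on them. -/
lemma pull_eq_pull_iff : T₁.pull m₁ = T₂.pull m₂ ↔
    (∀ E, σ₁.Semistable E ↔ σ₂.Semistable E) ∧
      ∀ E, σ₁.Semistable E → T₁.η E + 2 * m₁ = T₂.η E + 2 * m₂ := by
  constructor
  · intro h
    let L : IndecObj C → LiftedIndec R := fun E => ⟨E, R.phase E, 0, by simp⟩
    have h₁ : ∀ E, σ₁.Semistable E → R.phase E + T₂.η E + 2 * m₂ = R.phase E + T₁.η E + 2 * m₁ ∧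
        σ₂.Semistable E := fun E hE => (T₂.pull_lift_iff m₂ (L := L E)).1
      (h ▸ (T₁.pull_lift_iff m₁ (L := L E)).2 ⟨rfl, hE⟩)
    have h₂ : ∀ E, σ₂.Semistable E → σ₁.Semistable E := fun E hE =>
      ((T₁.pull_lift_iff m₁ (L := L E)).1
        (h.symm ▸ (T₂.pull_lift_iff m₂ (L := L E)).2 ⟨rfl, hE⟩)).2
    exact ⟨fun E => ⟨fun hE => (h₁ E hE).2, h₂ E⟩, fun E hE => by linarith [(h₁ E hE).1]⟩
  · rintro ⟨h, hη⟩
    ext ψ X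
    refine forall_congr' fun i => ?_
    rw [← h]
    refine and_congr_left fun hi => ?_
    rw [add_assoc, add_assoc, hη _ hi]

/-- Stability conditions with the same pullback are equivalent. -/
theorem equivalent [Pretriangulated (LiftedObj R)] (hKS : IsKrullSchmidt C)
    (hT : distTriang (LiftedObj R) = LiftedObj.distinguished R)
    (hZ : σ₁.Z.comp (LiftedObj.π₀ R) = σ₂.Z.comp (LiftedObj.π₀ R))
    (h : T₁.pull m₁ = T₂.pull m₂) : σ₁.Equivalent σ₂ := by
  obtain ⟨hs, hη⟩ := (pull_eq_pull_iff T₁ T₂).1 h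
  have hphase : ∀ E, σ₁.Semistable E → σ₁.phase E = σ₂.phase E := by
    intro E hE
    obtain ⟨n₁, h₁⟩ := T₁.phase E
    obtain ⟨n₂, h₂⟩ := T₂.phase E
    exact congrArg Subtype.val (StabilityCondition.Ioc_ext (ψ := ⟨_, σ₁.phase_mem E⟩)
      (ψ' := ⟨_, σ₂.phase_mem E⟩) (m := m₁ - n₁) (m' := m₂ - n₂)
      (by push_cast; linarith [hη E hE]))
  have hQ : ∀ (X : LiftedObj R) (ψ : Set.Ioc (0 : ℝ) 2), σ₁.Q ψ X.obj ↔ σ₂.Q ψ X.obj := by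
    intro X
    induction X using LiftedObj.induction with
    | zero X hX =>
      exact fun ψ => iff_of_true (σ₁.zero_mem ψ _ (LiftedObj.isZero_obj hX))
        (σ₂.zero_mem ψ _ (LiftedObj.isZero_obj hX))
    | sum X Y Z s hX hY =>
      intro ψ
      rw [StabilityCondition.mem_of_binSplit (LiftedObj.mapBinSplit s),
        StabilityCondition.mem_of_binSplit (LiftedObj.mapBinSplit s), hX, hY]
    | single L =>
      intro ψ
      by_cases hL : σ₁.Semistable L.obj
      · exact (hL.mem_iff.trans (by rw [hphase _ hL])).trans ((hs _).1 hL).mem_iff.symm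
      · exact iff_of_false (fun h' => hL ⟨ψ, h'⟩) fun h' => hL ((hs _).2 ⟨ψ, h'⟩)
  refine ⟨⟨?_, K0.hom_ext fun X => ?_⟩, fun E F f => ?_, fun E F G hF hG =>
    T₁.isomorphic T₂ m₁ m₂ h hKS hT hF hG, fun ψ ψ' E F hE hF l a b ha hb => ?_⟩
  · ext ψ X
    obtain ⟨d⟩ := hKS.1 X
    exact hQ (.ofDecomposition d) ψ
  · obtain ⟨d⟩ := hKS.1 X
    have := DFunLike.congr_fun hZ (K0.of _ (.ofDecomposition d))
    rwa [AddMonoidHom.comp_apply, AddMonoidHom.comp_apply, LiftedObj.π₀_of] at this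
  · exact T₁.isHomogeneous_iff.symm.trans T₂.isHomogeneous_iff
  · have h₁ := (T₁.hasDegree_iff'.1 ha).unique (T₂.hasDegree_iff'.1 hb)
    have h₂ := hη E ⟨ψ, hE⟩
    have h₃ := hη F ⟨ψ', hF⟩
    linarith

/-- Equivalent stability conditions have the same pullbacks. -/
theorem exists_pull_eq (hR : R.q.Connective) (h : σ₁.Equivalent σ₂) (m₁ : ℤ) :
    ∃ m₂ : ℤ, T₁.pull m₁ = T₂.pull m₂ := by
  obtain ⟨⟨hQ, -⟩, -, -, hl⟩ := h
  have hs : ∀ E, σ₁.Semistable E ↔ σ₂.Semistable E := fun E =>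
    exists_congr fun ψ => by rw [hQ]
  by_cases he : ∃ E₀, σ₁.Semistable E₀
  · obtain ⟨E₀, ψ₀, h₀⟩ := he
    obtain ⟨n₁, h₁⟩ := T₁.phase E₀
    obtain ⟨n₂, h₂⟩ := T₂.phase E₀
    have e₁ := (σ₁.semistable ψ₀ E₀ h₀).1
    have e₂ := (σ₂.semistable ψ₀ E₀ (hQ ▸ h₀)).1
    refine ⟨m₁ + n₂ - n₁, (pull_eq_pull_iff T₁ T₂).2 ⟨hs, fun E ⟨ψ, hE⟩ => ?_⟩⟩
    obtain ⟨l, d, hd⟩ := hR E₀ E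
    have := hl ψ₀ ψ E₀ E h₀ hE l _ _ (T₁.hasDegree_iff.1 hd) (T₂.hasDegree_iff.1 hd)
    push_cast
    linarith
  · exact ⟨0, (pull_eq_pull_iff T₁ T₂).2 ⟨hs, fun E hE => absurd ⟨E, hE⟩ he⟩⟩

end Twist

/-! ### Bijections of quotients -/

section Quotients

variable {A B : Type*} {r : A → A → Prop} {s : B → B → Prop} {Rel : A → B → Prop}

lemma equivalence_of_correspondence (hB : ∀ y, ∃ x, Rel x y)
    (hr : ∀ {x y y'}, Rel x y → Rel x y' → s y y')
    (hs : ∀ {x y y'}, s y y' → Rel x y → Rel x y') : _root_.Equivalence s where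
  refl y :=
    let ⟨_, hx⟩ := hB y
    hr hx hx
  symm {y _} h :=
    let ⟨_, hx⟩ := hB y
    hr (hs h hx) hx
  trans {y _ _} h h' :=
    let ⟨_, hx⟩ := hB y
    hr hx (hs h' (hs h hx))

/-- A correspondence which is compatible with two relations, and single-valued up to them in both
directions, induces a bijection of quotients. -/
lemma exists_quot_equiv (hA : ∀ x, ∃ y, Rel x y) (hB : ∀ y, ∃ x, Rel x y)
    (hl : ∀ {x x' y}, Rel x y → Rel x' y → r x x')
    (hr : ∀ {x y y'}, Rel x y → Rel x y' → s y y')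
    (hr' : ∀ {x x' y}, r x x' → Rel x y → Rel x' y)
    (hs : ∀ {x y y'}, s y y' → Rel x y → Rel x y') :
    ∃ e : Quot r ≃ Quot s, ∀ x y, e (Quot.mk _ x) = Quot.mk _ y ↔ Rel x y := by
  choose f hf using hA
  have hmk : ∀ {y y'}, Quot.mk s y = Quot.mk s y' → s y y' := fun h =>
    (equivalence_of_correspondence hB hr hs).eqvGen_iff.1 (Quot.eqvGen_exact h)
  let F : Quot r → Quot s := Quot.lift (fun x => Quot.mk s (f x)) fun x x' h =>
    Quot.sound (hr (hr' h (hf x)) (hf x'))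
  have hF : ∀ x y, F (Quot.mk _ x) = Quot.mk _ y ↔ Rel x y := fun x y =>
    ⟨fun h => hs (hmk h) (hf x), fun h => Quot.sound (hr (hf x) h)⟩
  refine ⟨Equiv.ofBijective F ⟨?_, ?_⟩, hF⟩
  · rintro ⟨x⟩ ⟨x'⟩ h
    exact Quot.sound (hl ((hF x _).1 h) (hf x'))
  · rintro ⟨y⟩
    obtain ⟨x, hx⟩ := hB y
    exact ⟨Quot.mk _ x, (hF x y).2 hx⟩

end Quotients

end Comparison

end CyclicStab

end

open CategoryTheory CategoryTheory.Limits CategoryTheory.Pretriangulated CyclicStab in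
theorem mainTheorem3 {k : Type*} [Field k] {C : Type*} [Category* C] [HasZeroObject C]
    [Preadditive C] [Linear k C] [HasShift C ℤ] [∀ n : ℤ, (shiftFunctor C n).Additive]
    [∀ n : ℤ, (shiftFunctor C n).Linear k] [Pretriangulated C] [IsTriangulated C]
    (hKS : IsKrullSchmidt C) (β : shiftFunctor C (2 : ℤ) ≅ 𝟭 C)
    {Λ : Type*} [AddCommGroup Λ] [Module.Free ℤ Λ] [Module.Finite ℤ Λ]
    (v : K0 C (distTriang C) →+ Λ)
    (σ : StabilityCondition k β v) (hconn : σ.q.Connective) (hlift : σ.q.IsLiftable) :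
    -- the `ℤ`-lift is (pre)triangulated
    (∃ T : Pretriangulated (LiftedObj σ.toChargeTriple),
      T.distinguishedTriangles = LiftedObj.distinguished σ.toChargeTriple) ∧
    -- the equivalence relation of good stability conditions applies to the deformation class
    (∀ σ₁ : σ.DeformationClass, σ₁.1.Good) ∧
    _root_.Equivalence (fun σ₁ σ₂ : σ.DeformationClass => σ₁.1.Equivalent σ₂.1) ∧
    ∃ e : Quot (BridgelandStability.EvenShift (T := LiftedObj.distinguished σ.toChargeTriple)
          (v := v.comp (LiftedObj.π₀ σ.toChargeTriple))) ≃
        Quot (fun σ₁ σ₂ : σ.DeformationClass => σ₁.1.Equivalent σ₂.1),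
      ∀ (τ : LiftedStability σ.toChargeTriple) (σ₁ : σ.DeformationClass),
        e (Quot.mk _ τ) = Quot.mk _ σ₁ ↔
          ∃ H : LiftEquivalence σ.toChargeTriple σ₁.1.toChargeTriple,
            LiftedStability.IsPullback τ σ₁.1 H := by
  let R := σ.toChargeTriple
  let inst : Pretriangulated (LiftedObj R) := LiftedObj.pretriangulated R hlift.1 hlift.2
  have hT : distTriang (LiftedObj R) = LiftedObj.distinguished R := rfl
  have twist : ∀ σ₁ : σ.DeformationClass, Nonempty (Twist R σ₁.1.toChargeTriple) :=
    fun σ₁ => σ₁.2.exists_twist hconn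
  let Rel : LiftedStability R → σ.DeformationClass → Prop := fun τ σ₁ =>
    ∃ H : LiftEquivalence R σ₁.1.toChargeTriple, LiftedStability.IsPullback τ σ₁.1 H
  have rel_iff : ∀ {τ : LiftedStability R} {σ₁ : σ.DeformationClass}
      (T : Twist R σ₁.1.toChargeTriple), Rel τ σ₁ ↔
        τ.Z = σ₁.1.Z.comp (LiftedObj.π₀ R) ∧ ∃ m : ℤ, τ.P = T.pull m :=
    fun T => LiftedStability.exists_isPullback_iff T hconn
  have hA : ∀ τ, ∃ σ₁, Rel τ σ₁ := fun τ => by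
    obtain ⟨σ₁, T, hZ, hP⟩ := LiftedStability.exists_stabilityCondition τ hKS hT hlift.1
    exact ⟨⟨σ₁, T.deformationEquivalent⟩, (rel_iff T).2 ⟨hZ, 0, hP⟩⟩
  have hB : ∀ σ₁, ∃ τ, Rel τ σ₁ := fun σ₁ => by
    obtain ⟨T⟩ := twist σ₁
    obtain ⟨τ, hZ, hP⟩ := T.exists_liftedStability 0 hKS hT
    exact ⟨τ, (rel_iff T).2 ⟨hZ, 0, hP⟩⟩
  have hr : ∀ {τ : LiftedStability R} {σ₁ σ₂ : σ.DeformationClass}, Rel τ σ₁ → Rel τ σ₂ →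
      σ₁.1.Equivalent σ₂.1 := fun {τ σ₁ σ₂} h₁ h₂ => by
    obtain ⟨T₁⟩ := twist σ₁
    obtain ⟨T₂⟩ := twist σ₂
    obtain ⟨hZ₁, m₁, hP₁⟩ := (rel_iff T₁).1 h₁
    obtain ⟨hZ₂, m₂, hP₂⟩ := (rel_iff T₂).1 h₂
    exact T₁.equivalent T₂ hKS hT (hZ₁.symm.trans hZ₂) (hP₁.symm.trans hP₂)
  have hs : ∀ {τ : LiftedStability R} {σ₁ σ₂ : σ.DeformationClass}, σ₁.1.Equivalent σ₂.1 →
      Rel τ σ₁ → Rel τ σ₂ := fun {τ σ₁ σ₂} h h₁ => by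
    obtain ⟨T₁⟩ := twist σ₁
    obtain ⟨T₂⟩ := twist σ₂
    obtain ⟨hZ, m₁, hP⟩ := (rel_iff T₁).1 h₁
    obtain ⟨m₂, hm⟩ := T₁.exists_pull_eq T₂ hconn h m₁
    exact (rel_iff T₂).2 ⟨by rw [hZ, h.1.2], m₂, hP.trans hm⟩
  have hl : ∀ {τ τ' : LiftedStability R} {σ₁ : σ.DeformationClass}, Rel τ σ₁ → Rel τ' σ₁ →
      τ.EvenShift τ' := fun {τ τ' σ₁} h h' => by
    obtain ⟨T⟩ := twist σ₁
    obtain ⟨hZ, m, hP⟩ := (rel_iff T).1 h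
    obtain ⟨hZ', m', hP'⟩ := (rel_iff T).1 h'
    refine LiftedStability.evenShift_iff.2 ⟨m' - m, fun φ X => ?_, hZ'.trans hZ.symm⟩
    rw [hP, hP', T.pull_sub, add_sub_cancel]
  have hr' : ∀ {τ τ' : LiftedStability R} {σ₁ : σ.DeformationClass}, τ.EvenShift τ' →
      Rel τ σ₁ → Rel τ' σ₁ := fun {τ τ' σ₁} h h₁ => by
    obtain ⟨T⟩ := twist σ₁
    obtain ⟨hZ, m, hP⟩ := (rel_iff T).1 h₁
    obtain ⟨n, hn, hZ'⟩ := LiftedStability.evenShift_iff.1 h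
    refine (rel_iff T).2 ⟨hZ'.trans hZ, m + n, ?_⟩
    ext φ X
    rw [hn, hP, T.pull_sub]
  exact ⟨⟨inst, rfl⟩, fun σ₁ => let ⟨T⟩ := twist σ₁; T.good hKS hT,
    equivalence_of_correspondence hB hr hs, exists_quot_equiv hA hB hl hr hr' hs⟩
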